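/- **Setting.** Let $g,m,l>0$, $\omega\in\mathbb R$, $I_-=(-m,0)$, $I_+=(0,l)$, $\Omega_\pm=\mathbb R^2\times I_\pm$. Let $p_\pm\in C^\infty(0,\infty)$ be nonnegative and strictly increasing with $1/p_\pm'\in L^\infty_{\rm loc}(0,\infty)$, and let $\rho_0$ be smooth on each of $I_\pm$, bounded above and below by positive constants, with $(p_\pm(\rho_0))'=-g\rho_0$ on $I_\pm$ and with one-sided limits $\rho_0^\pm$ at $0$ satisfying $p_+(\rho_0^+)=p_-(\rho_0^-)$ and $\rho_0^+>\rho_0^-$. Write $p'(\rho_0)$ for $p_\pm'(\rho_0)$ on $I_\pm$ and $\llbracket h\rrbracket=h|_{0^+}-h|_{0^-}$. The *linearized problem* for $(\eta,v,q)$ on $\Omega_\pm$, $t\ge 0$, is $$\partial_t\eta=v,\quad \partial_tq+\rho_0\,\mathrm{div}\,v=0,\quad \rho_0\partial_tv+\nabla(p'(\rho_0)q)=-gqe_3-g\rho_0\nabla\eta_3+2\rho_0\omega v_2e_1-2\rho_0\omega v_1e_2,$$ with $\llbracket v_3\rrbracket=0$, $\llbracket p'(\rho_0)q\rrbracket=0$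 at $x_3=0$ and $v_3=0$ at $x_3=-m$ and $x_3=l$. For $r>0$ let $-\lambda(r)^2$ (with $\lambda(r)>0$, when the infimum is negative) be the infimum of $$E(\varphi,\psi)=\tfrac12\int_{-m}^l p'(\rho_0)\rho_0(\psi'+r\varphi)^2-2gr\rho_0\psi\varphi+4\omega^2\rho_0\varphi^2\,dx_3$$ over $(\varphi,\psi)\in L^2(-m,l)\times H^1_0(-m,l)$ with $J(\varphi,\psi)=\frac12\int_{-m}^l\rho_0(\varphi^2+\psi^2)\,dx_3=1$. Given $R_0>1$, a *family of normal modes for $|\xi|>R_0$* consists of such $\lambda(|\xi|)>0$ and real functions $\varphi,\theta,\psi$ of $(\xi,x_3)$, measurable in $\xi$ and smooth in $x_3$ on each of $I_\pm$, which for every $|\xi|>R_0$ and $\lambda=\lambda(|\xi|)$ satisfy $$\begin{aligned} \lambda^2\rho_0\varphi+\xi_1p'(\rho_0)\rho_0(\xi_1\varphi+\xi_2\theta+\psi')&=\xi_1g\rho_0\psi+2\lambda\omega\rho_0\theta,\\ \lambda^2\rho_0\theta+\xi_2p'(\rho_0)\rho_0(\xi_1\varphi+\xi_2\theta+\psi')&=\xi_2g\rho_0\psi-2\lambda\omega\rho_0\varphi,\\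 \lambda^2\rho_0\psi-[p'(\rho_0)\rho_0(\xi_1\varphi+\xi_2\theta+\psi')]'&=g\rho_0(\xi_1\varphi+\xi_2\theta) \end{aligned}$$ on $I_\pm$, with $\llbracket\psi\rrbracket=\llbracket p'(\rho_0)\rho_0(\xi_1\varphi+\xi_2\theta+\psi')\rrbracket=0$ and $\psi(-m)=\psi(l)=0$; which are rotation equivariant, i.e. $(\varphi,\theta)(\mathcal R\xi,\cdot)=\mathcal R\,(\varphi,\theta)(\xi,\cdot)$ and $\psi(\mathcal R\xi,\cdot)=\psi(\xi,\cdot)$ for $\mathcal R\in SO(2)$; which satisfy $J(\varphi,\psi)=1$ at the frequencies $(|\xi|,0)$; and which are set to zero, together with $\lambda$, for $|\xi|\le R_0$. For $k\in\mathbb N$, let $$\|h\|_{H^k}^2=\sum_{\pm}\sum_{j=0}^k\int_{I_\pm}\int_{\mathbb R^2}(1+|\xi|^2)^{k-j}|\partial_{x_3}^j\hat h(\xi,x_3)|^2\,d\xi\,dx_3,\qquad \hat h(\xi,x_3)=\int_{\mathbb R^2}h(x',x_3)e^{-ix'\cdot\xi}dx',$$ the derivatives being weak derivatives on $I_\pm$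 and $\hat h$ the $L^2$ (Plancherel) transform; for vector fields sum the squares over the components. **Theorem.** There are constants $R_0>1$, $C_4>0$ with $C_4R_0\ge2$, and $\bar C_k>0$ $(k\in\mathbb N)$, depending only on $\rho_0,p_\pm,g,\omega,l,m$, such that a family of normal modes for $|\xi|>R_0$ exists, and for every such family the following holds. Let $R_0\le R_3<R_4<\infty$ and let $f\in C_c^\infty(\mathbb R^2)$ be real-valued and radial with support in $\{R_3\le|\xi|\le R_4\}$. Put $\hat w=-i\varphi e_1-i\theta e_2+\psi e_3$ and, for $t\ge0$, $x_3\in I_\pm$, $$\begin{aligned} \eta(t,x)&=\frac1{4\pi^2}\int_{\mathbb R^2}f(\xi)\hat w(\xi,x_3)e^{\lambda(|\xi|)t}e^{ix'\cdot\xi}d\xi,\\ v(t,x)&=\frac1{4\pi^2}\int_{\mathbb R^2}\lambda(|\xi|)f(\xi)\hat w(\xi,x_3)e^{\lambda(|\xi|)t}e^{ix'\cdot\xi}d\xi,\\ q(t,x)&=-\frac{\rho_0(x_3)}{4\pi^2}\int_{\mathbb R^2}f(\xi)(\xi_1\varphi+\xi_2\theta+\partial_{x_3}\psi)(\xi,x_3)\,e^{\lambda(|\xi|)t}e^{ix'\cdot\xi}d\xi.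 \end{aligned}$$ These integrals converge absolutely, and $\eta,v,q$ are real-valued classical ($C^1$ on $[0,\infty)\times\Omega_\pm$) solutions of the linearized problem with its jump and boundary conditions. For every $k\in\mathbb N$, $$\|\eta(0)\|_{H^k}+\|v(0)\|_{H^k}+\|q(0)\|_{H^k}\le\bar C_k\left(\int_{\mathbb R^2}(1+|\xi|^2)^{k+1}|f(\xi)|^2d\xi\right)^{1/2}<\infty,$$ and for every $t>0$ and $k\in\mathbb N$ one has $\eta(t),v(t),q(t)\in H^k$ and, for each $u\in\{\eta,v,q\}$, $$e^{t\sqrt{C_4R_3-1}}\|u(0)\|_{H^k}\le\|u(t)\|_{H^k}\le e^{t\sqrt{gR_4}}\|u(0)\|_{H^k}.$$ -/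

import Mathlib

open Set Filter Topology MeasureTheory
open scoped ContDiff ENNReal SchwartzMap

namespace RTI

noncomputable section

/-- The horizontal plane: both the horizontal variable `x'` and the frequency `ξ` live here. -/
abbrev Plane : Type := EuclideanSpace ℝ (Fin 2)

/-- A barotropic pressure law on `(0,∞)`: nonnegative, smooth, strictly increasing, and with
`1/p'` locally bounded on `(0,∞)`. -/
structure IsPressureLaw (p : ℝ → ℝ) : Prop where
  smooth : ContDiffOn ℝ ∞ p (Ioi 0)
  nonneg : ∀ z, 0 < z → 0 ≤ p z
  strictMono : StrictMonoOn p (Ioi 0)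
  inv_deriv_bdd : ∀ a b : ℝ, 0 < a → a ≤ b → ∃ c > 0, ∀ z ∈ Icc a b, c ≤ deriv p z

/-- The physical parameters together with a steady state `ρ` in which the denser fluid lies on top.
`ρPlus` and `ρMinus` are the traces of `ρ` at the interface `{x₃ = 0}`. -/
structure Config where
  /-- gravitational constant -/
  g : ℝ
  /-- angular velocity about the vertical axis -/
  om : ℝ
  /-- depth of the lower layer -/
  m : ℝ
  /-- height of the upper layer -/
  l : ℝ
  /-- pressure law of the upper fluid -/
  pPlus : ℝ → ℝ
  /-- pressure law of the lower fluid -/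
  pMinus : ℝ → ℝ
  /-- steady-state density as a function of the vertical variable -/
  ρ : ℝ → ℝ
  /-- trace of the density at the interface from above -/
  ρPlus : ℝ
  /-- trace of the density at the interface from below -/
  ρMinus : ℝ
  g_pos : 0 < g
  m_pos : 0 < m
  l_pos : 0 < l
  pPlus_law : IsPressureLaw pPlus
  pMinus_law : IsPressureLaw pMinus
  ρ_bounds : ∃ a b : ℝ, 0 < a ∧ ∀ z ∈ Ioo (-m) 0 ∪ Ioo 0 l, a ≤ ρ z ∧ ρ z ≤ b
  ρ_smooth_plus : ContDiffOn ℝ ∞ ρ (Ioo 0 l)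
  ρ_smooth_minus : ContDiffOn ℝ ∞ ρ (Ioo (-m) 0)
  hydrostatic_plus : ∀ z ∈ Ioo 0 l, HasDerivAt (fun s => pPlus (ρ s)) (-g * ρ z) z
  hydrostatic_minus : ∀ z ∈ Ioo (-m) 0, HasDerivAt (fun s => pMinus (ρ s)) (-g * ρ z) z
  ρ_trace_plus : Tendsto ρ (𝓝[>] 0) (𝓝 ρPlus)
  ρ_trace_minus : Tendsto ρ (𝓝[<] 0) (𝓝 ρMinus)
  pressure_jump : pPlus ρPlus = pMinus ρMinus
  density_jump : ρMinus < ρPlus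

/-- `u` has the same trace at the interface `0` from above and from below. -/
def NoJump (u : ℝ → ℝ) : Prop :=
  ∃ a : ℝ, Tendsto u (𝓝[>] 0) (𝓝 a) ∧ Tendsto u (𝓝[<] 0) (𝓝 a)

namespace Config

variable (P : Config)

/-- The vertical interval of the upper layer. -/
def upper : Set ℝ := Ioo 0 P.l

/-- The vertical interval of the lower layer. -/
def lower : Set ℝ := Ioo (-P.m) 0

/-- The vertical positions inside one of the two fluids. -/
def layers : Set ℝ := P.lower ∪ P.upper

/-- The coefficient `p'(ρ₀)`, i.e. `p₊'(ρ₀)` in the upper and `p₋'(ρ₀)` in the lower layer. -/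
def dp (z : ℝ) : ℝ :=
  if 0 < z then deriv P.pPlus (P.ρ z) else deriv P.pMinus (P.ρ z)

/-- `u` vanishes (in the sense of traces) on the two rigid planes `x₃ = -m` and `x₃ = l`. -/
def VanishesAtWalls (u : ℝ → ℝ) : Prop :=
  Tendsto u (𝓝[>] (-P.m)) (𝓝 0) ∧ Tendsto u (𝓝[<] P.l) (𝓝 0)

/-! ### The linearized equations -/

/-- Time derivative on `t ≥ 0` (one-sided at `t = 0`). -/
def dt (u : ℝ → Plane → ℝ → ℝ) (t : ℝ) (x : Plane) (z : ℝ) : ℝ :=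
  derivWithin (fun τ => u τ x z) (Ici 0) t

/-- Horizontal partial derivative in the direction of the `j`-th coordinate. -/
def dh (j : Fin 2) (u : ℝ → Plane → ℝ → ℝ) (t : ℝ) (x : Plane) (z : ℝ) : ℝ :=
  lineDeriv ℝ (fun y => u t y z) x (EuclideanSpace.single j 1)

/-- Vertical partial derivative. -/
def dz (u : ℝ → Plane → ℝ → ℝ) (t : ℝ) (x : Plane) (z : ℝ) : ℝ :=
  deriv (fun s => u t x s) z

/-- `u` is continuously differentiable on `[0,∞) × Ω₊` and on `[0,∞) × Ω₋`. -/
def IsC1 (u : ℝ → Plane → ℝ → ℝ) : Prop :=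
  ContDiffOn ℝ 1 (fun y : ℝ × Plane × ℝ => u y.1 y.2.1 y.2.2)
    (Ici 0 ×ˢ ((univ : Set Plane) ×ˢ P.layers))

/-- Classical solutions `(η, v, q)` of the linearized problem: the equations hold in both layers
for all `t ≥ 0`, together with the jump conditions at `x₃ = 0` and the conditions at the walls.
The components `0, 1, 2` of a vector are its components along `e₁, e₂, e₃`. -/
structure IsLinearSolution (η v : Fin 3 → ℝ → Plane → ℝ → ℝ) (q : ℝ → Plane → ℝ → ℝ) :
    Prop where
  η_C1 : ∀ i, P.IsC1 (η i)
  v_C1 : ∀ i, P.IsC1 (v i)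
  q_C1 : P.IsC1 q
  displacement : ∀ i, ∀ t ≥ 0, ∀ x, ∀ z ∈ P.layers, dt (η i) t x z = v i t x z
  mass : ∀ t ≥ 0, ∀ x, ∀ z ∈ P.layers,
    dt q t x z + P.ρ z * (dh 0 (v 0) t x z + dh 1 (v 1) t x z + dz (v 2) t x z) = 0
  momentum₁ : ∀ t ≥ 0, ∀ x, ∀ z ∈ P.layers,
    P.ρ z * dt (v 0) t x z + dh 0 (fun τ y s => P.dp s * q τ y s) t x z
      = -P.g * P.ρ z * dh 0 (η 2) t x z + 2 * P.ρ z * P.om * v 1 t x z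
  momentum₂ : ∀ t ≥ 0, ∀ x, ∀ z ∈ P.layers,
    P.ρ z * dt (v 1) t x z + dh 1 (fun τ y s => P.dp s * q τ y s) t x z
      = -P.g * P.ρ z * dh 1 (η 2) t x z - 2 * P.ρ z * P.om * v 0 t x z
  momentum₃ : ∀ t ≥ 0, ∀ x, ∀ z ∈ P.layers,
    P.ρ z * dt (v 2) t x z + dz (fun τ y s => P.dp s * q τ y s) t x z
      = -P.g * q t x z - P.g * P.ρ z * dz (η 2) t x z
  jump_velocity : ∀ t ≥ 0, ∀ x, NoJump (fun z => v 2 t x z)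
  jump_pressure : ∀ t ≥ 0, ∀ x, NoJump (fun z => P.dp z * q t x z)
  walls : ∀ t ≥ 0, ∀ x, P.VanishesAtWalls (fun z => v 2 t x z)

/-! ### Variational description of the growth rate -/

/-- `ψ ∈ H₀¹(-m,l)` with weak derivative `χ`: `ψ` is the primitive of the square integrable
function `χ` that vanishes at both end points. -/
def IsH10 (ψ χ : ℝ → ℝ) : Prop :=
  MemLp χ 2 (volume.restrict (Ioo (-P.m) P.l)) ∧
    (∀ z ∈ Icc (-P.m) P.l, ψ z = ∫ s in (-P.m)..z, χ s) ∧ ψ P.l = 0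

/-- The constraint functional `J(φ,ψ) = ½ ∫ ρ₀ (φ² + ψ²)`. -/
def J (φ ψ : ℝ → ℝ) : ℝ :=
  (1 / 2) * ∫ z in Ioo (-P.m) P.l, P.ρ z * (φ z ^ 2 + ψ z ^ 2)

/-- The energy
`E(φ,ψ) = ½ ∫ p'(ρ₀)ρ₀(ψ' + rφ)² - 2 g r ρ₀ ψ φ + 4 ω² ρ₀ φ²` at the frequency `r = |ξ|`;
`χ` stands for `ψ'`. -/
def energy (r : ℝ) (φ ψ χ : ℝ → ℝ) : ℝ :=
  (1 / 2) * ∫ z in Ioo (-P.m) P.l,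
    (P.dp z * P.ρ z * (χ z + r * φ z) ^ 2 - 2 * P.g * r * P.ρ z * ψ z * φ z
      + 4 * P.om ^ 2 * P.ρ z * φ z ^ 2)

/-- The values of the energy on `{(φ,ψ) ∈ L²(-m,l) × H₀¹(-m,l) : J(φ,ψ) = 1}`. -/
def energyValues (r : ℝ) : Set ℝ :=
  {e | ∃ φ ψ χ : ℝ → ℝ, MemLp φ 2 (volume.restrict (Ioo (-P.m) P.l)) ∧ P.IsH10 ψ χ ∧
    P.J φ ψ = 1 ∧ e = P.energy r φ ψ χ}

/-! ### Normal modes -/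

/-- The quantity `p'(ρ₀)ρ₀(ξ₁φ + ξ₂θ + ψ')`. -/
def flux (ξ : Plane) (φ θ ψ : ℝ → ℝ) (z : ℝ) : ℝ :=
  P.dp z * P.ρ z * (ξ 0 * φ z + ξ 1 * θ z + deriv ψ z)

/-- `(φ,θ,ψ)` is a normal mode with growth rate `lam` at the frequency `ξ`: it is smooth in each
layer and solves the system of ordinary differential equations, jump conditions and boundary
conditions obtained from the linearized problem by inserting `η = w e^{λt}`, `v = λ w e^{λt}`,
`q = -ρ₀ div w e^{λt}` with `w = (-iφ, -iθ, ψ) e^{i x'·ξ}`. -/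
structure IsNormalMode (ξ : Plane) (lam : ℝ) (φ θ ψ : ℝ → ℝ) : Prop where
  smooth_φ : ContDiffOn ℝ ∞ φ P.layers
  smooth_θ : ContDiffOn ℝ ∞ θ P.layers
  smooth_ψ : ContDiffOn ℝ ∞ ψ P.layers
  eq₁ : ∀ z ∈ P.layers,
    lam ^ 2 * P.ρ z * φ z + ξ 0 * P.flux ξ φ θ ψ z
      = ξ 0 * P.g * P.ρ z * ψ z + 2 * lam * P.om * P.ρ z * θ z
  eq₂ : ∀ z ∈ P.layers,
    lam ^ 2 * P.ρ z * θ z + ξ 1 * P.flux ξ φ θ ψ z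
      = ξ 1 * P.g * P.ρ z * ψ z - 2 * lam * P.om * P.ρ z * φ z
  eq₃ : ∀ z ∈ P.layers,
    lam ^ 2 * P.ρ z * ψ z - deriv (P.flux ξ φ θ ψ) z
      = P.g * P.ρ z * (ξ 0 * φ z + ξ 1 * θ z)
  jump_ψ : NoJump ψ
  jump_flux : NoJump (P.flux ξ φ θ ψ)
  walls : P.VanishesAtWalls ψ

end Config

/-- The vector of the plane with coordinates `a`, `b`. -/
def vec (a b : ℝ) : Plane := !₂[a, b]

/-- Rotation of the plane by the angle `α`. -/
def rot (α : ℝ) (ξ : Plane) : Plane :=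
  vec (Real.cos α * ξ 0 - Real.sin α * ξ 1) (Real.sin α * ξ 0 + Real.cos α * ξ 1)

/-- Data of a family of modes: a growth rate depending on `|ξ|`, and profiles depending on
the frequency `ξ` and on the vertical variable. -/
structure ModeFamily where
  /-- growth rate as a function of `|ξ|` -/
  lam : ℝ → ℝ
  /-- first horizontal profile -/
  φ : Plane → ℝ → ℝ
  /-- second horizontal profile -/
  θ : Plane → ℝ → ℝ
  /-- vertical profile -/
  ψ : Plane → ℝ → ℝ

/-- `M` is a family of normalized growing normal modes for the frequencies `|ξ| > R₀`, extended by
zero to `|ξ| ≤ R₀`. For `|ξ| > R₀` the growth rate `lam |ξ| > 0` is given by the variational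
principle `-lam² = inf E`, the profiles at `ξ` are a normal mode with this growth rate, they are
equivariant under rotations, normalized by `J = 1` at the frequency `(|ξ|, 0)`,
and depend measurably on the frequency. -/
structure Config.IsNormalModeFamily (P : Config) (R₀ : ℝ) (M : ModeFamily) : Prop where
  lam_pos : ∀ r > R₀, 0 < M.lam r
  lam_variational : ∀ r > R₀, IsGLB (P.energyValues r) (-(M.lam r) ^ 2)
  mode : ∀ ξ : Plane, R₀ < ‖ξ‖ → P.IsNormalMode ξ (M.lam ‖ξ‖) (M.φ ξ) (M.θ ξ) (M.ψ ξ)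
  normalized : ∀ r > R₀, P.J (M.φ (vec r 0)) (M.ψ (vec r 0)) = 1
  rot_φ : ∀ (α : ℝ) (ξ : Plane), R₀ < ‖ξ‖ → ∀ z ∈ P.layers,
    M.φ (rot α ξ) z = Real.cos α * M.φ ξ z - Real.sin α * M.θ ξ z
  rot_θ : ∀ (α : ℝ) (ξ : Plane), R₀ < ‖ξ‖ → ∀ z ∈ P.layers,
    M.θ (rot α ξ) z = Real.sin α * M.φ ξ z + Real.cos α * M.θ ξ z
  rot_ψ : ∀ (α : ℝ) (ξ : Plane), R₀ < ‖ξ‖ → ∀ z ∈ P.layers, M.ψ (rot α ξ) z = M.ψ ξ z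
  meas_φ : ∀ z ∈ P.layers, Measurable (fun ξ => M.φ ξ z)
  meas_θ : ∀ z ∈ P.layers, Measurable (fun ξ => M.θ ξ z)
  meas_ψ : ∀ z ∈ P.layers, Measurable (fun ξ => M.ψ ξ z)
  zero_lam : ∀ r ≤ R₀, M.lam r = 0
  zero_φ : ∀ ξ : Plane, ‖ξ‖ ≤ R₀ → ∀ z, M.φ ξ z = 0
  zero_θ : ∀ ξ : Plane, ‖ξ‖ ≤ R₀ → ∀ z, M.θ ξ z = 0
  zero_ψ : ∀ ξ : Plane, ‖ξ‖ ≤ R₀ → ∀ z, M.ψ ξ z = 0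

/-! ### Fourier synthesis -/

/-- `(4π²)⁻¹ ∫ G(ξ) e^{i x'·ξ} dξ`. -/
def synth (G : Plane → ℂ) (x : Plane) : ℂ :=
  (1 / (4 * (Real.pi : ℂ) ^ 2)) *
    ∫ ξ : Plane, G ξ * Complex.exp (Complex.I * ((inner ℝ x ξ : ℝ) : ℂ))

namespace ModeFamily

variable (M : ModeFamily) (f : Plane → ℝ)

/-- `ŵ = -iφ e₁ - iθ e₂ + ψ e₃`. -/
def wHat (i : Fin 3) (ξ : Plane) (z : ℝ) : ℂ :=
  ![-Complex.I * (M.φ ξ z : ℂ), -Complex.I * (M.θ ξ z : ℂ), (M.ψ ξ z : ℂ)] i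

/-- The amplitude `f ŵ e^{λt}` of the flow map. -/
def etaHat (i : Fin 3) (t z : ℝ) (ξ : Plane) : ℂ :=
  (f ξ : ℂ) * M.wHat i ξ z * (Real.exp (M.lam ‖ξ‖ * t) : ℂ)

/-- The amplitude `λ f ŵ e^{λt}` of the velocity. -/
def vHat (i : Fin 3) (t z : ℝ) (ξ : Plane) : ℂ :=
  (M.lam ‖ξ‖ : ℂ) * (f ξ : ℂ) * M.wHat i ξ z * (Real.exp (M.lam ‖ξ‖ * t) : ℂ)

/-- The amplitude `-ρ₀ f (ξ₁φ + ξ₂θ + ∂₃ψ) e^{λt}` of the density. -/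
def qHat (P : Config) (t z : ℝ) (ξ : Plane) : ℂ :=
  ((-P.ρ z * f ξ * (ξ 0 * M.φ ξ z + ξ 1 * M.θ ξ z + deriv (M.ψ ξ) z)
    * Real.exp (M.lam ‖ξ‖ * t) : ℝ) : ℂ)

end ModeFamily

/-! ### Piecewise Sobolev norms -/

/-- `U` is the Fourier transform `∫ u(x) e^{-i x·ξ} dx` of `u ∈ L²(ℝ²)` (Plancherel transform,
characterized by the multiplication formula against Schwartz functions). -/
def IsFourier (u U : Plane → ℂ) : Prop :=
  MemLp u 2 volume ∧ MemLp U 2 volume ∧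
    ∀ χ : 𝓢(Plane, ℂ), ∫ ξ, U ξ * χ ξ =
      ∫ x, u x * ∫ ξ, χ ξ * Complex.exp (-Complex.I * ((inner ℝ x ξ : ℝ) : ℂ))

/-- `V` is the weak derivative of `U` on the open interval `I`. -/
def IsWeakDeriv (I : Set ℝ) (U V : ℝ → ℂ) : Prop :=
  LocallyIntegrableOn U I ∧ LocallyIntegrableOn V I ∧
    ∀ χ : ℝ → ℝ, ContDiff ℝ ∞ χ → HasCompactSupport χ → tsupport χ ⊆ I →
      ∫ z in I, U z * ((deriv χ z : ℝ) : ℂ) = -∫ z in I, V z * (χ z : ℂ)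

/-- `D j` is, for `j ≤ k`, the weak derivative `∂₃ʲ û` of the horizontal Fourier transform of
the function `u` on `ℝ² × I`. -/
structure IsTransformJet (I : Set ℝ) (k : ℕ) (u : Plane → ℝ → ℂ) (D : ℕ → Plane → ℝ → ℂ) :
    Prop where
  meas_u : AEStronglyMeasurable (fun y : Plane × ℝ => u y.1 y.2)
    (volume.restrict ((univ : Set Plane) ×ˢ I))
  meas_D : ∀ j ≤ k, AEStronglyMeasurable (fun y : Plane × ℝ => D j y.1 y.2)
    (volume.restrict ((univ : Set Plane) ×ˢ I))
  fourier : ∀ᵐ z ∂(volume.restrict I), IsFourier (fun x => u x z) (fun ξ => D 0 ξ z)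
  weakDeriv : ∀ j < k, ∀ᵐ ξ : Plane, IsWeakDeriv I (D j ξ) (D (j + 1) ξ)

/-- The square of the `Hᵏ(ℝ² × I)` norm,
`∑_{j ≤ k} ∫_I ∫ (1+|ξ|²)^{k-j} |∂₃ʲ û(ξ,x₃)|² dξ dx₃ ∈ [0,∞]`; the jet `∂₃ʲ û` is unique up to null
sets, and the value is `∞` if it does not exist. -/
def hkSq (I : Set ℝ) (k : ℕ) (u : Plane → ℝ → ℂ) : ℝ≥0∞ :=
  ⨅ (D : ℕ → Plane → ℝ → ℂ) (_ : IsTransformJet I k u D),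
    ∑ j ∈ Finset.range (k + 1), ∫⁻ z in I, ∫⁻ ξ : Plane,
      ENNReal.ofReal ((1 + ‖ξ‖ ^ 2) ^ (k - j)) * ‖D j ξ z‖ₑ ^ 2

namespace Config

variable (P : Config)

/-- The piecewise Sobolev norm of a real function on `Ω`; it is finite exactly on `Hᵏ(Ω)`. -/
def hkNorm (k : ℕ) (u : Plane → ℝ → ℝ) : ℝ≥0∞ :=
  (hkSq P.upper k (fun x z => (u x z : ℂ)) + hkSq P.lower k (fun x z => (u x z : ℂ)))
    ^ (1 / 2 : ℝ)

/-- The piecewise Sobolev norm of a vector field on `Ω`. -/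
def hkNormVec (k : ℕ) (u : Fin 3 → Plane → ℝ → ℝ) : ℝ≥0∞ :=
  (∑ i, P.hkNorm k (u i) ^ 2) ^ (1 / 2 : ℝ)

end Config

/-- `a N₀ ≤ N ≤ b N₀` for two finite norms. -/
def TwoSided (a b : ℝ) (N₀ N : ℝ≥0∞) : Prop :=
  N₀ < ⊤ ∧ N < ⊤ ∧ ENNReal.ofReal a * N₀ ≤ N ∧ N ≤ ENNReal.ofReal b * N₀

end

end RTI

open Set Filter Topology MeasureTheory
open scoped ContDiff ENNReal SchwartzMap

/-! Reduction to an ODE. The two horizontal mode equations are algebraic in (φ, θ). Eliminating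
these leaves a linear first order system for y = (ψ, σ), where σ is the flux p'(ρ₀)ρ₀(ξ₁φ + ξ₂θ +
ψ'); it depends on the frequency only through s = λ² and μ = |ξ|²/(s + 4ω²). Continuity of y across
the interface is exactly the pair of jump conditions. The coefficients are bounded because the
density solves an autonomous equation ρ' = G(ρ) in each layer and stays in a compact subset of
(0,∞).

Size of λ. Completing squares gives E ≥ -g r J, hence λ² ≤ g r. In the other direction a tent of
width 2/r at the interface, with φ = -ψ'/r so that the compressive square vanishes, sees the density
jump and yields λ² ≥ c r for large r (`exists_growth_lowerBound`).

Existence of modes. No minimizing sequence is used. Let y start from (0, 1) at the lower wall with s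
= -inf E. If ψ vanished at an interior point, y cut off there would be a competitor with E + sJ = 0,
and a small perturbation would make this negative unless σ vanished as well, which uniqueness
forbids (`IsSol.no_interior_zero`). If ψ(l) ≠ 0, a suitable combination with a second solution is
positive on the closed interval; this persists for a slightly smaller s', and a positive solution
writes the integrand of 2(E + s'J) as squares plus an exact derivative (`IsSol.energy_nonneg`), so
-s' is a lower bound of E above its infimum. Hence ψ(l) = 0 (`sol_at_upper_wall`). Normalizing at
(r, 0) and rotating gives the family.

Estimates for an arbitrary family. Every profile is a combination of ψ and σ with coefficients
(function of ξ)·F(ρ), and this form is stable under ∂₃ (`ModeSpan`). Because λ² and μ are both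
O(|ξ|), each vertical derivative costs one power of |ξ|. The normalization J = 1 bounds ψ and σ in
L² uniformly in ξ (`exists_amp_bound`). All these constants depend on the configuration alone.

Synthesis. As f has compact support, one may differentiate under the integral, and the mode
equations become the linearized equations (`IsNormalModeFamily.isLinearSolution`). Equivariance
under the half turn gives the parities that make the fields real. On the Fourier side the evolution
is multiplication by e^{λt}, independent of x₃, so cR₃ ≤ λ² ≤ gR₄ on the frequencies present gives
the two-sided growth in every norm (`IsKernel.hkNorm_growth`); the bound at t = 0 follows from the
mode estimates by integrating first in x₃ (`exists_initial_bound`). -/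

namespace RTI

noncomputable section

/-! ### The two layers and the steady density. -/

namespace Config

variable (P : Config)

/-- One of the two fluid layers, with its pressure law. -/
structure IsLayer (I : Set ℝ) (p : ℝ → ℝ) : Prop where
  isOpen : IsOpen I
  subset : I ⊆ P.layers
  law : IsPressureLaw p
  smooth : ContDiffOn ℝ ∞ P.ρ I
  hydrostatic : ∀ z ∈ I, HasDerivAt (fun s => p (P.ρ s)) (-P.g * P.ρ z) z
  dp_eq : ∀ z ∈ I, P.dp z = deriv p (P.ρ z)

variable {P}

lemma isLayer_upper : P.IsLayer P.upper P.pPlus where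
  isOpen := isOpen_Ioo
  subset := subset_union_right
  law := P.pPlus_law
  smooth := P.ρ_smooth_plus
  hydrostatic := P.hydrostatic_plus
  dp_eq _ hz := if_pos hz.1

lemma isLayer_lower : P.IsLayer P.lower P.pMinus where
  isOpen := isOpen_Ioo
  subset := subset_union_left
  law := P.pMinus_law
  smooth := P.ρ_smooth_minus
  hydrostatic := P.hydrostatic_minus
  dp_eq _ hz := if_neg (not_lt.2 hz.2.le)

variable (P)

lemma isOpen_layers : IsOpen P.layers := isOpen_Ioo.union isOpen_Ioo

lemma measurableSet_layers : MeasurableSet P.layers := P.isOpen_layers.measurableSet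

lemma layers_subset : P.layers ⊆ Ioo (-P.m) P.l := by
  have := P.m_pos
  have := P.l_pos
  rintro z (⟨h1, h2⟩ | ⟨h1, h2⟩) <;> constructor <;> linarith

lemma ae_layers_eq : (Ioo (-P.m) P.l : Set ℝ) =ᵐ[volume] P.layers := by
  have h0 : ∀ᵐ z : ℝ, z ≠ 0 := by simp [ae_iff]
  filter_upwards [h0] with z hz
  refine propext ⟨fun h => ?_, fun h => P.layers_subset h⟩
  rcases lt_or_gt_of_ne hz with h' | h'
  · exact Or.inl ⟨h.1, h'⟩
  · exact Or.inr ⟨h', h.2⟩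

/-- The functionals integrate over the full interval, while regularity is available only off the
interface; the point removed is null. -/
lemma restrict_layers :
    volume.restrict (Ioo (-P.m) P.l) = volume.restrict P.layers :=
  Measure.restrict_congr_set P.ae_layers_eq

instance : IsFiniteMeasure (volume.restrict P.layers) := by
  rw [← P.restrict_layers]; infer_instance

lemma layers_induction {Q : ℝ → Prop} (h : ∀ I p, P.IsLayer I p → ∀ z ∈ I, Q z) :
    ∀ z ∈ P.layers, Q z := by
  rintro z (hz | hz)
  · exact h _ _ isLayer_lower z hz
  · exact h _ _ isLayer_upper z hz

/-- A lower bound of the density. -/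
def rhoMin : ℝ := P.ρ_bounds.choose

/-- An upper bound of the density. -/
def rhoMax : ℝ := P.ρ_bounds.choose_spec.choose

lemma rhoMin_pos : 0 < P.rhoMin := P.ρ_bounds.choose_spec.choose_spec.1

variable {P}

lemma rhoMin_le {z : ℝ} (hz : z ∈ P.layers) : P.rhoMin ≤ P.ρ z :=
  (P.ρ_bounds.choose_spec.choose_spec.2 z hz).1

lemma le_rhoMax {z : ℝ} (hz : z ∈ P.layers) : P.ρ z ≤ P.rhoMax :=
  (P.ρ_bounds.choose_spec.choose_spec.2 z hz).2

lemma rho_pos {z : ℝ} (hz : z ∈ P.layers) : 0 < P.ρ z := P.rhoMin_pos.trans_le (rhoMin_le hz)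

lemma mem_layers_upper {z : ℝ} (h0 : 0 < z) (h1 : z < P.l) : z ∈ P.layers := Or.inr ⟨h0, h1⟩

lemma mem_layers_lower {z : ℝ} (h0 : -P.m < z) (h1 : z < 0) : z ∈ P.layers := Or.inl ⟨h0, h1⟩

variable (P)

lemma rhoMax_pos : 0 < P.rhoMax := by
  have h : P.l / 2 ∈ P.layers := mem_layers_upper (by linarith [P.l_pos]) (by linarith [P.l_pos])
  exact (rho_pos h).trans_le (le_rhoMax h)

variable {P} {I : Set ℝ} {p : ℝ → ℝ}

lemma IsLayer.deriv_smooth (_ : P.IsLayer I p) (h : IsPressureLaw p) :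
    ContDiffOn ℝ ∞ (deriv p) (Ioi 0) :=
  ((contDiffOn_infty_iff_deriv_of_isOpen isOpen_Ioi).1 h.smooth).2

lemma _root_.RTI.IsPressureLaw.deriv_pos (h : IsPressureLaw p) {x : ℝ} (hx : 0 < x) :
    0 < deriv p x := by
  obtain ⟨c, hc, h'⟩ := h.inv_deriv_bdd x x hx le_rfl
  exact hc.trans_le (h' x (by simp))

/-- The vector field with `ρ' = G(ρ)`. -/
def slope (P : Config) (p : ℝ → ℝ) (x : ℝ) : ℝ := -P.g * x / deriv p x

lemma IsLayer.slope_smooth (h : P.IsLayer I p) : ContDiffOn ℝ ∞ (P.slope p) (Ioi 0) :=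
  (contDiffOn_const.mul contDiffOn_id).div (h.deriv_smooth h.law)
    fun _ hx => (h.law.deriv_pos hx).ne'

lemma IsLayer.rho_pos (h : P.IsLayer I p) {z : ℝ} (hz : z ∈ I) : 0 < P.ρ z :=
  Config.rho_pos (h.subset hz)

/-- The chain rule in the hydrostatic equation gives p'(ρ)ρ' = -gρ with p'(ρ) > 0. Since ρ' is
itself a smooth function of ρ, so is every derivative of F(ρ); this is what closes `ModeSpan` under
differentiation. -/
lemma IsLayer.hasDerivAt_rho (h : P.IsLayer I p) {z : ℝ} (hz : z ∈ I) :
    HasDerivAt P.ρ (P.slope p (P.ρ z)) z := by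
  have h1 : HasDerivAt P.ρ (deriv P.ρ z) z :=
    ((h.smooth.differentiableOn (by simp)).differentiableAt (h.isOpen.mem_nhds hz)).hasDerivAt
  have h2 : HasDerivAt p (deriv p (P.ρ z)) (P.ρ z) :=
    ((h.law.smooth.differentiableOn (by simp)).differentiableAt
      (isOpen_Ioi.mem_nhds (h.rho_pos hz))).hasDerivAt
  have h3 := (h2.comp z h1).unique (h.hydrostatic z hz)
  have h4 := (h.law.deriv_pos (h.rho_pos hz)).ne'
  have h5 : deriv P.ρ z = P.slope p (P.ρ z) := by
    rw [slope, eq_div_iff h4, ← h3]; ring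
  rwa [← h5]

lemma IsLayer.hasDerivAt_comp (h : P.IsLayer I p) {F : ℝ → ℝ} (hF : ContDiffOn ℝ ∞ F (Ioi 0))
    {z : ℝ} (hz : z ∈ I) :
    HasDerivAt (fun s => F (P.ρ s)) (deriv F (P.ρ z) * P.slope p (P.ρ z)) z :=
  ((hF.differentiableOn (by simp)).differentiableAt
      (isOpen_Ioi.mem_nhds (h.rho_pos hz))).hasDerivAt.comp z (h.hasDerivAt_rho hz)

lemma IsLayer.comp_smooth (h : P.IsLayer I p) {F : ℝ → ℝ} (hF : ContDiffOn ℝ ∞ F (Ioi 0)) :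
    ContDiffOn ℝ ∞ (fun s => F (P.ρ s)) I :=
  hF.comp h.smooth fun _ hz => h.rho_pos hz

lemma rho_mem_Icc {z : ℝ} (hz : z ∈ P.layers) : P.ρ z ∈ Icc P.rhoMin P.rhoMax :=
  ⟨rhoMin_le hz, le_rhoMax hz⟩

/-- The density takes values in a compact subinterval of (0,∞). Boundedness up to the interface and
the walls thus comes for free, although ρ is assumed smooth only inside the layers. -/
lemma exists_bound_comp (P : Config) {F : ℝ → ℝ} (hF : ContinuousOn F (Ioi 0)) :
    ∃ C > 0, ∀ z ∈ P.layers, |F (P.ρ z)| ≤ C := by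
  obtain ⟨C, hC⟩ := (isCompact_Icc (a := P.rhoMin) (b := P.rhoMax)).exists_bound_of_continuousOn
    (hF.mono fun x hx => P.rhoMin_pos.trans_le hx.1)
  exact ⟨max C 1, by positivity, fun z hz => (hC _ (rho_mem_Icc hz)).trans (le_max_left _ _)⟩

lemma contDiffOn_rho : ContDiffOn ℝ ∞ P.ρ P.layers :=
  fun z hz => (P.layers_induction (Q := fun z => ContDiffAt ℝ ∞ P.ρ z)
    (fun _ _ h _ hz => h.smooth.contDiffAt (h.isOpen.mem_nhds hz)) z hz).contDiffWithinAt

lemma contDiffOn_dp : ContDiffOn ℝ ∞ P.dp P.layers :=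
  fun z hz => (P.layers_induction (Q := fun z => ContDiffAt ℝ ∞ P.dp z)
    (fun _ _ h _ hz => ((h.comp_smooth (h.deriv_smooth h.law)).congr h.dp_eq).contDiffAt
      (h.isOpen.mem_nhds hz)) z hz).contDiffWithinAt

lemma dp_pos {z : ℝ} (hz : z ∈ P.layers) : 0 < P.dp z :=
  P.layers_induction (Q := fun z => 0 < P.dp z)
    (fun _ _ h z hz => by rw [h.dp_eq z hz]; exact h.law.deriv_pos (h.rho_pos hz)) z hz

lemma exists_bound_dp (P : Config) :
    ∃ c > 0, ∀ z ∈ P.layers, P.dp z ≤ c ∧ (P.dp z)⁻¹ ≤ c := by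
  have key : ∀ I p, P.IsLayer I p → ∃ c > 0, ∀ z ∈ I, P.dp z ≤ c ∧ (P.dp z)⁻¹ ≤ c := by
    intro I p h
    obtain ⟨c, hc, h1⟩ := P.exists_bound_comp (h.deriv_smooth h.law).continuousOn
    obtain ⟨d, hd, h2⟩ := P.exists_bound_comp
      ((h.deriv_smooth h.law).continuousOn.inv₀ fun x hx => (h.law.deriv_pos hx).ne')
    refine ⟨max c d, by positivity, fun z hz => ?_⟩
    rw [h.dp_eq z hz]
    exact ⟨((le_abs_self _).trans (h1 z (h.subset hz))).trans (le_max_left _ _),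
      ((le_abs_self _).trans (h2 z (h.subset hz))).trans (le_max_right _ _)⟩
  obtain ⟨c, hc, h1⟩ := key _ _ isLayer_upper
  obtain ⟨d, hd, h2⟩ := key _ _ isLayer_lower
  refine ⟨max c d, by positivity, ?_⟩
  rintro z (hz | hz)
  · exact ⟨(h2 z hz).1.trans (le_max_right _ _), (h2 z hz).2.trans (le_max_right _ _)⟩
  · exact ⟨(h1 z hz).1.trans (le_max_left _ _), (h1 z hz).2.trans (le_max_left _ _)⟩

variable (P)

/-- A common bound of `p'(ρ₀)` and its inverse. -/
def dpBound : ℝ := P.exists_bound_dp.choose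

lemma dpBound_pos : 0 < P.dpBound := P.exists_bound_dp.choose_spec.1

variable {P}

lemma dp_le {z : ℝ} (hz : z ∈ P.layers) : P.dp z ≤ P.dpBound :=
  (P.exists_bound_dp.choose_spec.2 z hz).1

lemma inv_dp_le {z : ℝ} (hz : z ∈ P.layers) : (P.dp z)⁻¹ ≤ P.dpBound :=
  (P.exists_bound_dp.choose_spec.2 z hz).2

lemma inv_rho_le {z : ℝ} (hz : z ∈ P.layers) : (P.ρ z)⁻¹ ≤ P.rhoMin⁻¹ :=
  inv_anti₀ P.rhoMin_pos (rhoMin_le hz)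

lemma aesm_rho : AEStronglyMeasurable P.ρ (volume.restrict P.layers) :=
  contDiffOn_rho.continuousOn.aestronglyMeasurable P.measurableSet_layers

lemma aesm_dp : AEStronglyMeasurable P.dp (volume.restrict P.layers) :=
  contDiffOn_dp.continuousOn.aestronglyMeasurable P.measurableSet_layers

end Config

/-! ### Linear Volterra equations with a parameter, solved by Neumann series. -/

section Volterra

variable {X E : Type*} [TopologicalSpace X] [FirstCountableTopology X]
  [NormedAddCommGroup E] [NormedSpace ℝ E]
  {A : X → ℝ → E →L[ℝ] E} {K : X → ℝ} {a b : ℝ} {y₀ : E}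

/-- The terms of the Neumann series of the linear Volterra equation
`y(z) = y₀ + ∫_a^z A(ζ) y(ζ) dζ`. -/
def volterraTerm (A : X → ℝ → E →L[ℝ] E) (a : ℝ) (y₀ : E) : ℕ → X → ℝ → E
  | 0 => fun _ _ => y₀
  | n + 1 => fun x z => ∫ ζ in a..z, A x ζ (volterraTerm A a y₀ n x ζ)

/-- The solution of the linear Volterra equation `y(z) = y₀ + ∫_a^z A(ζ) y(ζ) dζ`. -/
def volterra (A : X → ℝ → E →L[ℝ] E) (a : ℝ) (y₀ : E) (x : X) (z : ℝ) : E :=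
  ∑' n, volterraTerm A a y₀ n x z

variable (hm : ∀ x, StronglyMeasurable (A x)) (hc : ∀ z, Continuous fun x => A x z)
  (hK : Continuous K) (hA : ∀ x z, ‖A x z‖ ≤ K x)

include hm hc hK hA

/-- Dominated convergence for the primitive, jointly in the parameter and the end point. Only
measurability of the coefficients in the integration variable is needed, since they jump at the
interface. -/
lemma continuous_volterraTerm (n : ℕ) :
    Continuous fun p : X × ℝ => volterraTerm A a y₀ n p.1 p.2 := by
  induction n with
  | zero => exact continuous_const
  | succ n ih =>
    rw [continuous_iff_continuousAt]
    rintro ⟨x₀, b₀⟩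
    set u := min a b₀ - 1
    set v := max a b₀ + 1
    have hua : u < a := by have := min_le_left a b₀; simp only [u]; linarith
    have hub : u < b₀ := by have := min_le_right a b₀; simp only [u]; linarith
    have hav : a < v := by have := le_max_left a b₀; simp only [v]; linarith
    have hbv : b₀ < v := by have := le_max_right a b₀; simp only [v]; linarith
    obtain ⟨M, hM⟩ : ∃ M, ∀ z ∈ Icc u v, ‖volterraTerm A a y₀ n x₀ z‖ ≤ M :=
      isCompact_Icc.exists_bound_of_continuousOn
        (ih.comp (Continuous.prodMk_right x₀)).continuousOn
    -- Tube lemma: the bound at x₀ on the compact window persists for nearby parameters with one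
    -- unit of slack, which supplies a constant dominating function.
    have hnear : ∀ᶠ x in 𝓝 x₀, ∀ z ∈ Icc u v, ‖volterraTerm A a y₀ n x z‖ < M + 1 := by
      refine isCompact_Icc.eventually_forall_of_forall_eventually fun z hz => ?_
      exact ih.norm.continuousAt.eventually_lt (f := fun p : X × ℝ => ‖_‖)
        continuousAt_const (by simpa using (hM z hz).trans_lt (lt_add_one M))
    refine intervalIntegral.continuousAt_parametric_primitive_of_dominated
      (F := fun x ζ => A x ζ (volterraTerm A a y₀ n x ζ)) (fun _ => (K x₀ + 1) * (M + 1)) u v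
      ?_ ?_ intervalIntegrable_const ?_ ⟨hua, hav⟩ ⟨hub, hbv⟩ (by simp)
    · intro x
      have h1 : StronglyMeasurable fun ζ => volterraTerm A a y₀ n x ζ :=
        (ih.comp (Continuous.prodMk_right x)).stronglyMeasurable
      exact ((ContinuousLinearMap.apply ℝ E).flip.continuous₂.comp_stronglyMeasurable
        ((hm x).prodMk h1)).aestronglyMeasurable
    · have hKn : ∀ᶠ x in 𝓝 x₀, K x < K x₀ + 1 :=
        hK.continuousAt.eventually_lt continuousAt_const (by simp)
      filter_upwards [hnear, hKn] with x hx hx'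
      refine (ae_restrict_iff' measurableSet_uIoc).2 (Eventually.of_forall fun z hz => ?_)
      rw [uIoc_of_le (by linarith)] at hz
      have h0 : 0 ≤ K x := (norm_nonneg _).trans (hA x z)
      calc _ ≤ ‖A x z‖ * ‖volterraTerm A a y₀ n x z‖ := ContinuousLinearMap.le_opNorm _ _
        _ ≤ (K x₀ + 1) * (M + 1) := by
          gcongr
          · linarith
          · exact (hA x z).trans hx'.le
          · exact (hx z (Ioc_subset_Icc_self hz)).le
    · refine Eventually.of_forall fun z => ?_
      exact ((hc z).clm_apply (ih.comp (Continuous.prodMk_left z))).continuousAt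

lemma aesm_volterraTerm (n : ℕ) (x : X) (μ : Measure ℝ) :
    AEStronglyMeasurable (fun ζ => A x ζ (volterraTerm A a y₀ n x ζ)) μ := by
  have h1 : StronglyMeasurable fun ζ => volterraTerm A a y₀ n x ζ :=
    ((continuous_volterraTerm hm hc hK hA n).comp (Continuous.prodMk_right x)).stronglyMeasurable
  exact ((ContinuousLinearMap.apply ℝ E).flip.continuous₂.comp_stronglyMeasurable
        ((hm x).prodMk h1)).aestronglyMeasurable

-- The weight exp(2k(z - a)) makes the integral operator a contraction of ratio 1/2: integrating k
-- exp(2k(ζ - a)) returns half of the weight. The series is then geometric.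
omit [TopologicalSpace X] [FirstCountableTopology X] hm hc hK in
lemma norm_volterraTerm_le (n : ℕ) {x : X} {k : ℝ} (hk : 0 < k) (hKk : K x ≤ k) {z : ℝ}
    (hz : a ≤ z) :
    ‖volterraTerm A a y₀ n x z‖ ≤ (1 / 2) ^ n * Real.exp (2 * k * (z - a)) * ‖y₀‖ := by
  induction n generalizing z with
  | zero =>
    have : 1 ≤ Real.exp (2 * k * (z - a)) :=
      Real.one_le_exp (mul_nonneg (by positivity) (by linarith))
    simpa [volterraTerm] using le_mul_of_one_le_left (norm_nonneg y₀) this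
  | succ n ih =>
    have hder : ∀ ζ ∈ uIcc a z, HasDerivAt
        (fun ζ => (1 / 2) ^ (n + 1) * Real.exp (2 * k * (ζ - a)) * ‖y₀‖)
        (k * ((1 / 2) ^ n * Real.exp (2 * k * (ζ - a)) * ‖y₀‖)) ζ := by
      intro ζ _
      have := (((((hasDerivAt_id ζ).sub_const a).const_mul (2 * k)).exp).const_mul
        ((1 / 2 : ℝ) ^ (n + 1))).mul_const ‖y₀‖
      refine this.congr_deriv ?_
      simp only [id_eq, pow_succ]; ring
    have hint : IntervalIntegrable
        (fun ζ => k * ((1 / 2) ^ n * Real.exp (2 * k * (ζ - a)) * ‖y₀‖)) volume a z :=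
      (by fun_prop : Continuous _).intervalIntegrable _ _
    have h1 := intervalIntegral.norm_integral_le_of_norm_le
      (f := fun ζ => A x ζ (volterraTerm A a y₀ n x ζ)) hz
      (Eventually.of_forall fun ζ hζ =>
        (ContinuousLinearMap.le_opNorm _ _).trans
          (mul_le_mul ((hA x ζ).trans hKk) (ih hζ.1.le) (norm_nonneg _) hk.le)) hint
    rw [intervalIntegral.integral_eq_sub_of_hasDerivAt hder hint] at h1
    refine h1.trans (sub_le_self _ (by positivity))

/-- Weierstrass test on the open set {K < k}, which contains the given parameter. Continuity in the
parameter is what allows `sol_at_upper_wall` to lower s slightly. -/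
lemma continuousOn_volterra [CompleteSpace E] :
    ContinuousOn (fun p : X × ℝ => volterra A a y₀ p.1 p.2) (univ ×ˢ Icc a b) := by
  rintro ⟨x₀, z₀⟩ ⟨_, hz₀⟩
  set k := |K x₀| + 1
  have hk : 0 < k := by positivity
  have hU : IsOpen {x | K x < k} := isOpen_lt hK continuous_const
  have hx₀ : K x₀ < k := (le_abs_self _).trans_lt (lt_add_one _)
  have h1 : ContinuousOn (fun p : X × ℝ => volterra A a y₀ p.1 p.2) ({x | K x < k} ×ˢ Icc a b) := by
    refine continuousOn_tsum
      (u := fun n => (1 / 2) ^ n * (Real.exp (2 * k * (b - a)) * ‖y₀‖))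
      (fun n => (continuous_volterraTerm hm hc hK hA n).continuousOn)
      (summable_geometric_two.mul_right _) ?_
    rintro n ⟨x, z⟩ ⟨hx, hz⟩
    refine (norm_volterraTerm_le hA n hk (le_of_lt hx) hz.1).trans ?_
    rw [mul_assoc]
    gcongr
    exact hz.2
  refine (h1 (x₀, z₀) ⟨hx₀, hz₀⟩).mono_of_mem_nhdsWithin ?_
  rw [nhdsWithin_prod_eq, nhdsWithin_univ]
  exact Filter.prod_mem_prod (hU.mem_nhds hx₀) self_mem_nhdsWithin

lemma volterra_eq [CompleteSpace E] (x : X) {z : ℝ} (hz : a ≤ z) :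
    volterra A a y₀ x z = y₀ + ∫ ζ in a..z, A x ζ (volterra A a y₀ x ζ) := by
  set k := |K x| + 1
  have hk : 0 < k := by positivity
  have hx : K x ≤ k := (le_abs_self _).trans (lt_add_one _).le
  have hb : ∀ n, ∀ ζ ∈ Icc a z, ‖volterraTerm A a y₀ n x ζ‖ ≤
      (1 / 2) ^ n * (Real.exp (2 * k * (z - a)) * ‖y₀‖) := by
    intro n ζ hζ
    refine (norm_volterraTerm_le hA n hk hx hζ.1).trans ?_
    rw [mul_assoc]
    gcongr
    exact hζ.2
  have hs : ∀ ζ ∈ Icc a z, Summable fun n => volterraTerm A a y₀ n x ζ := fun ζ hζ =>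
    .of_norm_bounded (summable_geometric_two.mul_right _) fun n => hb n ζ hζ
  have h1 := intervalIntegral.hasSum_integral_of_dominated_convergence (μ := volume) (a := a) (b := z)
    (F := fun n ζ => A x ζ (volterraTerm A a y₀ n x ζ))
    (f := fun ζ => A x ζ (volterra A a y₀ x ζ))
    (fun n _ => k * ((1 / 2) ^ n * (Real.exp (2 * k * (z - a)) * ‖y₀‖)))
    (fun n => aesm_volterraTerm hm hc hK hA n x _)
    (fun n => Eventually.of_forall fun ζ hζ => by
      rw [uIoc_of_le hz] at hζ
      exact (ContinuousLinearMap.le_opNorm _ _).trans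
        (mul_le_mul ((hA x ζ).trans hx) (hb n ζ (Ioc_subset_Icc_self hζ)) (norm_nonneg _) hk.le))
    (Eventually.of_forall fun ζ _ => (summable_geometric_two.mul_right _).mul_left _)
    intervalIntegrable_const
    (Eventually.of_forall fun ζ hζ => by
      rw [uIoc_of_le hz] at hζ
      exact (A x ζ).hasSum (hs ζ (Ioc_subset_Icc_self hζ)).hasSum)
  have h2 : Summable fun n => volterraTerm A a y₀ n x z := hs z ⟨hz, le_rfl⟩
  rw [volterra, h2.tsum_eq_zero_add]
  exact congrArg (y₀ + ·) h1.tsum_eq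

lemma volterra_zero [CompleteSpace E] (x : X) : volterra A a y₀ x a = y₀ := by
  simp [volterra_eq hm hc hK hA x le_rfl]

end Volterra

/-! ### Calculus across the interface, and the system for the vertical displacement and the flux. -/

namespace Config

variable (P : Config)

variable {P}

lemma mem_layers_of_mem_Ioo {z : ℝ} (hz : z ∈ Ioo (-P.m) P.l) (h0 : z ≠ 0) : z ∈ P.layers := by
  rcases lt_or_gt_of_ne h0 with h | h
  · exact mem_layers_lower hz.1 h
  · exact mem_layers_upper h hz.2

/-- A continuous function with nonnegative derivative in both layers is monotone. -/
lemma monotoneOn_of_layers {f f' : ℝ → ℝ} (hc : ContinuousOn f (Icc (-P.m) P.l))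
    (hd : ∀ z ∈ P.layers, HasDerivAt f (f' z) z) (h0 : ∀ z ∈ P.layers, 0 ≤ f' z) :
    MonotoneOn f (Icc (-P.m) P.l) := by
  have hm := P.m_pos
  have hl := P.l_pos
  have key : ∀ a b, a ≤ b → Icc a b ⊆ Icc (-P.m) P.l → Ioo a b ⊆ P.layers →
      MonotoneOn f (Icc a b) := by
    intro a b _ h1 h2
    refine monotoneOn_of_deriv_nonneg (convex_Icc a b) (hc.mono h1) ?_ ?_
    · rw [interior_Icc]
      exact fun z hz => (hd z (h2 hz)).differentiableAt.differentiableWithinAt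
    · rw [interior_Icc]
      exact fun z hz => by rw [(hd z (h2 hz)).deriv]; exact h0 z (h2 hz)
  have h1 := key (-P.m) 0 (by linarith) (Icc_subset_Icc le_rfl hl.le) subset_union_left
  have h2 := key 0 P.l hl.le (Icc_subset_Icc (by linarith) le_rfl) subset_union_right
  rw [← Icc_union_Icc_eq_Icc (show -P.m ≤ 0 by linarith) hl.le]
  exact h1.union_right h2 (isGreatest_Icc (by linarith)) (isLeast_Icc hl.le)

/-- The fundamental theorem of calculus tolerates the interface as one exceptional point, because f
is continuous there. -/
lemma integral_of_layers {f f' : ℝ → ℝ} (hc : ContinuousOn f (Icc (-P.m) P.l))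
    (hd : ∀ z ∈ P.layers, HasDerivAt f (f' z) z)
    (hi : IntervalIntegrable f' volume (-P.m) P.l) {a b : ℝ} (ha : -P.m ≤ a) (hab : a ≤ b)
    (hb : b ≤ P.l) : ∫ z in a..b, f' z = f b - f a := by
  refine integral_eq_of_hasDerivAt_off_countable_of_le f f' hab (countable_singleton 0)
    (hc.mono (Icc_subset_Icc ha hb)) ?_ ?_
  · rintro z ⟨hz, hz0⟩
    exact hd z (mem_layers_of_mem_Ioo ⟨ha.trans_lt hz.1, hz.2.trans_le hb⟩ hz0)
  · refine hi.mono_set ?_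
    rw [uIcc_of_le hab, uIcc_of_le (ha.trans (hab.trans hb))]
    exact Icc_subset_Icc ha hb

lemma intervalIntegrable_iff_layers {f : ℝ → ℝ} :
    IntervalIntegrable f volume (-P.m) P.l ↔ IntegrableOn f P.layers := by
  rw [intervalIntegrable_iff_integrableOn_Ioo_of_le (by linarith [P.m_pos, P.l_pos]),
    IntegrableOn, P.restrict_layers, IntegrableOn]

lemma intervalIntegral_eq_layers {f : ℝ → ℝ} :
    ∫ z in (-P.m)..P.l, f z = ∫ z in P.layers, f z := by
  rw [intervalIntegral.integral_of_le (by linarith [P.m_pos, P.l_pos]),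
    integral_Ioc_eq_integral_Ioo, P.restrict_layers]

/-- A bounded function that is continuous in the layers is integrable. -/
lemma integrableOn_layers {f : ℝ → ℝ} (hc : ContinuousOn f P.layers) {C : ℝ}
    (hC : ∀ z ∈ P.layers, |f z| ≤ C) : IntegrableOn f P.layers :=
  Integrable.of_bound (hc.aestronglyMeasurable P.measurableSet_layers) C
    ((ae_restrict_iff' P.measurableSet_layers).2 (Eventually.of_forall hC))

/-! ### The first order system for the vertical displacement and the flux -/

/-- The right-hand side of `ψ'`. -/
def rhsPsi (P : Config) (x : ℝ × ℝ) (y : ℝ × ℝ) (z : ℝ) : ℝ :=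
  -x.2 * P.g * y.1 + ((P.dp z * P.ρ z)⁻¹ + x.2 / P.ρ z) * y.2

/-- The right-hand side of `σ'`. -/
def rhsSigma (P : Config) (x : ℝ × ℝ) (y : ℝ × ℝ) (z : ℝ) : ℝ :=
  (x.1 - P.g ^ 2 * x.2) * P.ρ z * y.1 + P.g * x.2 * y.2

open ContinuousLinearMap in
/-- The coefficient matrix of the first order system, in the parameters
`s = λ²` and `μ = r² / (s + 4ω²)`. -/
def odeMat (P : Config) (x : ℝ × ℝ) : ℝ → (ℝ × ℝ) →L[ℝ] (ℝ × ℝ) :=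
  P.layers.indicator fun z =>
    (-x.2 * P.g) • (fst ℝ ℝ ℝ).prod 0
      + ((P.dp z * P.ρ z)⁻¹ + x.2 / P.ρ z) • (snd ℝ ℝ ℝ).prod 0
      + ((x.1 - P.g ^ 2 * x.2) * P.ρ z) • (0 : ℝ × ℝ →L[ℝ] ℝ).prod (fst ℝ ℝ ℝ)
      + (P.g * x.2) • (0 : ℝ × ℝ →L[ℝ] ℝ).prod (snd ℝ ℝ ℝ)

lemma odeMat_apply {x y : ℝ × ℝ} {z : ℝ} (hz : z ∈ P.layers) :
    P.odeMat x z y = (P.rhsPsi x y z, P.rhsSigma x y z) := by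
  rw [odeMat, indicator_of_mem hz]
  ext <;> simp [rhsPsi, rhsSigma]

lemma continuousOn_odeMat (x : ℝ × ℝ) : ContinuousOn (P.odeMat x) P.layers := by
  have h1 := (contDiffOn_rho (P := P)).continuousOn
  have h2 := (contDiffOn_dp (P := P)).continuousOn
  refine ContinuousOn.congr ?_ (fun z hz => indicator_of_mem hz _)
  have h3 : ContinuousOn (fun z => (P.dp z * P.ρ z)⁻¹) P.layers :=
    (h2.mul h1).inv₀ fun z hz => (mul_pos (dp_pos hz) (rho_pos hz)).ne'
  have h4 : ContinuousOn (fun z => x.2 / P.ρ z) P.layers :=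
    continuousOn_const.div h1 fun z hz => (rho_pos hz).ne'
  exact ((continuousOn_const.add ((h3.add h4).smul continuousOn_const)).add
    ((continuousOn_const.mul h1).smul continuousOn_const)).add continuousOn_const

/-- The extension by zero off the layers makes the coefficients measurable and bounded on all of ℝ,
as the Volterra lemmas require. -/
lemma stronglyMeasurable_odeMat (x : ℝ × ℝ) : StronglyMeasurable (P.odeMat x) := by
  classical
  have : ProperSpace ((ℝ × ℝ) →L[ℝ] (ℝ × ℝ)) := FiniteDimensional.proper ℝ _
  have h := (continuousOn_odeMat (P := P) x).measurable_piecewise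
    (g := fun _ => (0 : (ℝ × ℝ) →L[ℝ] (ℝ × ℝ))) continuousOn_const P.measurableSet_layers
  have h' : P.odeMat x = P.layers.piecewise (P.odeMat x) fun _ => 0 := by
    ext1 z
    by_cases hz : z ∈ P.layers <;> simp [hz, odeMat]
  rw [h']
  exact h.stronglyMeasurable

lemma continuous_odeMat (z : ℝ) : Continuous fun x => P.odeMat x z := by
  by_cases hz : z ∈ P.layers
  · simp only [odeMat, indicator_of_mem hz]
    fun_prop
  · simp only [odeMat, indicator_of_notMem hz]
    exact continuous_const

/-- A bound of the coefficient matrix. -/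
def odeBound (P : Config) (x : ℝ × ℝ) : ℝ :=
  |x.2| * P.g + (P.dpBound * P.rhoMin⁻¹ + |x.2| * P.rhoMin⁻¹)
    + (|x.1| + P.g ^ 2 * |x.2|) * P.rhoMax + P.g * |x.2|

lemma continuous_odeBound : Continuous P.odeBound := by unfold odeBound; fun_prop

lemma odeBound_nonneg (x : ℝ × ℝ) : 0 ≤ P.odeBound x := by
  have := P.g_pos
  have := P.dpBound_pos
  have := P.rhoMin_pos
  have := P.rhoMax_pos
  unfold odeBound
  positivity

lemma abs_rhsPsi_le (x y : ℝ × ℝ) {z : ℝ} (hz : z ∈ P.layers) :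
    |P.rhsPsi x y z| ≤ P.odeBound x * ‖y‖ := by
  have hg := P.g_pos
  have h1 := rho_pos hz
  have h2 := dp_pos hz
  have h3 := inv_dp_le hz
  have h4 := inv_rho_le hz
  have h5 := P.rhoMin_pos
  have h6 := P.rhoMax_pos
  have hd := P.dpBound_pos
  have e1 : |y.1| ≤ ‖y‖ := norm_fst_le y
  have e2 : |y.2| ≤ ‖y‖ := norm_snd_le y
  calc |P.rhsPsi x y z| ≤ |x.2| * P.g * |y.1|
        + ((P.dp z)⁻¹ * (P.ρ z)⁻¹ + |x.2| * (P.ρ z)⁻¹) * |y.2| := by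
        refine (abs_add_le _ _).trans ?_
        rw [abs_mul, abs_mul, abs_mul, abs_neg, abs_of_pos hg]
        gcongr
        refine (abs_add_le _ _).trans ?_
        rw [abs_of_pos (by positivity), abs_div, abs_of_pos h1, mul_inv, div_eq_mul_inv]
    _ ≤ |x.2| * P.g * ‖y‖ + (P.dpBound * P.rhoMin⁻¹ + |x.2| * P.rhoMin⁻¹) * ‖y‖ := by gcongr
    _ ≤ _ := by
      rw [← add_mul]
      refine mul_le_mul_of_nonneg_right ?_ (norm_nonneg _)
      unfold odeBound
      have : 0 ≤ (|x.1| + P.g ^ 2 * |x.2|) * P.rhoMax + P.g * |x.2| := by positivity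
      linarith

lemma abs_rhsSigma_le (x y : ℝ × ℝ) {z : ℝ} (hz : z ∈ P.layers) :
    |P.rhsSigma x y z| ≤ P.odeBound x * ‖y‖ := by
  have hg := P.g_pos
  have h1 := rho_pos hz
  have h2 := le_rhoMax hz
  have h5 := P.rhoMin_pos
  have h6 := P.rhoMax_pos
  have hd := P.dpBound_pos
  have e1 : |y.1| ≤ ‖y‖ := norm_fst_le y
  have e2 : |y.2| ≤ ‖y‖ := norm_snd_le y
  calc |P.rhsSigma x y z| ≤ (|x.1| + P.g ^ 2 * |x.2|) * P.ρ z * |y.1| + P.g * |x.2| * |y.2| := by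
        refine (abs_add_le _ _).trans ?_
        rw [abs_mul, abs_mul, abs_mul, abs_mul, abs_of_pos hg, abs_of_pos h1]
        gcongr
        refine (abs_sub _ _).trans ?_
        rw [abs_mul, abs_of_pos (pow_pos hg 2)]
    _ ≤ (|x.1| + P.g ^ 2 * |x.2|) * P.rhoMax * ‖y‖ + P.g * |x.2| * ‖y‖ := by gcongr
    _ ≤ _ := by
      rw [← add_mul]
      refine mul_le_mul_of_nonneg_right ?_ (norm_nonneg _)
      unfold odeBound
      have : 0 ≤ |x.2| * P.g + (P.dpBound * P.rhoMin⁻¹ + |x.2| * P.rhoMin⁻¹) := by positivity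
      linarith

lemma norm_odeMat_le (x : ℝ × ℝ) (z : ℝ) : ‖P.odeMat x z‖ ≤ P.odeBound x := by
  refine ContinuousLinearMap.opNorm_le_bound _ (odeBound_nonneg x) fun y => ?_
  by_cases hz : z ∈ P.layers
  · rw [odeMat_apply hz, Prod.norm_def]
    exact max_le (abs_rhsPsi_le x y hz) (abs_rhsSigma_le x y hz)
  · rw [odeMat, indicator_of_notMem hz]
    simpa using mul_nonneg (odeBound_nonneg x) (norm_nonneg y)

/-- The solution of the first order system with initial value `y₀` at the lower wall. -/
def sol (P : Config) (y₀ x : ℝ × ℝ) (z : ℝ) : ℝ × ℝ := volterra P.odeMat (-P.m) y₀ x z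

variable {y₀ x : ℝ × ℝ}

lemma continuousOn_sol :
    ContinuousOn (fun p : (ℝ × ℝ) × ℝ => P.sol y₀ p.1 p.2) (univ ×ˢ Icc (-P.m) P.l) :=
  continuousOn_volterra stronglyMeasurable_odeMat continuous_odeMat continuous_odeBound
    norm_odeMat_le

lemma continuousOn_sol_right : ContinuousOn (P.sol y₀ x) (Icc (-P.m) P.l) :=
  continuousOn_sol.comp (Continuous.prodMk_right x).continuousOn fun _ hz => ⟨mem_univ _, hz⟩

lemma continuous_sol_left {z : ℝ} (hz : z ∈ Icc (-P.m) P.l) :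
    Continuous fun x => P.sol y₀ x z :=
  continuousOn_univ.1 <|
    continuousOn_sol.comp (Continuous.prodMk_left z).continuousOn fun _ _ => ⟨mem_univ _, hz⟩

lemma sol_left : P.sol y₀ x (-P.m) = y₀ :=
  volterra_zero stronglyMeasurable_odeMat continuous_odeMat continuous_odeBound
    norm_odeMat_le x

/-- The integral equation can be differentiated where the coefficients are continuous, that is,
inside the layers. At the interface it provides only continuity, and this is just what the jump
conditions ask. -/
lemma hasDerivAt_sol {z : ℝ} (hz : z ∈ P.layers) :
    HasDerivAt (P.sol y₀ x) (P.rhsPsi x (P.sol y₀ x z) z, P.rhsSigma x (P.sol y₀ x z) z) z := by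
  have hI := P.layers_subset hz
  have hco : ContinuousOn (fun ζ => P.odeMat x ζ (P.sol y₀ x ζ)) P.layers :=
    (continuousOn_odeMat x).clm_apply
      (continuousOn_sol_right.mono (P.layers_subset.trans Ioo_subset_Icc_self))
  have hint : IntervalIntegrable (fun ζ => P.odeMat x ζ (P.sol y₀ x ζ)) volume (-P.m) z := by
    obtain ⟨C, hC⟩ := isCompact_Icc.exists_bound_of_continuousOn
      (continuousOn_sol_right (P := P) (y₀ := y₀) (x := x))
    rw [intervalIntegrable_iff_integrableOn_Ioo_of_le hI.1.le]
    have hsub : Ioo (-P.m) z ⊆ Ioo (-P.m) P.l := Ioo_subset_Ioo le_rfl hI.2.le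
    refine IntegrableOn.mono_set ?_ hsub
    rw [IntegrableOn, P.restrict_layers]
    refine Integrable.of_bound (hco.aestronglyMeasurable P.measurableSet_layers)
      (P.odeBound x * C) ((ae_restrict_iff' P.measurableSet_layers).2
        (Eventually.of_forall fun ζ hζ => ?_))
    exact (ContinuousLinearMap.le_opNorm _ _).trans
      (mul_le_mul (norm_odeMat_le x ζ) (hC ζ (Ioo_subset_Icc_self (P.layers_subset hζ)))
        (norm_nonneg _) (odeBound_nonneg x))
  have h1 := intervalIntegral.integral_hasDerivAt_right hint
    (hco.stronglyMeasurableAtFilter P.isOpen_layers z hz)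
    (hco.continuousAt (P.isOpen_layers.mem_nhds hz))
  rw [odeMat_apply hz] at h1
  refine (h1.const_add y₀).congr_of_eventuallyEq ?_
  filter_upwards [P.isOpen_layers.mem_nhds hz] with ζ hζ
  exact volterra_eq stronglyMeasurable_odeMat continuous_odeMat continuous_odeBound
    norm_odeMat_le x (P.layers_subset hζ).1.le

lemma hasDerivAt_fst {y : ℝ → ℝ × ℝ} {y' : ℝ × ℝ} {z : ℝ} (h : HasDerivAt y y' z) :
    HasDerivAt (fun z => (y z).1) y'.1 z := by simpa using h.hasFDerivAt.fst.hasDerivAt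

lemma hasDerivAt_snd {y : ℝ → ℝ × ℝ} {y' : ℝ × ℝ} {z : ℝ} (h : HasDerivAt y y' z) :
    HasDerivAt (fun z => (y z).2) y'.2 z := by simpa using h.hasFDerivAt.snd.hasDerivAt

/-- A nontrivial solution of a linear system has no zero. -/
lemma ne_zero_of_layers {K : ℝ} (hK : 0 ≤ K) {y : ℝ → ℝ × ℝ} {y' : ℝ → ℝ × ℝ}
    (hc : ContinuousOn y (Icc (-P.m) P.l)) (hd : ∀ z ∈ P.layers, HasDerivAt y (y' z) z)
    (hb : ∀ z ∈ P.layers, |(y' z).1| ≤ K * ‖y z‖ ∧ |(y' z).2| ≤ K * ‖y z‖) (h0 : y (-P.m) ≠ 0)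
    {z : ℝ} (hz : z ∈ Icc (-P.m) P.l) : y z ≠ 0 := by
  have hml : -P.m ≤ P.l := by linarith [P.m_pos, P.l_pos]
  have hpos : ∀ w : ℝ × ℝ, w ≠ 0 ↔ 0 < w.1 ^ 2 + w.2 ^ 2 := by
    intro w
    constructor
    · intro hw
      by_contra hcon
      apply hw
      have e1 : w.1 = 0 := by nlinarith [sq_nonneg w.1, sq_nonneg w.2]
      have e2 : w.2 = 0 := by nlinarith [sq_nonneg w.1, sq_nonneg w.2]
      exact Prod.ext e1 e2
    · rintro hw rfl
      simp at hw
  -- The derivative of |y|² is at least -4K|y|², so this weighted square cannot decrease from its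
  -- positive value at the lower wall.
  have hmono : MonotoneOn (fun z => Real.exp (4 * K * z) * ((y z).1 ^ 2 + (y z).2 ^ 2))
      (Icc (-P.m) P.l) := by
    refine monotoneOn_of_layers (f' := fun z => Real.exp (4 * K * z) *
      (4 * K * ((y z).1 ^ 2 + (y z).2 ^ 2) + 2 * ((y z).1 * (y' z).1 + (y z).2 * (y' z).2)))
      ?_ ?_ ?_
    · exact (by fun_prop : Continuous fun z => Real.exp (4 * K * z)).continuousOn.mul
        ((hc.fst.pow 2).add (hc.snd.pow 2))
    · intro z hz
      have h1 := ((hasDerivAt_id z).const_mul (4 * K)).exp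
      have h2 := ((hasDerivAt_fst (hd z hz)).pow 2).add ((hasDerivAt_snd (hd z hz)).pow 2)
      refine (h1.mul h2).congr_deriv ?_
      simp; ring
    · intro z hz
      obtain ⟨b1, b2⟩ := hb z hz
      refine mul_nonneg (Real.exp_pos _).le ?_
      have hn : ‖y z‖ ^ 2 ≤ (y z).1 ^ 2 + (y z).2 ^ 2 := by
        rw [Prod.norm_def, Real.norm_eq_abs, Real.norm_eq_abs]
        rcases max_choice |(y z).1| |(y z).2| with h | h <;> rw [h, sq_abs] <;> nlinarith
      have n1 : |(y z).1 * (y' z).1| ≤ K * ((y z).1 ^ 2 + (y z).2 ^ 2) := by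
        rw [abs_mul]
        calc _ ≤ ‖y z‖ * (K * ‖y z‖) :=
              mul_le_mul (norm_fst_le (y z)) b1 (abs_nonneg _) (norm_nonneg _)
          _ = K * ‖y z‖ ^ 2 := by ring
          _ ≤ _ := by gcongr
      have n2 : |(y z).2 * (y' z).2| ≤ K * ((y z).1 ^ 2 + (y z).2 ^ 2) := by
        rw [abs_mul]
        calc _ ≤ ‖y z‖ * (K * ‖y z‖) :=
              mul_le_mul (norm_snd_le (y z)) b2 (abs_nonneg _) (norm_nonneg _)
          _ = K * ‖y z‖ ^ 2 := by ring
          _ ≤ _ := by gcongr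
      have := neg_abs_le ((y z).1 * (y' z).1)
      have := neg_abs_le ((y z).2 * (y' z).2)
      linarith
  have h1 := hmono ⟨le_rfl, hml⟩ hz hz.1
  rw [hpos] at h0 ⊢
  have h2 : 0 < Real.exp (4 * K * z) * ((y z).1 ^ 2 + (y z).2 ^ 2) :=
    (mul_pos (Real.exp_pos _) h0).trans_le h1
  exact (mul_pos_iff_of_pos_left (Real.exp_pos _)).1 h2

lemma sol_ne_zero (h0 : y₀ ≠ 0) {z : ℝ} (hz : z ∈ Icc (-P.m) P.l) : P.sol y₀ x z ≠ 0 :=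
  ne_zero_of_layers (odeBound_nonneg x) continuousOn_sol_right (fun _ hz => hasDerivAt_sol hz)
    (fun _ hz => ⟨abs_rhsPsi_le _ _ hz, abs_rhsSigma_le _ _ hz⟩) (by rwa [sol_left]) hz

end Config

/-! ### The variational problem in homogeneous form, and measurability of the growth rate. -/

namespace Config

variable {P : Config}

/-- Admissible competitors of the variational problem; `χ` is the weak derivative of `ψ`. -/
def Admissible (P : Config) (φ ψ χ : ℝ → ℝ) : Prop :=
  MemLp φ 2 (volume.restrict (Ioo (-P.m) P.l)) ∧ P.IsH10 ψ χ

lemma memLp_layers {f : ℝ → ℝ} :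
    MemLp f 2 (volume.restrict (Ioo (-P.m) P.l)) ↔ MemLp f 2 (volume.restrict P.layers) := by
  rw [P.restrict_layers]

variable {φ ψ χ : ℝ → ℝ} {r s : ℝ}

lemma Admissible.memLp_phi (h : P.Admissible φ ψ χ) : MemLp φ 2 (volume.restrict P.layers) :=
  memLp_layers.1 h.1

lemma Admissible.memLp_chi (h : P.Admissible φ ψ χ) : MemLp χ 2 (volume.restrict P.layers) :=
  memLp_layers.1 h.2.1

lemma Admissible.intervalIntegrable_chi (h : P.Admissible φ ψ χ) :
    IntervalIntegrable χ volume (-P.m) P.l :=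
  intervalIntegrable_iff_layers.2 (h.memLp_chi.integrable (by norm_num))

lemma neg_m_le_l (P : Config) : -P.m ≤ P.l := by linarith [P.m_pos, P.l_pos]

lemma Admissible.continuousOn_psi (h : P.Admissible φ ψ χ) : ContinuousOn ψ (Icc (-P.m) P.l) := by
  have h1 := intervalIntegral.continuousOn_primitive_interval' h.intervalIntegrable_chi
    (left_mem_uIcc)
  rw [uIcc_of_le P.neg_m_le_l] at h1
  exact h1.congr h.2.2.1

lemma memLp_of_continuousOn {f : ℝ → ℝ} (h : ContinuousOn f (Icc (-P.m) P.l)) :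
    MemLp f 2 (volume.restrict P.layers) := by
  obtain ⟨C, hC⟩ := isCompact_Icc.exists_bound_of_continuousOn h
  have hsub := P.layers_subset.trans Ioo_subset_Icc_self
  exact MemLp.of_bound ((h.mono hsub).aestronglyMeasurable P.measurableSet_layers) C
    ((ae_restrict_iff' P.measurableSet_layers).2 (Eventually.of_forall fun z hz => hC z (hsub hz)))

lemma Admissible.memLp_psi (h : P.Admissible φ ψ χ) : MemLp ψ 2 (volume.restrict P.layers) :=
  memLp_of_continuousOn h.continuousOn_psi

lemma Admissible.psi_left (h : P.Admissible φ ψ χ) : ψ (-P.m) = 0 := by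
  rw [h.2.2.1 _ ⟨le_rfl, P.neg_m_le_l⟩, intervalIntegral.integral_same]

lemma integrable_rho_mul {f g : ℝ → ℝ} (hf : MemLp f 2 (volume.restrict P.layers))
    (hg : MemLp g 2 (volume.restrict P.layers)) :
    Integrable (fun z => P.ρ z * (f z * g z)) (volume.restrict P.layers) := by
  refine (hf.integrable_mul hg).bdd_mul (c := P.rhoMax) aesm_rho
    ((ae_restrict_iff' P.measurableSet_layers).2 (Eventually.of_forall fun z hz => ?_))
  rw [Real.norm_of_nonneg (rho_pos hz).le]
  exact le_rhoMax hz

lemma integrable_dp_rho_mul {f g : ℝ → ℝ} (hf : MemLp f 2 (volume.restrict P.layers))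
    (hg : MemLp g 2 (volume.restrict P.layers)) :
    Integrable (fun z => P.dp z * (P.ρ z * (f z * g z))) (volume.restrict P.layers) := by
  refine (integrable_rho_mul hf hg).bdd_mul (c := P.dpBound) aesm_dp
    ((ae_restrict_iff' P.measurableSet_layers).2 (Eventually.of_forall fun z hz => ?_))
  rw [Real.norm_of_nonneg (dp_pos hz).le]
  exact dp_le hz

/-- The bilinear integrand polarizing the density of `2 (E + s J)`. -/
def bilin (P : Config) (r s : ℝ) (φ ψ χ φ' ψ' χ' : ℝ → ℝ) (z : ℝ) : ℝ :=
  P.dp z * (P.ρ z * ((χ z + r * φ z) * (χ' z + r * φ' z)))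
    - P.g * r * (P.ρ z * (ψ z * φ' z)) - P.g * r * (P.ρ z * (ψ' z * φ z))
    + (4 * P.om ^ 2 + s) * (P.ρ z * (φ z * φ' z)) + s * (P.ρ z * (ψ z * ψ' z))

lemma integrable_bilin {φ' ψ' χ' : ℝ → ℝ}
    (h1 : MemLp φ 2 (volume.restrict P.layers)) (h2 : MemLp ψ 2 (volume.restrict P.layers))
    (h3 : MemLp χ 2 (volume.restrict P.layers)) (h1' : MemLp φ' 2 (volume.restrict P.layers))
    (h2' : MemLp ψ' 2 (volume.restrict P.layers)) (h3' : MemLp χ' 2 (volume.restrict P.layers)) :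
    Integrable (P.bilin r s φ ψ χ φ' ψ' χ') (volume.restrict P.layers) :=
  ((((integrable_dp_rho_mul (h3.add (h1.const_mul r)) (h3'.add (h1'.const_mul r))).sub
    ((integrable_rho_mul h2 h1').const_mul _)).sub
    ((integrable_rho_mul h2' h1).const_mul _)).add
    ((integrable_rho_mul h1 h1').const_mul _)).add ((integrable_rho_mul h2 h2').const_mul _)

lemma Admissible.integrable_bilin (h : P.Admissible φ ψ χ) :
    Integrable (P.bilin r s φ ψ χ φ ψ χ) (volume.restrict P.layers) :=
  Config.integrable_bilin h.memLp_phi h.memLp_psi h.memLp_chi h.memLp_phi h.memLp_psi h.memLp_chi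

lemma two_mul_energy (P : Config) (r : ℝ) (φ ψ χ : ℝ → ℝ) :
    2 * P.energy r φ ψ χ = ∫ z in P.layers, P.bilin r 0 φ ψ χ φ ψ χ z := by
  rw [energy, P.restrict_layers, ← mul_assoc, mul_one_div_cancel two_ne_zero, one_mul]
  refine integral_congr_ae (Eventually.of_forall fun z => ?_)
  simp only [bilin]; ring

lemma two_mul_J (P : Config) (φ ψ : ℝ → ℝ) :
    2 * P.J φ ψ = ∫ z in P.layers, P.ρ z * (φ z ^ 2 + ψ z ^ 2) := by
  rw [J, P.restrict_layers]; ring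

lemma integrable_J (h1 : MemLp φ 2 (volume.restrict P.layers))
    (h2 : MemLp ψ 2 (volume.restrict P.layers)) :
    Integrable (fun z => P.ρ z * (φ z ^ 2 + ψ z ^ 2)) (volume.restrict P.layers) := by
  refine ((integrable_rho_mul h1 h1).add (integrable_rho_mul h2 h2)).congr
    (Eventually.of_forall fun z => ?_)
  simp only [Pi.add_apply]; ring

lemma Admissible.two_mul_energy_add (h : P.Admissible φ ψ χ) :
    2 * (P.energy r φ ψ χ + s * P.J φ ψ) = ∫ z in P.layers, P.bilin r s φ ψ χ φ ψ χ z := by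
  rw [mul_add, two_mul_energy, mul_left_comm, two_mul_J, ← integral_const_mul,
    ← integral_add h.integrable_bilin ((integrable_J h.memLp_phi h.memLp_psi).const_mul s)]
  refine integral_congr_ae (Eventually.of_forall fun z => ?_)
  simp only [bilin]; ring

lemma J_nonneg (P : Config) (φ ψ : ℝ → ℝ) : 0 ≤ P.J φ ψ := by
  have : 0 ≤ 2 * P.J φ ψ := by
    rw [two_mul_J]
    exact setIntegral_nonneg P.measurableSet_layers fun z hz =>
      mul_nonneg (rho_pos hz).le (by positivity)
  linarith

/-- The energy is bounded below by `-g r` times the constraint. -/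
lemma Admissible.energy_ge (h : P.Admissible φ ψ χ) (hr : 0 ≤ r) :
    -(P.g * r) * P.J φ ψ ≤ P.energy r φ ψ χ := by
  have h1 := h.two_mul_energy_add (r := r) (s := P.g * r)
  have h2 : 0 ≤ ∫ z in P.layers, P.bilin r (P.g * r) φ ψ χ φ ψ χ z := by
    refine setIntegral_nonneg P.measurableSet_layers fun z hz => ?_
    -- With s = g r the cross term is completed to a square of ψ - φ. This is the source of λ² ≤ g
    -- r.
    have e : P.bilin r (P.g * r) φ ψ χ φ ψ χ z = P.dp z * (P.ρ z * (χ z + r * φ z) ^ 2)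
        + P.g * r * (P.ρ z * (ψ z - φ z) ^ 2) + 4 * P.om ^ 2 * (P.ρ z * φ z ^ 2) := by
      simp only [bilin]; ring
    have := dp_pos hz
    have := rho_pos hz
    have := P.g_pos
    rw [e]; positivity
  linarith

lemma Admissible.smul (h : P.Admissible φ ψ χ) (c : ℝ) :
    P.Admissible (fun z => c * φ z) (fun z => c * ψ z) (fun z => c * χ z) := by
  refine ⟨h.1.const_mul c, h.2.1.const_mul c, fun z hz => ?_, by simp [h.2.2.2]⟩
  rw [intervalIntegral.integral_const_mul, ← h.2.2.1 z hz]

lemma J_smul (c : ℝ) : P.J (fun z => c * φ z) (fun z => c * ψ z) = c ^ 2 * P.J φ ψ := by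
  rw [J, J, mul_left_comm (c ^ 2), ← integral_const_mul (c ^ 2)]
  refine congrArg (1 / 2 * ·) ?_
  refine integral_congr_ae (Eventually.of_forall fun z => ?_)
  dsimp only; ring

lemma energy_smul (c : ℝ) :
    P.energy r (fun z => c * φ z) (fun z => c * ψ z) (fun z => c * χ z)
      = c ^ 2 * P.energy r φ ψ χ := by
  rw [energy, energy, mul_left_comm (c ^ 2), ← integral_const_mul (c ^ 2)]
  refine congrArg (1 / 2 * ·) ?_
  refine integral_congr_ae (Eventually.of_forall fun z => ?_)
  dsimp only; ring

/-- A lower bound of the constrained energy gives a homogeneous inequality. -/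
lemma Admissible.nonneg_of_lowerBound (h : P.Admissible φ ψ χ)
    (hs : -s ∈ lowerBounds (P.energyValues r)) : 0 ≤ P.energy r φ ψ χ + s * P.J φ ψ := by
  rcases (P.J_nonneg φ ψ).eq_or_lt' with h0 | h0
  -- A competitor with J = 0 cannot be rescaled to the constraint. But then φ and ψ vanish almost
  -- everywhere, and only the nonnegative term in χ² remains.
  · rw [h0, mul_zero, add_zero]
    have h1 : ∫ z in P.layers, P.ρ z * (φ z ^ 2 + ψ z ^ 2) = 0 := by
      rw [← two_mul_J, h0, mul_zero]
    rw [setIntegral_eq_zero_iff_of_nonneg_ae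
      ((ae_restrict_iff' P.measurableSet_layers).2 (Eventually.of_forall fun z hz =>
        mul_nonneg (rho_pos hz).le (by positivity))) (integrable_J h.memLp_phi h.memLp_psi)] at h1
    have h2 : 0 ≤ 2 * P.energy r φ ψ χ := by
      rw [two_mul_energy]
      refine integral_nonneg_of_ae ?_
      filter_upwards [h1, (ae_restrict_iff' P.measurableSet_layers).2
        (Eventually.of_forall fun z hz => hz)] with z hz hz'
      have h3 := rho_pos hz'
      have h4 : φ z ^ 2 + ψ z ^ 2 = 0 := by simpa [h3.ne'] using hz
      have h5 : φ z = 0 := by nlinarith [sq_nonneg (φ z), sq_nonneg (ψ z)]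
      have h6 : ψ z = 0 := by nlinarith [sq_nonneg (φ z), sq_nonneg (ψ z)]
      have := dp_pos hz'
      simp only [bilin, h5, h6, Pi.zero_apply]
      ring_nf
      positivity
    linarith
  · set c := (√(P.J φ ψ))⁻¹
    have hc : c ^ 2 * P.J φ ψ = 1 := by
      simp only [c, inv_pow, Real.sq_sqrt h0.le]
      exact inv_mul_cancel₀ h0.ne'
    have h1 : -s ≤ c ^ 2 * P.energy r φ ψ χ := by
      refine hs ⟨_, _, _, (h.smul c).1, (h.smul c).2, ?_, energy_smul c |>.symm⟩
      rw [J_smul, hc]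
    have h2 : 0 ≤ c ^ 2 * (P.energy r φ ψ χ + s * P.J φ ψ) := by
      have : c ^ 2 * (P.energy r φ ψ χ + s * P.J φ ψ)
          = c ^ 2 * P.energy r φ ψ χ + s * (c ^ 2 * P.J φ ψ) := by ring
      rw [this, hc]; linarith
    have hc0 : 0 < c ^ 2 := by positivity
    exact nonneg_of_mul_nonneg_right h2 hc0

lemma lowerBound_of_nonneg
    (hs : ∀ φ ψ χ, P.Admissible φ ψ χ → 0 ≤ P.energy r φ ψ χ + s * P.J φ ψ) :
    -s ∈ lowerBounds (P.energyValues r) := by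
  rintro e ⟨φ, ψ, χ, h1, h2, h3, rfl⟩
  have := hs φ ψ χ ⟨h1, h2⟩
  rw [h3] at this
  linarith

lemma neg_mem_lowerBounds (hr : 0 ≤ r) : -(P.g * r) ∈ lowerBounds (P.energyValues r) :=
  lowerBound_of_nonneg fun φ ψ χ h => by have := h.energy_ge hr; linarith

/-- The energy of a fixed competitor depends continuously on the frequency. -/
lemma Admissible.continuous_energy (h : P.Admissible φ ψ χ) :
    Continuous fun r => P.energy r φ ψ χ := by
  have key : ∀ r, P.energy r φ ψ χ = (1 / 2) *
      ((∫ z in P.layers, P.bilin 0 0 φ ψ χ φ ψ χ z)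
      + r * (∫ z in P.layers, (2 * (P.dp z * (P.ρ z * (χ z * φ z)))
          - 2 * P.g * (P.ρ z * (ψ z * φ z))))
      + r ^ 2 * ∫ z in P.layers, P.dp z * (P.ρ z * (φ z * φ z))) := by
    intro r
    have i1 := integrable_dp_rho_mul h.memLp_chi h.memLp_phi
    have i2 := integrable_rho_mul h.memLp_psi h.memLp_phi
    have i3 := integrable_dp_rho_mul h.memLp_phi h.memLp_phi
    have i4 : Integrable (fun z => r * (2 * (P.dp z * (P.ρ z * (χ z * φ z)))
        - 2 * P.g * (P.ρ z * (ψ z * φ z)))) (volume.restrict P.layers) :=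
      ((i1.const_mul 2).sub (i2.const_mul (2 * P.g))).const_mul r
    have i5 : Integrable (fun z => P.bilin 0 0 φ ψ χ φ ψ χ z
        + r * (2 * (P.dp z * (P.ρ z * (χ z * φ z)))
        - 2 * P.g * (P.ρ z * (ψ z * φ z)))) (volume.restrict P.layers) :=
      h.integrable_bilin.add i4
    rw [← integral_const_mul, ← integral_const_mul, ← integral_add h.integrable_bilin i4,
      ← integral_add i5 (i3.const_mul _), energy, P.restrict_layers]
    congr 1
    refine integral_congr_ae (Eventually.of_forall fun z => ?_)
    simp only [bilin]; ring
  rw [funext key]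
  fun_prop

/-- The growth rate is a measurable function of the frequency. -/
lemma measurable_growthRate {R₀ : ℝ} {lam : ℝ → ℝ} (hpos : ∀ r > R₀, 0 < lam r)
    (hvar : ∀ r > R₀, IsGLB (P.energyValues r) (-(lam r) ^ 2)) (hzero : ∀ r ≤ R₀, lam r = 0) :
    Measurable lam := by
  refine measurable_of_Ioi fun c => ?_
  rcases lt_or_ge c 0 with hc | hc
  · have : lam ⁻¹' Ioi c = univ := by
      refine eq_univ_of_forall fun r => ?_
      rcases le_or_gt r R₀ with h | h
      · simpa [hzero r h] using hc
      · exact hc.trans (hpos r h)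
    rw [this]; exact MeasurableSet.univ
  -- Above R₀, the rate at r exceeds c exactly when some fixed competitor has energy below -c²
  -- there. Each such condition is open in r, so an uncountable union does no harm.
  · have : lam ⁻¹' Ioi c = Ioi R₀ ∩ ⋃ (φ : ℝ → ℝ) (ψ : ℝ → ℝ) (χ : ℝ → ℝ)
        (_ : P.Admissible φ ψ χ ∧ P.J φ ψ = 1), {r | P.energy r φ ψ χ < -c ^ 2} := by
      ext r
      simp only [mem_preimage, mem_Ioi, mem_inter_iff, mem_iUnion, mem_ofPred_eq]
      constructor
      · intro h
        have hr : R₀ < r := by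
          by_contra hcon
          rw [hzero r (not_lt.1 hcon)] at h
          linarith
        refine ⟨hr, ?_⟩
        have h1 : -(lam r) ^ 2 < -c ^ 2 := by nlinarith
        obtain ⟨e, ⟨φ, ψ, χ, a1, a2, a3, rfl⟩, he⟩ := (isGLB_lt_iff (hvar r hr)).1 h1
        exact ⟨φ, ψ, χ, ⟨⟨a1, a2⟩, a3⟩, he⟩
      · rintro ⟨hr, φ, ψ, χ, ⟨⟨a1, a2⟩, a3⟩, he⟩
        have h1 := (hvar r hr).1 ⟨φ, ψ, χ, a1, a2, a3, rfl⟩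
        have := hpos r hr
        nlinarith
    rw [this]
    refine (isOpen_Ioi.inter ?_).measurableSet
    refine isOpen_iUnion fun φ => isOpen_iUnion fun ψ => isOpen_iUnion fun χ =>
      isOpen_iUnion fun h => ?_
    exact isOpen_lt h.1.continuous_energy continuous_const

end Config

/-! ### Lower bound of the growth rate by a tent at the interface. -/

namespace Config

variable {P : Config}

/-- The tent of height one and width `2 / r` centred at the interface. -/
def tent (r z : ℝ) : ℝ := max 0 (1 - r * |z|)

/-- The derivative of the tent. -/
def tentDeriv (r z : ℝ) : ℝ := if r * |z| < 1 then (if z < 0 then r else -r) else 0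

lemma hasDerivAt_tent {r z : ℝ} (h0 : z ≠ 0) (h1 : r * |z| ≠ 1) :
    HasDerivAt (tent r) (tentDeriv r z) z := by
  have habs : HasDerivAt (fun z : ℝ => |z|) (if z < 0 then -1 else 1) z := by
    rcases lt_or_gt_of_ne h0 with h | h
    · simpa [h] using hasDerivAt_abs_neg h
    · simpa [not_lt.2 h.le] using hasDerivAt_abs_pos h
  have hlin : HasDerivAt (fun z => 1 - r * |z|) (if z < 0 then r else -r) z := by
    refine ((habs.const_mul r).const_sub 1).congr_deriv ?_
    split_ifs <;> ring
  have hcont : ContinuousAt (fun z : ℝ => r * |z|) z := by fun_prop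
  rcases lt_or_gt_of_ne h1 with h | h
  · rw [tentDeriv, if_pos h]
    refine hlin.congr_of_eventuallyEq ?_
    filter_upwards [hcont.eventually_lt continuousAt_const h] with w hw
    exact max_eq_right (by linarith)
  · rw [tentDeriv, if_neg (not_lt.2 h.le)]
    refine (hasDerivAt_const z (0 : ℝ)).congr_of_eventuallyEq ?_
    filter_upwards [continuousAt_const.eventually_lt hcont h] with w hw
    exact max_eq_left (by linarith)

lemma abs_tentDeriv_le {r : ℝ} (hr : 0 ≤ r) (z : ℝ) : |tentDeriv r z| ≤ r := by
  unfold tentDeriv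
  split_ifs <;> simp [abs_of_nonneg hr, hr]

lemma measurable_tentDeriv (r : ℝ) : Measurable (tentDeriv r) := by
  unfold tentDeriv
  refine Measurable.ite (measurableSet_lt (by fun_prop) measurable_const)
    (Measurable.ite measurableSet_Iio measurable_const measurable_const) measurable_const

lemma memLp_tentDeriv {r : ℝ} (hr : 0 ≤ r) :
    MemLp (tentDeriv r) 2 (volume.restrict (Ioo (-P.m) P.l)) :=
  MemLp.of_bound (measurable_tentDeriv r).aestronglyMeasurable r
    (Eventually.of_forall (abs_tentDeriv_le hr))

/-- The choice φ = -ψ'/r annihilates the compressive square (ψ' + rφ)² and turns the buoyancy term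
into 2gρψψ'. The conditions on r place the tent between the walls. -/
lemma admissible_tent {r : ℝ} (hr : 0 < r) (hm : 1 ≤ r * P.m) (hl : 1 ≤ r * P.l) :
    P.Admissible (fun z => -r⁻¹ * tentDeriv r z) (tent r) (tentDeriv r) := by
  have hc : Continuous (tent r) := by unfold tent; fun_prop
  have hm0 := P.m_pos
  have hl0 := P.l_pos
  have hleft : tent r (-P.m) = 0 := by
    rw [tent, abs_neg, abs_of_pos hm0]; exact max_eq_left (by linarith)
  refine ⟨(memLp_tentDeriv hr.le).const_mul _, memLp_tentDeriv hr.le, fun z hz => ?_, ?_⟩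
  · rw [integral_eq_of_hasDerivAt_off_countable_of_le (tent r) (tentDeriv r) hz.1
      (s := {0, r⁻¹, -r⁻¹}) (by simp) hc.continuousOn, hleft, sub_zero]
    · rintro w ⟨_, hw⟩
      simp only [mem_insert_iff, mem_singleton_iff, not_or] at hw
      refine hasDerivAt_tent hw.1 fun h => ?_
      have h' : |w| = r⁻¹ := eq_inv_of_mul_eq_one_right h
      rcases abs_choice w with h2 | h2 <;> rw [h2] at h'
      · exact hw.2.1 h'
      · exact hw.2.2 (by linarith)
    · have : IntervalIntegrable (fun _ : ℝ => r) volume (-P.m) z := intervalIntegrable_const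
      refine this.mono_fun (measurable_tentDeriv r).aestronglyMeasurable
        (Eventually.of_forall fun z => ?_)
      simpa [abs_of_pos hr] using abs_tentDeriv_le hr.le z
  · rw [tent, abs_of_pos hl0]; exact max_eq_left (by linarith)

lemma integral_affine (A B r a b : ℝ) :
    ∫ z in a..b, (A * (1 + r * z) + B) = A * (b - a + r * (b ^ 2 - a ^ 2) / 2) + B * (b - a) := by
  have hd : ∀ z ∈ uIcc a b, HasDerivAt (fun z => A * (z + r * z ^ 2 / 2) + B * z)
      (A * (1 + r * z) + B) z := by
    intro z _
    have h1 := (((hasDerivAt_id z).add ((((hasDerivAt_id z).pow 2).const_mul r).div_const 2)).const_mul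
      A).add ((hasDerivAt_id z).const_mul B)
    refine h1.congr_deriv ?_
    simp only [id, Nat.cast_ofNat]; ring
  rw [intervalIntegral.integral_eq_sub_of_hasDerivAt hd
    ((by fun_prop : Continuous _).intervalIntegrable _ _)]
  ring

set_option maxHeartbeats 800000 in
/-- The growth rate is at least of the order of the square root of the frequency. -/
theorem exists_growth_lowerBound (P : Config) :
    ∃ c > 0, ∃ r₀ > 0, ∀ r ≥ r₀, ∀ s ≥ 0, -s ∈ lowerBounds (P.energyValues r) → c * r ≤ s := by
  have hg := P.g_pos
  have hb := P.rhoMax_pos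
  set b := P.rhoMax
  have hΔ : 0 < P.ρPlus - P.ρMinus := sub_pos.2 P.density_jump
  set Δ := P.ρPlus - P.ρMinus
  have hε : 0 < Δ / 4 := by positivity
  have e1 : ∀ᶠ z in 𝓝[>] (0 : ℝ), P.ρPlus - Δ / 4 < P.ρ z :=
    P.ρ_trace_plus.eventually (lt_mem_nhds (by linarith))
  have e2 : ∀ᶠ z in 𝓝[<] (0 : ℝ), P.ρ z < P.ρMinus + Δ / 4 :=
    P.ρ_trace_minus.eventually (gt_mem_nhds (by linarith))
  obtain ⟨u, hu, hu'⟩ := mem_nhdsGT_iff_exists_Ioo_subset.1 e1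
  obtain ⟨w, hw, hw'⟩ := mem_nhdsLT_iff_exists_Ioo_subset.1 e2
  simp only [mem_Ioi, mem_Iio] at hu hw
  have hm0 := P.m_pos
  have hl0 := P.l_pos
  have hD : 0 < P.g * Δ := by positivity
  -- The first four summands make the tent fit into both layers and into the neighbourhoods where ρ
  -- is on the right side of its trace up to Δ/4. The last one lets the Coriolis term consume at
  -- most half of the buoyancy gain.
  set r₀ := u⁻¹ + (-w)⁻¹ + P.m⁻¹ + P.l⁻¹ + 32 * P.om ^ 2 * b / (P.g * Δ)
  have p1 : 0 < u⁻¹ := inv_pos.2 hu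
  have p2 : 0 < (-w)⁻¹ := inv_pos.2 (by linarith)
  have p3 : 0 < P.m⁻¹ := inv_pos.2 hm0
  have p4 : 0 < P.l⁻¹ := inv_pos.2 hl0
  have p5 : 0 ≤ 32 * P.om ^ 2 * b / (P.g * Δ) := by positivity
  refine ⟨P.g * Δ / (16 * b), by positivity, r₀, by positivity, fun r hr s hs hlow => ?_⟩
  have hr0 : 0 < r := by have : 0 < r₀ := by positivity
                         linarith
  have hle : ∀ x, 0 < x → x⁻¹ ≤ r → r⁻¹ ≤ x := fun x hx h => inv_le_of_inv_le₀ hx h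
  have q1 : r⁻¹ ≤ u := hle u hu (by simp only [r₀] at hr; linarith)
  have q2 : r⁻¹ ≤ -w := hle _ (by linarith) (by simp only [r₀] at hr; linarith)
  have q3 : r⁻¹ ≤ P.m := hle _ hm0 (by simp only [r₀] at hr; linarith)
  have q4 : r⁻¹ ≤ P.l := hle _ hl0 (by simp only [r₀] at hr; linarith)
  have q5 : 32 * P.om ^ 2 * b ≤ P.g * Δ * r := by
    rw [← div_le_iff₀' hD]; simp only [r₀] at hr; linarith
  have hrinv : r * r⁻¹ = 1 := mul_inv_cancel₀ hr0.ne'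
  have hinv : 0 < r⁻¹ := inv_pos.2 hr0
  have hlt : ∀ x, x < r⁻¹ → r * x < 1 := fun x hx => by
    have := mul_lt_mul_of_pos_left hx hr0
    rwa [hrinv] at this
  have hgt : ∀ x, r⁻¹ < x → 1 < r * x := fun x hx => by
    have := mul_lt_mul_of_pos_left hx hr0
    rwa [hrinv] at this
  have hge : ∀ x, r⁻¹ ≤ x → 1 ≤ r * x := fun x hx => by
    have := mul_le_mul_of_nonneg_left hx hr0.le
    rwa [hrinv] at this
  have hadm : P.Admissible (fun z => -r⁻¹ * tentDeriv r z) (tent r) (tentDeriv r) :=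
    admissible_tent hr0 (hge _ q3) (hge _ q4)
  have h1 := hadm.nonneg_of_lowerBound hlow
  have h2 := hadm.two_mul_energy_add (r := r) (s := s)
  set F := P.bilin r s (fun z => -r⁻¹ * tentDeriv r z) (tent r) (tentDeriv r)
    (fun z => -r⁻¹ * tentDeriv r z) (tent r) (tentDeriv r) with hF
  have hint : IntervalIntegrable F volume (-P.m) P.l :=
    intervalIntegrable_iff_layers.2 hadm.integrable_bilin
  have hsub : ∀ a b, -P.m ≤ a → a ≤ b → b ≤ P.l → IntervalIntegrable F volume a b := by
    intro a b h1 h2 h3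
    refine hint.mono_set ?_
    rw [uIcc_of_le h2, uIcc_of_le P.neg_m_le_l]
    exact Icc_subset_Icc h1 h3
  have i1 := hsub (-P.m) (-r⁻¹) le_rfl (by linarith) (by linarith)
  have i2 := hsub (-r⁻¹) 0 (by linarith) (by linarith) (by linarith)
  have i3 := hsub 0 r⁻¹ (by linarith) (by linarith) (by linarith)
  have i4 := hsub r⁻¹ P.l (by linarith) (by linarith) le_rfl
  have hsplit : ∫ z in P.layers, F z = (∫ z in (-P.m)..(-r⁻¹), F z) + (∫ z in (-r⁻¹)..0, F z)
      + (∫ z in 0..r⁻¹, F z) + ∫ z in r⁻¹..P.l, F z := by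
    rw [← intervalIntegral_eq_layers, intervalIntegral.integral_add_adjacent_intervals i1 i2,
      intervalIntegral.integral_add_adjacent_intervals (i1.trans i2) i3,
      intervalIntegral.integral_add_adjacent_intervals ((i1.trans i2).trans i3) i4]
  have hout : ∀ z, 1 < r * |z| → F z = 0 := by
    intro z hz
    have t1 : tent r z = 0 := max_eq_left (by linarith)
    have t2 : tentDeriv r z = 0 := if_neg (not_lt.2 hz.le)
    simp [hF, bilin, t1, t2]
  have k1 : ∫ z in (-P.m)..(-r⁻¹), F z ≤ 0 := by
    have := intervalIntegral.integral_mono_on_of_le_Ioo (by linarith) i1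
      (g := fun _ => (0 : ℝ)) intervalIntegrable_const fun z hz => by
        refine (hout z ?_).le
        rw [abs_of_neg (by linarith [hz.2])]
        exact hgt _ (by linarith [hz.2])
    simpa using this
  have k4 : ∫ z in r⁻¹..P.l, F z ≤ 0 := by
    have := intervalIntegral.integral_mono_on_of_le_Ioo (by linarith) i4
      (g := fun _ => (0 : ℝ)) intervalIntegrable_const fun z hz => by
        refine (hout z ?_).le
        rw [abs_of_pos (by linarith [hz.1])]
        exact hgt _ hz.1
    simpa using this
  -- Buoyancy costs energy below the interface and releases it above, in proportion to the density
  -- on each side.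
  have hin : ∀ z, r * |z| < 1 → z ≠ 0 → F z = (if z < 0 then 2 * P.g * r else -(2 * P.g * r))
      * P.ρ z * (1 - r * |z|) + (4 * P.om ^ 2 + s) * P.ρ z + s * P.ρ z * (1 - r * |z|) ^ 2 := by
    intro z hz _
    have t1 : tent r z = 1 - r * |z| := max_eq_right (by linarith)
    have hr1 : r⁻¹ * r = 1 := inv_mul_cancel₀ hr0.ne'
    simp only [hF, bilin, t1, tentDeriv, if_pos hz]
    split_ifs
    · have : r + r * (-r⁻¹ * r) = 0 := by rw [neg_mul, hr1]; ring
      rw [this, neg_mul, hr1]; ring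
    · have : -r + r * (-r⁻¹ * -r) = 0 := by rw [neg_mul_neg, hr1]; ring
      rw [this, neg_mul_neg, hr1]; ring
  have hrest : ∀ z ∈ P.layers, 0 ≤ 1 - r * |z| → (4 * P.om ^ 2 + s) * P.ρ z
      + s * P.ρ z * (1 - r * |z|) ^ 2 ≤ (4 * P.om ^ 2 + 2 * s) * b := by
    intro z hz h0
    have h3 := le_rhoMax hz
    have h4 := rho_pos hz
    have h5 : 1 - r * |z| ≤ 1 := sub_le_self _ (mul_nonneg hr0.le (abs_nonneg z))
    have h6 : (1 - r * |z|) ^ 2 ≤ 1 := pow_le_one₀ h0 h5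
    have h7 : s * P.ρ z * (1 - r * |z|) ^ 2 ≤ s * P.ρ z * 1 := by gcongr
    have h8 : (4 * P.om ^ 2 + 2 * s) * P.ρ z ≤ (4 * P.om ^ 2 + 2 * s) * b := by gcongr
    linarith
  -- The integral of 2gr(1 + rz) over (-1/r, 0) equals g, whatever r is. Cost below and gain above
  -- (`k3`) therefore differ by gΔ/2, while the remaining terms are O((ω² + s)/r).
  have k2 : ∫ z in (-r⁻¹)..0, F z ≤ P.g * (P.ρMinus + Δ / 4) + (4 * P.om ^ 2 + 2 * s) * b * r⁻¹ := by
    refine (intervalIntegral.integral_mono_on_of_le_Ioo (by linarith) i2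
      (g := fun z => (2 * P.g * r * (P.ρMinus + Δ / 4)) * (1 + r * z)
        + (4 * P.om ^ 2 + 2 * s) * b)
      ((by fun_prop : Continuous _).intervalIntegrable _ _) fun z hz => ?_).trans_eq ?_
    · have hz1 := hz.1
      have hz2 := hz.2
      have ha : |z| = -z := abs_of_neg hz2
      have hz3 : 0 < 1 - r * |z| := sub_pos.2 (hlt _ (by rw [ha]; linarith))
      have hρ : P.ρ z < P.ρMinus + Δ / 4 := hw' ⟨by linarith, hz2⟩
      rw [hin z (by linarith) hz2.ne, if_pos hz2]
      have h5 := hrest z (mem_layers_lower (by linarith) hz2) hz3.le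
      have h6 : 2 * P.g * r * P.ρ z * (1 - r * |z|)
          ≤ 2 * P.g * r * (P.ρMinus + Δ / 4) * (1 - r * |z|) := by gcongr
      have h7 : 1 - r * |z| = 1 + r * z := by rw [ha]; ring
      rw [h7] at h6 h5 ⊢
      linarith
    · rw [integral_affine]
      have : r * r⁻¹ ^ 2 = r⁻¹ := by rw [pow_two, ← mul_assoc, hrinv, one_mul]
      linear_combination (P.g * (P.ρMinus + Δ / 4)) * hrinv
        - P.g * r * (P.ρMinus + Δ / 4) * this + 0 * hrinv
  have k3 : ∫ z in 0..r⁻¹, F z ≤ -(P.g * (P.ρPlus - Δ / 4)) + (4 * P.om ^ 2 + 2 * s) * b * r⁻¹ := by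
    refine (intervalIntegral.integral_mono_on_of_le_Ioo (by linarith) i3
      (g := fun z => (-(2 * P.g * r) * (P.ρPlus - Δ / 4)) * (1 + (-r) * z)
        + (4 * P.om ^ 2 + 2 * s) * b)
      ((by fun_prop : Continuous _).intervalIntegrable _ _) fun z hz => ?_).trans_eq ?_
    · have hz1 := hz.1
      have hz2 := hz.2
      have ha : |z| = z := abs_of_pos hz1
      have hz3 : 0 < 1 - r * |z| := sub_pos.2 (hlt _ (by rw [ha]; linarith))
      have hρ : P.ρPlus - Δ / 4 < P.ρ z := hu' ⟨hz1, by linarith⟩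
      rw [hin z (by linarith) hz1.ne', if_neg (not_lt.2 hz1.le)]
      have h5 := hrest z (mem_layers_upper hz1 (by linarith)) hz3.le
      have h6 : 2 * P.g * r * (P.ρPlus - Δ / 4) * (1 - r * |z|)
          ≤ 2 * P.g * r * P.ρ z * (1 - r * |z|) := by gcongr
      have h7 : 1 - r * |z| = 1 + (-r) * z := by rw [ha]; ring
      rw [h7] at h6 h5 ⊢
      linarith
    · rw [integral_affine]
      have : r * r⁻¹ ^ 2 = r⁻¹ := by rw [pow_two, ← mul_assoc, hrinv, one_mul]
      linear_combination -(P.g * (P.ρPlus - Δ / 4)) * hrinv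
        + P.g * r * (P.ρPlus - Δ / 4) * this
  have hfin : 0 ≤ -(P.g * Δ / 2) + 2 * ((4 * P.om ^ 2 + 2 * s) * b * r⁻¹) := by
    have : P.g * (P.ρMinus + Δ / 4) - P.g * (P.ρPlus - Δ / 4) = -(P.g * Δ / 2) := by
      simp only [Δ]; ring
    linarith
  have hfin' : P.g * Δ / 2 * r ≤ 2 * ((4 * P.om ^ 2 + 2 * s) * b) := by
    have h9 : 0 ≤ r * (-(P.g * Δ / 2) + 2 * ((4 * P.om ^ 2 + 2 * s) * b * r⁻¹)) :=
      mul_nonneg hr0.le hfin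
    have h10 : r * (-(P.g * Δ / 2) + 2 * ((4 * P.om ^ 2 + 2 * s) * b * r⁻¹))
      = -(P.g * Δ / 2 * r) + 2 * ((4 * P.om ^ 2 + 2 * s) * b) * (r * r⁻¹) := by ring
    rw [h10, hrinv] at h9
    linarith
  rw [div_mul_eq_mul_div, div_le_iff₀ (by positivity)]
  linarith

end Config

/-! ### Sturm theory: at the infimum the solution satisfies the condition at the upper wall. -/

namespace Config

variable {P : Config}

/-- `y = (ψ, σ)` solves the first order system in both layers and is continuous up to the
interface and the walls. -/
structure IsSol (P : Config) (x : ℝ × ℝ) (y : ℝ → ℝ × ℝ) : Prop where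
  continuousOn : ContinuousOn y (Icc (-P.m) P.l)
  hasDerivAt : ∀ z ∈ P.layers, HasDerivAt y (P.rhsPsi x (y z) z, P.rhsSigma x (y z) z) z

lemma isSol_sol (y₀ x : ℝ × ℝ) : P.IsSol x (P.sol y₀ x) :=
  ⟨continuousOn_sol_right, fun _ hz => hasDerivAt_sol hz⟩

variable {x : ℝ × ℝ} {y y' : ℝ → ℝ × ℝ} {r s : ℝ}

lemma IsSol.add (h : P.IsSol x y) (h' : P.IsSol x y') : P.IsSol x (fun z => y z + y' z) := by
  refine ⟨h.continuousOn.add h'.continuousOn, fun z hz => ?_⟩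
  refine ((h.hasDerivAt z hz).add (h'.hasDerivAt z hz)).congr_deriv ?_
  ext <;> simp [rhsPsi, rhsSigma] <;> ring

lemma IsSol.smul (h : P.IsSol x y) (c : ℝ) : P.IsSol x (fun z => c • y z) := by
  refine ⟨h.continuousOn.const_smul c, fun z hz => ?_⟩
  refine ((h.hasDerivAt z hz).const_smul c).congr_deriv ?_
  ext <;> simp [rhsPsi, rhsSigma] <;> ring

lemma IsSol.psi (h : P.IsSol x y) {z : ℝ} (hz : z ∈ P.layers) :
    HasDerivAt (fun z => (y z).1) (P.rhsPsi x (y z) z) z := hasDerivAt_fst (h.hasDerivAt z hz)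

lemma IsSol.sigma (h : P.IsSol x y) {z : ℝ} (hz : z ∈ P.layers) :
    HasDerivAt (fun z => (y z).2) (P.rhsSigma x (y z) z) z := hasDerivAt_snd (h.hasDerivAt z hz)

lemma layers_subset_Icc (P : Config) : P.layers ⊆ Icc (-P.m) P.l :=
  P.layers_subset.trans Ioo_subset_Icc_self

lemma IsSol.continuousOn_layers (h : P.IsSol x y) : ContinuousOn y P.layers :=
  h.continuousOn.mono P.layers_subset_Icc

lemma IsSol.continuousOn_rhsPsi (h : P.IsSol x y) :
    ContinuousOn (fun z => P.rhsPsi x (y z) z) P.layers :=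
  (((continuousOn_odeMat x).clm_apply h.continuousOn_layers).congr fun _ hz =>
    (odeMat_apply hz).symm).fst

lemma IsSol.continuousOn_rhsSigma (h : P.IsSol x y) :
    ContinuousOn (fun z => P.rhsSigma x (y z) z) P.layers :=
  (((continuousOn_odeMat x).clm_apply h.continuousOn_layers).congr fun _ hz =>
    (odeMat_apply hz).symm).snd

lemma IsSol.exists_bound (h : P.IsSol x y) : ∃ C, ∀ z ∈ Icc (-P.m) P.l, ‖y z‖ ≤ C :=
  isCompact_Icc.exists_bound_of_continuousOn h.continuousOn

lemma IsSol.bound_rhs (h : P.IsSol x y) : ∃ C, ∀ z ∈ P.layers,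
    |P.rhsPsi x (y z) z| ≤ C ∧ |P.rhsSigma x (y z) z| ≤ C := by
  obtain ⟨C, hC⟩ := h.exists_bound
  refine ⟨P.odeBound x * C, fun z hz => ?_⟩
  have h1 := mul_le_mul_of_nonneg_left (hC z (P.layers_subset_Icc hz)) (odeBound_nonneg (P := P) x)
  exact ⟨(abs_rhsPsi_le x _ hz).trans h1, (abs_rhsSigma_le x _ hz).trans h1⟩

/-- The parameters `s = λ²` and `μ = r² / (s + 4ω²)` of the first order system. -/
def par (P : Config) (r s : ℝ) : ℝ × ℝ := (s, r ^ 2 / (s + 4 * P.om ^ 2))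

lemma den_pos (hs : 0 < s) : 0 < s + 4 * P.om ^ 2 := by positivity

/-- A solution without zeros makes the second variation nonnegative. -/
lemma IsSol.energy_nonneg (hs : 0 < s) (h : P.IsSol (P.par r s) y)
    (hpos : ∀ z ∈ Icc (-P.m) P.l, 0 < (y z).1) {φ ψ χ : ℝ → ℝ} (ha : P.Admissible φ ψ χ) :
    0 ≤ P.energy r φ ψ χ + s * P.J φ ψ := by
  have hml := P.neg_m_le_l
  -- The Riccati variable σ/ψ of the positive solution. Subtracting the exact derivative (k ψ²)' of
  -- the competitor from the integrand leaves a sum of squares, and the exact derivative integrates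
  -- to zero because the competitor vanishes at the walls.
  set k : ℝ → ℝ := fun z => (y z).2 / (y z).1
  set k' : ℝ → ℝ := fun z => (P.rhsSigma (P.par r s) (y z) z * (y z).1
    - (y z).2 * P.rhsPsi (P.par r s) (y z) z) / (y z).1 ^ 2
  have hkc : ContinuousOn k (Icc (-P.m) P.l) :=
    h.continuousOn.snd.div h.continuousOn.fst fun z hz => (hpos z hz).ne'
  have hkd : ∀ z ∈ P.layers, HasDerivAt k (k' z) z := fun z hz =>
    (h.sigma hz).div (h.psi hz) (hpos z (P.layers_subset_Icc hz)).ne'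
  have hk'c : ContinuousOn k' P.layers :=
    ((h.continuousOn_rhsSigma.mul h.continuousOn_layers.fst).sub
      (h.continuousOn_layers.snd.mul h.continuousOn_rhsPsi)).div
      (h.continuousOn_layers.fst.pow 2)
      fun z hz => (pow_pos (hpos z (P.layers_subset_Icc hz)) 2).ne'
  have hk'b : ∃ C, ∀ z ∈ P.layers, |k' z| ≤ C := by
    obtain ⟨B, hB⟩ := h.exists_bound
    obtain ⟨C, hC⟩ := h.bound_rhs
    obtain ⟨D, hD⟩ := isCompact_Icc.exists_bound_of_continuousOn
      (f := fun z => ((y z).1 ^ 2)⁻¹) ((h.continuousOn.fst.pow 2).inv₀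
        fun z hz => (pow_pos (hpos z hz) 2).ne')
    refine ⟨(C * B + B * C) * D, fun z hz => ?_⟩
    have hz' := P.layers_subset_Icc hz
    have hC0 : 0 ≤ C := (abs_nonneg _).trans (hC z hz).1
    have hB0 : 0 ≤ B := (norm_nonneg _).trans (hB z hz')
    simp only [k', div_eq_mul_inv]
    rw [abs_mul]
    refine mul_le_mul ?_ (hD z hz') (abs_nonneg _) (by positivity)
    refine (abs_sub _ _).trans ?_
    rw [abs_mul, abs_mul]
    have e1 : |(y z).1| ≤ B := (norm_fst_le (y z)).trans (hB z hz')
    have e2 : |(y z).2| ≤ B := (norm_snd_le (y z)).trans (hB z hz')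
    exact add_le_add (mul_le_mul (hC z hz).2 e1 (abs_nonneg _) hC0)
      (mul_le_mul e2 (hC z hz).1 (abs_nonneg _) hB0)
  obtain ⟨C, hC⟩ := hk'b
  have hk'i : IntervalIntegrable k' volume (-P.m) P.l :=
    intervalIntegrable_iff_layers.2 (integrableOn_layers hk'c hC)
  -- The competitor is only in H¹ and k has a corner at the interface. Writing both as primitives
  -- gives absolute continuity and almost everywhere derivatives.
  set U : ℝ → ℝ := fun z => ∫ t in (-P.m)..z, χ t
  set H : ℝ → ℝ := fun z => k (-P.m) + ∫ t in (-P.m)..z, k' t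
  have hH : ∀ z ∈ Icc (-P.m) P.l, H z = k z := fun z hz => by
    simp only [H]
    rw [integral_of_layers hkc hkd hk'i le_rfl hz.1 hz.2]; ring
  have hU : ∀ z ∈ Icc (-P.m) P.l, U z = ψ z := fun z hz => (ha.2.2.1 z hz).symm
  have hχi := ha.intervalIntegrable_chi
  have acU : AbsolutelyContinuousOnInterval U (-P.m) P.l :=
    hχi.absolutelyContinuousOnInterval_intervalIntegral (by simp)
  have acH : AbsolutelyContinuousOnInterval H (-P.m) P.l := by
    have h1 := hk'i.absolutelyContinuousOnInterval_intervalIntegral (c := -P.m) (by simp)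
    have h2 : AbsolutelyContinuousOnInterval (fun _ : ℝ => k (-P.m)) (-P.m) P.l :=
      (LipschitzWith.const (k (-P.m))).lipschitzOnWith.absolutelyContinuousOnInterval
    exact h2.add h1
  have acf : AbsolutelyContinuousOnInterval (fun z => H z * (U z * U z)) (-P.m) P.l :=
    acH.fun_mul (acU.fun_mul acU)
  have h0 := acf.integral_deriv_eq_sub
  rw [hU P.l ⟨hml, le_rfl⟩, hU (-P.m) ⟨le_rfl, hml⟩, ha.2.2.2, ha.psi_left] at h0
  simp only [mul_zero, sub_zero] at h0
  rw [intervalIntegral_eq_layers] at h0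
  have hle : ∫ z in P.layers, deriv (fun z => H z * (U z * U z)) z
      ≤ ∫ z in P.layers, P.bilin r s φ ψ χ φ ψ χ z := by
    refine integral_mono_ae (intervalIntegrable_iff_layers.1 acf.intervalIntegrable_deriv)
      ha.integrable_bilin ?_
    have d1 := hχi.ae_hasDerivAt_integral
    have d2 := hk'i.ae_hasDerivAt_integral
    filter_upwards [ae_restrict_of_ae d1, ae_restrict_of_ae d2,
      (ae_restrict_iff' P.measurableSet_layers).2 (Eventually.of_forall fun z hz => hz)]
      with z hz1 hz2 hz
    have hz' := P.layers_subset_Icc hz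
    have hzu : z ∈ uIcc (-P.m) P.l := by rwa [uIcc_of_le hml]
    have e1 : HasDerivAt U (χ z) z := hz1 hzu (-P.m) left_mem_uIcc
    have e2 : HasDerivAt H (k' z) z := (hz2 hzu (-P.m) left_mem_uIcc).const_add _
    have e3 : HasDerivAt (fun z => H z * (U z * U z))
        (k' z * (U z * U z) + H z * (χ z * U z + U z * χ z)) z := e2.mul (e1.mul e1)
    rw [e3.deriv, hH z hz', hU z hz']
    have hy := (hpos z hz').ne'
    have hdp := dp_pos hz
    have hρ := rho_pos hz
    have hD := den_pos (P := P) hs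
    -- The first square completes the quadratic in χ, the second the one in φ. What is left is a
    -- multiple of ψ², which cancels by the Riccati equation `hk'`.
    have key : P.bilin r s φ ψ χ φ ψ χ z
        - (k' z * (ψ z * ψ z) + k z * (χ z * ψ z + ψ z * χ z))
        = P.dp z * P.ρ z * (χ z + r * φ z - k z * ψ z / (P.dp z * P.ρ z)) ^ 2
          + (s + 4 * P.om ^ 2) * P.ρ z * (φ z - r * ψ z * (P.g - k z / P.ρ z)
            / (s + 4 * P.om ^ 2)) ^ 2 := by
      have hk' : k' z = (s - P.g ^ 2 * (P.par r s).2) * P.ρ z + 2 * P.g * (P.par r s).2 * k z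
          - ((P.dp z * P.ρ z)⁻¹ + (P.par r s).2 / P.ρ z) * k z ^ 2 := by
        simp only [k', k, rhsSigma, rhsPsi, par]
        field_simp
        ring
      rw [hk']
      simp only [bilin, par]
      field_simp
      ring
    have hnn : 0 ≤ P.bilin r s φ ψ χ φ ψ χ z
        - (k' z * (ψ z * ψ z) + k z * (χ z * ψ z + ψ z * χ z)) := by
      rw [key]; positivity
    exact sub_nonneg.1 hnn
  have := ha.two_mul_energy_add (r := r) (s := s)
  linarith

/-- The horizontal profile of a solution of the first order system. -/
def phiOf (P : Config) (r s : ℝ) (y : ℝ → ℝ × ℝ) (z : ℝ) : ℝ :=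
  r / (s + 4 * P.om ^ 2) * (P.g * (y z).1 - (y z).2 / P.ρ z)

/-- The profile `phiOf` is stationary in φ, so the test function φ' drops out. If χ' is the
derivative of the test function ψ', the rest is the exact derivative of σ times ψ', and Green's
formula is a single integration. -/
lemma bilin_phiOf (hs : 0 < s) (φ' ψ' χ' : ℝ → ℝ) {z : ℝ} (hz : z ∈ P.layers) :
    P.bilin r s (P.phiOf r s y) (fun z => (y z).1) (fun z => P.rhsPsi (P.par r s) (y z) z)
      φ' ψ' χ' z = (y z).2 * χ' z + P.rhsSigma (P.par r s) (y z) z * ψ' z := by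
  have hdp := dp_pos hz
  have hρ := rho_pos hz
  have hD := den_pos (P := P) hs
  simp only [bilin, phiOf, rhsPsi, rhsSigma, par]
  field_simp
  ring

/-- For small ε the linear term prevails; ε = -a/(|b| + 1) is small enough whatever the sign of b.
-/
lemma eq_zero_of_quadratic_nonneg {a b : ℝ} (h : ∀ ε : ℝ, 0 ≤ 2 * ε * a + ε ^ 2 * b) : a = 0 := by
  by_contra ha
  have hk : 0 < |b| + 1 := by positivity
  have h1 := h (-a / (|b| + 1))
  have h2 : 2 * (-a / (|b| + 1)) * a + (-a / (|b| + 1)) ^ 2 * b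
      = a ^ 2 / (|b| + 1) ^ 2 * (b - 2 * (|b| + 1)) := by
    field_simp
    ring
  rw [h2] at h1
  have h3 : 0 < a ^ 2 / (|b| + 1) ^ 2 := by positivity
  have h4 := (mul_nonneg_iff_of_pos_left h3).1 h1
  have := le_abs_self b
  have := abs_nonneg b
  linarith

lemma Admissible.add_smul {φ ψ χ φ' ψ' χ' : ℝ → ℝ} (h : P.Admissible φ ψ χ)
    (h' : P.Admissible φ' ψ' χ') (ε : ℝ) :
    P.Admissible (fun z => φ z + ε * φ' z) (fun z => ψ z + ε * ψ' z)
      (fun z => χ z + ε * χ' z) := by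
  refine ⟨h.1.add (h'.1.const_mul ε), h.2.1.add (h'.2.1.const_mul ε), fun z hz => ?_, ?_⟩
  · have hsub : uIcc (-P.m) z ⊆ uIcc (-P.m) P.l := by
      rw [uIcc_of_le hz.1, uIcc_of_le P.neg_m_le_l]
      exact Icc_subset_Icc le_rfl hz.2
    rw [intervalIntegral.integral_add (h.intervalIntegrable_chi.mono_set hsub)
      ((h'.intervalIntegrable_chi.mono_set hsub).const_mul ε),
      intervalIntegral.integral_const_mul, ← h.2.2.1 z hz, ← h'.2.2.1 z hz]
  · simp [h.2.2.2, h'.2.2.2]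

lemma IsSol.intervalIntegrable_rhsPsi (h : P.IsSol x y) :
    IntervalIntegrable (fun z => P.rhsPsi x (y z) z) volume (-P.m) P.l := by
  obtain ⟨C, hC⟩ := h.bound_rhs
  exact intervalIntegrable_iff_layers.2 (integrableOn_layers h.continuousOn_rhsPsi
    fun z hz => (hC z hz).1)

lemma IsSol.intervalIntegrable_rhsSigma (h : P.IsSol x y) :
    IntervalIntegrable (fun z => P.rhsSigma x (y z) z) volume (-P.m) P.l := by
  obtain ⟨C, hC⟩ := h.bound_rhs
  exact intervalIntegrable_iff_layers.2 (integrableOn_layers h.continuousOn_rhsSigma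
    fun z hz => (hC z hz).2)

lemma IsSol.continuousOn_phiOf (h : P.IsSol x y) : ContinuousOn (P.phiOf r s y) P.layers :=
  continuousOn_const.mul ((continuousOn_const.mul h.continuousOn_layers.fst).sub
    (h.continuousOn_layers.snd.div contDiffOn_rho.continuousOn fun _ hz => (rho_pos hz).ne'))

lemma IsSol.exists_bound_phiOf (h : P.IsSol x y) : ∃ C, ∀ z ∈ P.layers, |P.phiOf r s y z| ≤ C := by
  obtain ⟨B, hB⟩ := h.exists_bound
  refine ⟨|r / (s + 4 * P.om ^ 2)| * (P.g * B + B * P.rhoMin⁻¹), fun z hz => ?_⟩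
  have hz' := P.layers_subset_Icc hz
  have e1 : |(y z).1| ≤ B := (norm_fst_le (y z)).trans (hB z hz')
  have e2 : |(y z).2| ≤ B := (norm_snd_le (y z)).trans (hB z hz')
  have hB0 : 0 ≤ B := (norm_nonneg _).trans (hB z hz')
  have hg := P.g_pos
  rw [phiOf, abs_mul]
  refine mul_le_mul_of_nonneg_left ((abs_sub _ _).trans ?_) (abs_nonneg _)
  rw [abs_mul, abs_of_pos P.g_pos, abs_div, abs_of_pos (rho_pos hz), div_eq_mul_inv]
  have h3 := rho_pos hz
  have h4 := inv_rho_le hz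
  gcongr

/-- A solution vanishing at the lower wall and at `z₀`, cut off above `z₀`, is a competitor. -/
lemma IsSol.admissible_cut (h : P.IsSol (P.par r s) y) (h0 : (y (-P.m)).1 = 0) {z₀ : ℝ}
    (hz₀ : z₀ ∈ Icc (-P.m) P.l) (hy : (y z₀).1 = 0) :
    P.Admissible ((Iic z₀).indicator (P.phiOf r s y)) ((Iic z₀).indicator fun z => (y z).1)
      ((Iic z₀).indicator fun z => P.rhsPsi (P.par r s) (y z) z) := by
  obtain ⟨C, hC⟩ := h.exists_bound_phiOf (r := r) (s := s)
  obtain ⟨D, hD⟩ := h.bound_rhs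
  have hχ : MemLp (fun z => P.rhsPsi (P.par r s) (y z) z) 2 (volume.restrict P.layers) :=
    MemLp.of_bound (h.continuousOn_rhsPsi.aestronglyMeasurable P.measurableSet_layers) D
      ((ae_restrict_iff' P.measurableSet_layers).2 (Eventually.of_forall fun z hz => (hD z hz).1))
  have hφ : MemLp (P.phiOf r s y) 2 (volume.restrict P.layers) :=
    MemLp.of_bound (h.continuousOn_phiOf.aestronglyMeasurable P.measurableSet_layers) C
      ((ae_restrict_iff' P.measurableSet_layers).2 (Eventually.of_forall fun z hz => hC z hz))
  have hint := h.intervalIntegrable_rhsPsi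
  have hlow : ∀ z ∈ Icc (-P.m) z₀, (y z).1 = ∫ t in (-P.m)..z,
      (Iic z₀).indicator (fun z => P.rhsPsi (P.par r s) (y z) z) t := by
    intro z hz
    have := integral_of_layers h.continuousOn.fst (fun z hz => h.psi hz) hint le_rfl hz.1
      (hz.2.trans hz₀.2)
    rw [h0, sub_zero] at this
    rw [← this]
    refine intervalIntegral.integral_congr fun t ht => ?_
    rw [uIcc_of_le hz.1] at ht
    exact (indicator_of_mem (show t ∈ Iic z₀ from ht.2.trans hz.2) _).symm
  have hind : IntervalIntegrable ((Iic z₀).indicator fun z => P.rhsPsi (P.par r s) (y z) z)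
      volume (-P.m) P.l := by
    rw [intervalIntegrable_iff] at hint ⊢
    exact Integrable.indicator hint measurableSet_Iic
  have hall : ∀ z ∈ Icc (-P.m) P.l, (Iic z₀).indicator (fun z => (y z).1) z = ∫ t in (-P.m)..z,
      (Iic z₀).indicator (fun z => P.rhsPsi (P.par r s) (y z) z) t := by
    intro z hz
    rcases le_or_gt z z₀ with hle | hlt
    · rw [indicator_of_mem (show z ∈ Iic z₀ from hle)]
      exact hlow z ⟨hz.1, hle⟩
    · rw [indicator_of_notMem (show z ∉ Iic z₀ from not_le.2 hlt)]
      have hs : ∀ a b, -P.m ≤ a → a ≤ b → b ≤ P.l → uIcc a b ⊆ uIcc (-P.m) P.l := by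
        intro a b h1 h2 h3
        rw [uIcc_of_le h2, uIcc_of_le P.neg_m_le_l]
        exact Icc_subset_Icc h1 h3
      rw [← intervalIntegral.integral_add_adjacent_intervals
        (hind.mono_set (hs (-P.m) z₀ le_rfl hz₀.1 hz₀.2))
        (hind.mono_set (hs z₀ z hz₀.1 hlt.le hz.2)), ← hlow z₀ ⟨hz₀.1, le_rfl⟩, hy, zero_add]
      symm
      rw [intervalIntegral.integral_of_le hlt.le]
      refine setIntegral_eq_zero_of_forall_eq_zero fun t ht => ?_
      exact indicator_of_notMem (show t ∉ Iic z₀ from not_le.2 ht.1) _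
  refine ⟨memLp_layers.2 (hφ.indicator measurableSet_Iic),
    memLp_layers.2 (hχ.indicator measurableSet_Iic), hall, ?_⟩
  by_cases hl : P.l ≤ z₀
  · rw [indicator_of_mem (show P.l ∈ Iic z₀ from hl)]
    rw [le_antisymm hl hz₀.2, hy]
  · exact indicator_of_notMem (show P.l ∉ Iic z₀ from hl) _

/-- The competitor that is used to perturb a cut off solution. -/
lemma admissible_bump : P.Admissible (fun _ => 0) (fun z => (z + P.m) * (P.l - z))
    (fun z => P.l - P.m - 2 * z) := by
  have hc : Continuous fun z : ℝ => P.l - P.m - 2 * z := by fun_prop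
  refine ⟨MemLp.zero, memLp_layers.2 (memLp_of_continuousOn hc.continuousOn), fun z hz => ?_,
    by simp⟩
  have hd : ∀ t ∈ uIcc (-P.m) z, HasDerivAt (fun z => (z + P.m) * (P.l - z))
      (P.l - P.m - 2 * t) t := by
    intro t _
    refine (((hasDerivAt_id t).add_const P.m).mul ((hasDerivAt_id t).const_sub P.l)).congr_deriv ?_
    simp only [id]; ring
  rw [intervalIntegral.integral_eq_sub_of_hasDerivAt hd (hc.intervalIntegrable _ _)]
  ring

/-- Green's formula for a cut off solution. -/
lemma IsSol.integral_bilin_cut (hs : 0 < s) (h : P.IsSol (P.par r s) y) {z₀ : ℝ}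
    (hz₀ : z₀ ∈ Icc (-P.m) P.l) {φ' ψ' χ' : ℝ → ℝ} (hint : Integrable (P.bilin r s
      ((Iic z₀).indicator (P.phiOf r s y)) ((Iic z₀).indicator fun z => (y z).1)
      ((Iic z₀).indicator fun z => P.rhsPsi (P.par r s) (y z) z) φ' ψ' χ')
      (volume.restrict P.layers)) {f f' : ℝ → ℝ} (hf : ContinuousOn f (Icc (-P.m) P.l))
    (hf' : ∀ z ∈ P.layers, HasDerivAt f (f' z) z) (hfi : IntervalIntegrable f' volume (-P.m) P.l)
    (hf0 : f (-P.m) = 0)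
    (heq : ∀ z ∈ P.layers, z ≤ z₀ → χ' z = f' z ∧ ψ' z = f z) :
    ∫ z in P.layers, P.bilin r s
      ((Iic z₀).indicator (P.phiOf r s y)) ((Iic z₀).indicator fun z => (y z).1)
      ((Iic z₀).indicator fun z => P.rhsPsi (P.par r s) (y z) z) φ' ψ' χ' z
      = (y z₀).2 * f z₀ := by
  have hI := intervalIntegrable_iff_layers.2 hint
  have hs1 : uIcc (-P.m) z₀ ⊆ uIcc (-P.m) P.l := by
    rw [uIcc_of_le hz₀.1, uIcc_of_le P.neg_m_le_l]; exact Icc_subset_Icc le_rfl hz₀.2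
  have hs2 : uIcc z₀ P.l ⊆ uIcc (-P.m) P.l := by
    rw [uIcc_of_le hz₀.2, uIcc_of_le P.neg_m_le_l]; exact Icc_subset_Icc hz₀.1 le_rfl
  rw [← intervalIntegral_eq_layers, ← intervalIntegral.integral_add_adjacent_intervals
    (hI.mono_set hs1) (hI.mono_set hs2)]
  have h2 : ∫ z in z₀..P.l, P.bilin r s
      ((Iic z₀).indicator (P.phiOf r s y)) ((Iic z₀).indicator fun z => (y z).1)
      ((Iic z₀).indicator fun z => P.rhsPsi (P.par r s) (y z) z) φ' ψ' χ' z = 0 := by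
    rw [intervalIntegral.integral_of_le hz₀.2]
    refine setIntegral_eq_zero_of_forall_eq_zero fun t ht => ?_
    have : t ∉ Iic z₀ := not_le.2 ht.1
    simp [bilin, this]
  have hder : ∀ z ∈ P.layers, HasDerivAt (fun z => (y z).2 * f z)
      (P.rhsSigma (P.par r s) (y z) z * f z + (y z).2 * f' z) z :=
    fun z hz => (h.sigma hz).mul (hf' z hz)
  have hi' : IntervalIntegrable (fun z => P.rhsSigma (P.par r s) (y z) z * f z + (y z).2 * f' z)
      volume (-P.m) P.l := by
    have hu : uIcc (-P.m) P.l = Icc (-P.m) P.l := uIcc_of_le P.neg_m_le_l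
    exact (h.intervalIntegrable_rhsSigma.mul_continuousOn (by rwa [hu])).add
      (hfi.continuousOn_mul (by rw [hu]; exact h.continuousOn.snd))
  have h3 := integral_of_layers (f := fun z => (y z).2 * f z) (h.continuousOn.snd.mul hf) hder hi' le_rfl hz₀.1 hz₀.2
  simp only [hf0, mul_zero, sub_zero] at h3
  rw [h2, add_zero, ← h3]
  refine intervalIntegral.integral_congr_ae ?_
  have hn0 : ∀ᵐ z : ℝ, z ≠ 0 := by simp [ae_iff]
  have hnl : ∀ᵐ z : ℝ, z ≠ P.l := by simp [ae_iff]
  filter_upwards [hn0, hnl] with z hz0 hzl hz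
  rw [uIoc_of_le hz₀.1] at hz
  have hzL : z ∈ P.layers :=
    mem_layers_of_mem_Ioo ⟨hz.1, lt_of_le_of_ne (hz.2.trans hz₀.2) hzl⟩ hz0
  have hmem : z ∈ Iic z₀ := hz.2
  have h4 := bilin_phiOf (r := r) (y := y) hs φ' ψ' χ' hzL
  simp only [bilin, indicator_of_mem hmem] at h4 ⊢
  rw [h4, (heq z hzL hz.2).1, (heq z hzL hz.2).2]
  ring

/-- At the extremal `s` a solution vanishing at the lower wall has no interior zero. -/
lemma IsSol.no_interior_zero (hs : 0 < s) (hlow : -s ∈ lowerBounds (P.energyValues r))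
    (h : P.IsSol (P.par r s) y) (h0 : (y (-P.m)).1 = 0) (hne : ∀ z ∈ Icc (-P.m) P.l, y z ≠ 0)
    {z₀ : ℝ} (hz₀ : z₀ ∈ Ioo (-P.m) P.l) : (y z₀).1 ≠ 0 := by
  intro hy
  have hz₁ : z₀ ∈ Icc (-P.m) P.l := Ioo_subset_Icc_self hz₀
  have hA := h.admissible_cut h0 hz₁ hy
  have hB := admissible_bump (P := P)
  set φ₁ := (Iic z₀).indicator (P.phiOf r s y)
  set ψ₁ := (Iic z₀).indicator fun z => (y z).1
  set χ₁ := (Iic z₀).indicator fun z => P.rhsPsi (P.par r s) (y z) z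
  have iAB := Config.integrable_bilin (r := r) (s := s) hA.memLp_phi hA.memLp_psi hA.memLp_chi
    hB.memLp_phi hB.memLp_psi hB.memLp_chi
  have iAA := hA.integrable_bilin (r := r) (s := s)
  have iBB := hB.integrable_bilin (r := r) (s := s)
  -- Green's formula leaves only the boundary term at z₀. It vanishes for the cut off solution
  -- itself, but against the bump (`hAB`) it is a positive multiple of σ(z₀). Minimality forces this
  -- first variation to vanish, so y(z₀) = 0, which is excluded.
  have hAA : ∫ z in P.layers, P.bilin r s φ₁ ψ₁ χ₁ φ₁ ψ₁ χ₁ z = (y z₀).2 * (y z₀).1 := by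
    refine h.integral_bilin_cut hs hz₁ iAA (f := fun z => (y z).1)
      (f' := fun z => P.rhsPsi (P.par r s) (y z) z) h.continuousOn.fst (fun z hz => h.psi hz)
      h.intervalIntegrable_rhsPsi h0 fun z _ hz => ?_
    exact ⟨indicator_of_mem (show z ∈ Iic z₀ from hz) _,
      indicator_of_mem (show z ∈ Iic z₀ from hz) _⟩
  have hAB : ∫ z in P.layers, P.bilin r s φ₁ ψ₁ χ₁ (fun _ => 0) (fun z => (z + P.m) * (P.l - z))
      (fun z => P.l - P.m - 2 * z) z = (y z₀).2 * ((z₀ + P.m) * (P.l - z₀)) := by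
    refine h.integral_bilin_cut hs hz₁ iAB (f := fun z => (z + P.m) * (P.l - z))
      (f' := fun z => P.l - P.m - 2 * z) (by fun_prop) (fun z _ => ?_)
      ((by fun_prop : Continuous _).intervalIntegrable _ _) (by simp) fun z _ hz => ⟨rfl, rfl⟩
    refine (((hasDerivAt_id z).add_const P.m).mul ((hasDerivAt_id z).const_sub P.l)).congr_deriv ?_
    simp only [id]; ring
  rw [hy, mul_zero] at hAA
  set β := ∫ z in P.layers, P.bilin r s (fun _ => 0) (fun z => (z + P.m) * (P.l - z))
      (fun z => P.l - P.m - 2 * z) (fun _ => 0) (fun z => (z + P.m) * (P.l - z))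
      (fun z => P.l - P.m - 2 * z) z
  have hzero := eq_zero_of_quadratic_nonneg (a := (y z₀).2 * ((z₀ + P.m) * (P.l - z₀))) (b := β)
    fun ε => by
      have hV := hA.add_smul hB ε
      have h1 := hV.nonneg_of_lowerBound hlow
      have h2 := hV.two_mul_energy_add (r := r) (s := s)
      have h3 : ∫ z in P.layers, P.bilin r s (fun z => φ₁ z + ε * 0)
          (fun z => ψ₁ z + ε * ((z + P.m) * (P.l - z))) (fun z => χ₁ z + ε * (P.l - P.m - 2 * z))
          (fun z => φ₁ z + ε * 0)
          (fun z => ψ₁ z + ε * ((z + P.m) * (P.l - z)))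
          (fun z => χ₁ z + ε * (P.l - P.m - 2 * z)) z
          = 2 * ε * ((y z₀).2 * ((z₀ + P.m) * (P.l - z₀))) + ε ^ 2 * β := by
        have h4 := integral_add (iAA.add (iAB.const_mul (2 * ε))) (iBB.const_mul (ε ^ 2))
        have h5 := integral_add iAA (iAB.const_mul (2 * ε))
        rw [integral_const_mul] at h4 h5
        rw [hAA, hAB, zero_add] at h5
        simp only [Pi.add_apply] at h4
        rw [h5] at h4
        rw [← h4]
        refine integral_congr_ae (Eventually.of_forall fun z => ?_)
        simp only [bilin]
        ring
      rw [← h3, ← h2]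
      linarith
  have hpos : 0 < (z₀ + P.m) * (P.l - z₀) :=
    mul_pos (by linarith [hz₀.1]) (by linarith [hz₀.2])
  have h2 : (y z₀).2 = 0 := by
    rcases mul_eq_zero.1 hzero with h | h
    · exact h
    · exact absurd h hpos.ne'
  exact hne z₀ hz₁ (Prod.ext hy h2)

/-- At the extremal `s` the solution starting at the lower wall reaches the upper wall. -/
theorem sol_at_upper_wall (hs : 0 < s) (hglb : IsGLB (P.energyValues r) (-s)) :
    (P.sol (0, 1) (P.par r s) P.l).1 = 0 := by
  by_contra hl
  have hml := P.neg_m_le_l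
  have hml' : -P.m < P.l := by linarith [P.m_pos, P.l_pos]
  set y := P.sol (0, 1) (P.par r s)
  have hsol : P.IsSol (P.par r s) y := isSol_sol _ _
  have hy0 : y (-P.m) = (0, 1) := sol_left
  have hne : ∀ z ∈ Ioc (-P.m) P.l, (y z).1 ≠ 0 := by
    intro z hz
    rcases hz.2.eq_or_lt with h | h
    · rwa [h]
    · exact hsol.no_interior_zero hs hglb.1 (by rw [hy0])
        (fun z hz => sol_ne_zero (by simp) hz) ⟨hz.1, h⟩
  -- Without zeros above the lower wall ψ has one sign there, and c = ±1 makes it positive. It still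
  -- vanishes at the lower wall itself.
  obtain ⟨c, hc⟩ : ∃ c : ℝ, ∀ z ∈ Ioc (-P.m) P.l, 0 < c * (y z).1 := by
    have hcont : ContinuousOn (fun z => (y z).1) (Ioc (-P.m) P.l) :=
      hsol.continuousOn.fst.mono Ioc_subset_Icc_self
    have hpre : IsPreconnected (Ioc (-P.m) P.l) := isPreconnected_Ioc
    rcases lt_or_gt_of_ne hl with h | h
    · refine ⟨-1, fun z hz => ?_⟩
      by_contra hcon
      have hz' : 0 ≤ (y z).1 := by linarith
      obtain ⟨w, hw, hw'⟩ := hpre.intermediate_value ⟨hml', le_rfl⟩ hz hcont ⟨h.le, hz'⟩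
      exact hne w hw hw'
    · refine ⟨1, fun z hz => ?_⟩
      by_contra hcon
      have hz' : (y z).1 ≤ 0 := by linarith
      obtain ⟨w, hw, hw'⟩ := hpre.intermediate_value hz ⟨hml', le_rfl⟩ hcont ⟨hz', h.le⟩
      exact hne w hw hw'
  -- a solution that is positive up to both walls
  obtain ⟨ε, hε⟩ : ∃ ε : ℝ, ∀ z ∈ Icc (-P.m) P.l,
      0 < c * (y z).1 + ε * (P.sol (1, 0) (P.par r s) z).1 := by
    set w := fun z => (P.sol (1, 0) (P.par r s) z).1
    have hw : ContinuousOn w (Icc (-P.m) P.l) := (isSol_sol (1, 0) (P.par r s)).continuousOn.fst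
    have hw0 : w (-P.m) = 1 := by simp only [w]; rw [sol_left]
    have h1 : ∀ᶠ z in 𝓝[Icc (-P.m) P.l] (-P.m), 0 < w z :=
      (hw (-P.m) ⟨le_rfl, hml⟩).eventually (lt_mem_nhds (by rw [hw0]; norm_num))
    obtain ⟨U, hU, hU0, hUw⟩ := mem_nhdsWithin.1 h1
    have hK : IsCompact (Icc (-P.m) P.l \ U) := isCompact_Icc.diff hU
    have hKsub : Icc (-P.m) P.l \ U ⊆ Ioc (-P.m) P.l := by
      rintro z ⟨hz, hzU⟩
      refine ⟨lt_of_le_of_ne hz.1 ?_, hz.2⟩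
      rintro rfl
      exact hzU hU0
    obtain ⟨B, hB⟩ := isCompact_Icc.exists_bound_of_continuousOn hw
    have hfin : ∀ z ∈ Icc (-P.m) P.l, ∀ ε, 0 < ε → z ∈ U → 0 < c * (y z).1 + ε * w z := by
      intro z hz ε hε hzU
      have h2 : 0 < w z := hUw ⟨hzU, hz⟩
      rcases hz.1.eq_or_lt with h | h
      · rw [← h, hy0, hw0]; simpa using hε
      · have := hc z ⟨h, hz.2⟩
        positivity
    rcases (Icc (-P.m) P.l \ U).eq_empty_or_nonempty with he | hn
    · refine ⟨1, fun z hz => hfin z hz 1 one_pos ?_⟩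
      by_contra hcon
      exact (eq_empty_iff_forall_notMem.1 he) z ⟨hz, hcon⟩
    · obtain ⟨a, ha, hmin⟩ := hK.exists_isMinOn hn
        (f := fun z => c * (y z).1) (continuousOn_const.mul
          (hsol.continuousOn.fst.mono sdiff_subset))
      have hκ : 0 < c * (y a).1 := hc a (hKsub ha)
      have hB0 : 0 < |B| + 1 := by positivity
      -- Near the lower wall the second solution w is positive because w(-m) = 1. Away from it, ε|w|
      -- stays below the minimum c·ψ(a) of the first solution.
      refine ⟨c * (y a).1 / (|B| + 1), fun z hz => ?_⟩
      by_cases hzU : z ∈ U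
      · exact hfin z hz _ (by positivity) hzU
      · have h3 : c * (y a).1 ≤ c * (y z).1 := hmin ⟨hz, hzU⟩
        have h4 : -(|B|) ≤ w z := by
          have := hB z hz
          rw [Real.norm_eq_abs] at this
          linarith [neg_abs_le (w z), le_abs_self B]
        have h5 : c * (y a).1 / (|B| + 1) * -(|B|) ≤ c * (y a).1 / (|B| + 1) * w z := by gcongr
        have h6 : c * (y a).1 / (|B| + 1) * -(|B|) = -(c * (y a).1) + c * (y a).1 / (|B| + 1) := by
          field_simp; ring
        have h7 : 0 < c * (y a).1 / (|B| + 1) := by positivity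
        change 0 < c * (y z).1 + c * (y a).1 / (|B| + 1) * w z
        linarith
  -- Strict positivity on a compact interval survives a small change of the parameters; `projIcc`
  -- only serves to extend the solutions continuously to all z for the tube lemma.
  have hev : ∀ᶠ x in 𝓝 (P.par r s), ∀ z ∈ Icc (-P.m) P.l,
      0 < c * (P.sol (0, 1) x z).1 + ε * (P.sol (1, 0) x z).1 := by
    have hcont : ∀ y₀ : ℝ × ℝ, Continuous fun p : (ℝ × ℝ) × ℝ =>
        P.sol y₀ p.1 (projIcc (-P.m) P.l hml p.2) := fun y₀ =>
      continuousOn_sol.comp_continuous (g := fun p => P.sol y₀ p.1 p.2)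
        (f := fun p : (ℝ × ℝ) × ℝ => (p.1, (projIcc (-P.m) P.l hml p.2 : ℝ)))
        (continuous_fst.prodMk (continuous_subtype_val.comp
          (continuous_projIcc.comp continuous_snd)))
        fun p => ⟨mem_univ _, (projIcc (-P.m) P.l hml p.2).2⟩
    have : ∀ᶠ x in 𝓝 (P.par r s), ∀ z ∈ Icc (-P.m) P.l,
        0 < c * (P.sol (0, 1) x (projIcc (-P.m) P.l hml z)).1
          + ε * (P.sol (1, 0) x (projIcc (-P.m) P.l hml z)).1 := by
      refine isCompact_Icc.eventually_forall_of_forall_eventually fun z hz => ?_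
      refine ContinuousAt.eventually_lt (f := fun _ : (ℝ × ℝ) × ℝ => (0 : ℝ)) continuousAt_const
        (g := fun p : (ℝ × ℝ) × ℝ => c * (P.sol (0, 1) p.1 (projIcc (-P.m) P.l hml p.2)).1
          + ε * (P.sol (1, 0) p.1 (projIcc (-P.m) P.l hml p.2)).1)
        (((hcont _).fst.const_mul c).add ((hcont _).fst.const_mul ε)).continuousAt ?_
      simp only [projIcc_of_mem hml hz]
      exact hε z hz
    filter_upwards [this] with x hx z hz
    have := hx z hz
    rwa [projIcc_of_mem hml hz] at this
  have hpar : ContinuousAt (P.par r) s := by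
    refine continuousAt_id.prodMk (continuousAt_const.div (continuousAt_id.add continuousAt_const) ?_)
    exact (den_pos hs).ne'
  have hev' := (hpar.eventually hev).and (lt_mem_nhds hs)
  -- Some s' < s still admits a positive solution, so -s' > -s is a lower bound of the energy
  -- values, contradicting that -s is the greatest one.
  obtain ⟨s', ⟨h1, h2⟩, h3⟩ :=
    ((hev'.filter_mono nhdsWithin_le_nhds).and (self_mem_nhdsWithin (s := Iio s))).exists
  have h4 : P.IsSol (P.par r s') fun z => c • P.sol (0, 1) (P.par r s') z
      + ε • P.sol (1, 0) (P.par r s') z := ((isSol_sol _ _).smul c).add ((isSol_sol _ _).smul ε)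
  have h5 : -s' ∈ lowerBounds (P.energyValues r) := lowerBound_of_nonneg fun φ ψ χ ha =>
    h4.energy_nonneg h2 (fun z hz => by simpa using h1 z hz) ha
  have h6 := hglb.2 h5
  have h7 : s' < s := h3
  linarith

end Config

/-! ### Rotations of the plane and construction of a family of normal modes. -/

lemma vec_zero (a b : ℝ) : vec a b 0 = a := rfl

lemma vec_one (a b : ℝ) : vec a b 1 = b := rfl

lemma norm_sq_plane (ξ : Plane) : ‖ξ‖ ^ 2 = ξ 0 ^ 2 + ξ 1 ^ 2 := by
  rw [EuclideanSpace.norm_sq_eq, Fin.sum_univ_two, Real.norm_eq_abs, Real.norm_eq_abs, sq_abs,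
    sq_abs]

lemma norm_vec_zero {r : ℝ} (hr : 0 ≤ r) : ‖vec r 0‖ = r := by
  have h : ‖vec r 0‖ ^ 2 = r ^ 2 := by rw [norm_sq_plane, vec_zero, vec_one]; ring
  exact (sq_eq_sq₀ (norm_nonneg _) hr).1 h

lemma rot_zero (α : ℝ) (ξ : Plane) : rot α ξ 0 = Real.cos α * ξ 0 - Real.sin α * ξ 1 := rfl

lemma rot_one (α : ℝ) (ξ : Plane) : rot α ξ 1 = Real.sin α * ξ 0 + Real.cos α * ξ 1 := rfl

lemma norm_rot (α : ℝ) (ξ : Plane) : ‖rot α ξ‖ = ‖ξ‖ := by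
  have h : ‖rot α ξ‖ ^ 2 = ‖ξ‖ ^ 2 := by
    rw [norm_sq_plane, norm_sq_plane, rot_zero, rot_one]
    linear_combination (ξ 0 ^ 2 + ξ 1 ^ 2) * Real.sin_sq_add_cos_sq α
  exact (sq_eq_sq₀ (norm_nonneg _) (norm_nonneg _)).1 h

namespace Config

variable {P : Config}

variable {x : ℝ × ℝ} {y : ℝ → ℝ × ℝ} {r s : ℝ}

lemma contDiffOn_rhs {f g : ℝ → ℝ} {n : WithTop ℕ∞} (hn : n ≤ ((⊤ : ℕ∞) : WithTop ℕ∞)) (x : ℝ × ℝ)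
    (hf : ContDiffOn ℝ n f P.layers) (hg : ContDiffOn ℝ n g P.layers) :
    ContDiffOn ℝ n (fun z => P.rhsPsi x (f z, g z) z) P.layers ∧
      ContDiffOn ℝ n (fun z => P.rhsSigma x (f z, g z) z) P.layers := by
  have hρ := (contDiffOn_rho (P := P)).of_le hn
  have hd := (contDiffOn_dp (P := P)).of_le hn
  constructor
  · exact (contDiffOn_const.mul hf).add (((hd.mul hρ).inv
      (fun z hz => (mul_pos (dp_pos hz) (rho_pos hz)).ne')).add
      (contDiffOn_const.div hρ fun z hz => (rho_pos hz).ne') |>.mul hg)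
  · exact ((contDiffOn_const.mul hρ).mul hf).add (contDiffOn_const.mul hg)

/-- Solutions of the first order system are smooth in the layers. -/
lemma contDiffOn_of_system {f g : ℝ → ℝ} {x : ℝ × ℝ}
    (hf : ∀ z ∈ P.layers, HasDerivAt f (P.rhsPsi x (f z, g z) z) z)
    (hg : ∀ z ∈ P.layers, HasDerivAt g (P.rhsSigma x (f z, g z) z) z) :
    ContDiffOn ℝ ∞ f P.layers ∧ ContDiffOn ℝ ∞ g P.layers := by
  have key : ∀ n : ℕ, ContDiffOn ℝ n f P.layers ∧ ContDiffOn ℝ n g P.layers := by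
    intro n
    induction n with
    | zero =>
      simp only [Nat.cast_zero, contDiffOn_zero]
      exact ⟨fun z hz => (hf z hz).continuousAt.continuousWithinAt,
        fun z hz => (hg z hz).continuousAt.continuousWithinAt⟩
    | succ n ih =>
      obtain ⟨h1, h2⟩ := contDiffOn_rhs (P := P)
        (n := (n : WithTop ℕ∞)) (by exact_mod_cast le_top) x ih.1 ih.2
      push_cast
      rw [contDiffOn_succ_iff_deriv_of_isOpen P.isOpen_layers,
        contDiffOn_succ_iff_deriv_of_isOpen P.isOpen_layers]
      refine ⟨⟨fun z hz => (hf z hz).differentiableAt.differentiableWithinAt, by simp,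
        h1.congr fun z hz => (hf z hz).deriv⟩,
        fun z hz => (hg z hz).differentiableAt.differentiableWithinAt, by simp,
        h2.congr fun z hz => (hg z hz).deriv⟩
  exact ⟨contDiffOn_infty.2 fun n => (key n).1, contDiffOn_infty.2 fun n => (key n).2⟩

/-- The tent estimate with s = 0 says that 0 is not a lower bound. This shows at once that the set
of energies is nonempty and that its infimum is not positive; the estimate then applies with s =
-inf E. -/
lemma exists_isGLB (P : Config) : ∃ c > 0, ∃ r₀ > 0, ∀ r ≥ r₀,
    IsGLB (P.energyValues r) (sInf (P.energyValues r)) ∧ c * r ≤ -sInf (P.energyValues r) := by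
  obtain ⟨c, hc, r₀, hr₀, h⟩ := P.exists_growth_lowerBound
  refine ⟨c, hc, r₀, hr₀, fun r hr => ?_⟩
  have hr0 : 0 < r := hr₀.trans_le hr
  have hcr : 0 < c * r := by positivity
  have hne : (P.energyValues r).Nonempty := by
    by_contra hcon
    rw [not_nonempty_iff_eq_empty] at hcon
    have := h r hr 0 le_rfl (by rw [hcon]; simp)
    linarith
  have hglb : IsGLB (P.energyValues r) (sInf (P.energyValues r)) :=
    isGLB_csInf hne ⟨_, neg_mem_lowerBounds hr0.le⟩
  refine ⟨hglb, h r hr _ ?_ (by simpa using hglb.1)⟩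
  by_contra hcon
  have h0 : -(0 : ℝ) ∈ lowerBounds (P.energyValues r) := fun e he => by
    have := hglb.1 he
    linarith
  have := h r hr 0 le_rfl h0
  linarith

/-- The growth rate given by the variational principle, cut off at `R₀`. -/
def rate (P : Config) (R₀ r : ℝ) : ℝ := if R₀ < r then √(-sInf (P.energyValues r)) else 0

/-- The profile `(ψ, σ)` before normalization. -/
def rawSol (P : Config) (lam r : ℝ) : ℝ → ℝ × ℝ := P.sol (0, 1) (P.par r (lam ^ 2))

/-- The normalization constant. -/
def mass (P : Config) (lam r : ℝ) : ℝ :=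
  √(P.J (P.phiOf r (lam ^ 2) (P.rawSol lam r)) fun z => (P.rawSol lam r z).1)

/-- The normalized vertical profile at the frequency `(r, 0)`. -/
def profPsi (P : Config) (lam r z : ℝ) : ℝ := (P.mass lam r)⁻¹ * (P.rawSol lam r z).1

/-- The normalized flux. -/
def profSigma (P : Config) (lam r z : ℝ) : ℝ := (P.mass lam r)⁻¹ * (P.rawSol lam r z).2

/-- The normalized profile `φ` at the frequency `(r, 0)`. -/
def profPhi (P : Config) (lam r z : ℝ) : ℝ :=
  (P.mass lam r)⁻¹ * P.phiOf r (lam ^ 2) (P.rawSol lam r) z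

/-- The normalized profile `θ` at the frequency `(r, 0)`. -/
def profTheta (P : Config) (lam r z : ℝ) : ℝ := -(2 * P.om / lam) * P.profPhi lam r z

/-- The family of normal modes given by the variational growth rate. -/
def modeFamily (P : Config) (R₀ : ℝ) : ModeFamily where
  lam := P.rate R₀
  φ ξ z := if R₀ < ‖ξ‖ then ξ 0 / ‖ξ‖ * P.profPhi (P.rate R₀ ‖ξ‖) ‖ξ‖ z
    - ξ 1 / ‖ξ‖ * P.profTheta (P.rate R₀ ‖ξ‖) ‖ξ‖ z else 0
  θ ξ z := if R₀ < ‖ξ‖ then ξ 1 / ‖ξ‖ * P.profPhi (P.rate R₀ ‖ξ‖) ‖ξ‖ z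
    + ξ 0 / ‖ξ‖ * P.profTheta (P.rate R₀ ‖ξ‖) ‖ξ‖ z else 0
  ψ ξ z := if R₀ < ‖ξ‖ then P.profPsi (P.rate R₀ ‖ξ‖) ‖ξ‖ z else 0

lemma layers_volume_ne_zero (P : Config) : volume P.layers ≠ 0 :=
  (P.isOpen_layers.measure_pos volume ⟨P.l / 2, mem_layers_upper (by linarith [P.l_pos])
    (by linarith [P.l_pos])⟩).ne'

/-- If φ and ψ vanish almost everywhere, then so does the flux, since φ is a nonzero multiple of gψ
- σ/ρ; but y has no zero. -/
lemma IsSol.J_pos (h : P.IsSol x y) (hs : 0 < s) (hr : r ≠ 0)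
    (hne : ∀ z ∈ Icc (-P.m) P.l, y z ≠ 0) :
    0 < P.J (P.phiOf r s y) fun z => (y z).1 := by
  refine (P.J_nonneg _ _).lt_of_ne fun h0 => ?_
  have h1 : ∫ z in P.layers, P.ρ z * (P.phiOf r s y z ^ 2 + (y z).1 ^ 2) = 0 := by
    rw [← two_mul_J, ← h0, mul_zero]
  obtain ⟨C, hC⟩ := h.exists_bound_phiOf (r := r) (s := s)
  have i1 : MemLp (P.phiOf r s y) 2 (volume.restrict P.layers) :=
    MemLp.of_bound (h.continuousOn_phiOf.aestronglyMeasurable P.measurableSet_layers) C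
      ((ae_restrict_iff' P.measurableSet_layers).2 (Eventually.of_forall fun z hz => hC z hz))
  have i2 : MemLp (fun z => (y z).1) 2 (volume.restrict P.layers) :=
    memLp_of_continuousOn h.continuousOn.fst
  rw [setIntegral_eq_zero_iff_of_nonneg_ae
      ((ae_restrict_iff' P.measurableSet_layers).2 (Eventually.of_forall fun z hz =>
        mul_nonneg (rho_pos hz).le (by positivity))) (integrable_J i1 i2)] at h1
  have hfalse : ∀ᵐ z ∂volume.restrict P.layers, False := by
    filter_upwards [h1, (ae_restrict_iff' P.measurableSet_layers).2
        (Eventually.of_forall fun z hz => hz)] with z hz hz'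
    have h3 := rho_pos hz'
    have h4 : P.phiOf r s y z ^ 2 + (y z).1 ^ 2 = 0 := by simpa [h3.ne'] using hz
    have h5 : P.phiOf r s y z = 0 := by nlinarith [sq_nonneg (P.phiOf r s y z), sq_nonneg (y z).1]
    have h6 : (y z).1 = 0 := by nlinarith [sq_nonneg (P.phiOf r s y z), sq_nonneg (y z).1]
    refine hne z (P.layers_subset_Icc hz') (Prod.ext h6 ?_)
    have hD := den_pos (P := P) hs
    rw [phiOf, h6, mul_zero, zero_sub] at h5
    simpa [hD.ne', hr, h3.ne'] using h5
  have hmz : volume.restrict P.layers = 0 := by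
    rw [← ae_eq_bot, ← eventually_false_iff_eq_bot]
    exact hfalse
  rw [Measure.restrict_eq_zero] at hmz
  exact P.layers_volume_ne_zero hmz

lemma mass_pos {lam : ℝ} (hl : 0 < lam) (hr : r ≠ 0) : 0 < P.mass lam r :=
  Real.sqrt_pos.2 <| (isSol_sol _ _).J_pos (by positivity) hr fun _ hz => sol_ne_zero (by simp) hz

lemma J_prof {lam : ℝ} (hl : 0 < lam) (hr : r ≠ 0) :
    P.J (P.profPhi lam r) (P.profPsi lam r) = 1 := by
  have h := mass_pos (P := P) hl hr
  have h1 : P.J (P.profPhi lam r) (P.profPsi lam r) = _ := J_smul (P := P) (P.mass lam r)⁻¹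
  rw [h1, mass] at *
  have h2 := Real.sqrt_pos.1 h
  rw [inv_pow, Real.sq_sqrt h2.le, inv_mul_cancel₀ h2.ne']

lemma hasDerivAt_profPsi {lam z : ℝ} (hz : z ∈ P.layers) :
    HasDerivAt (P.profPsi lam r)
      (P.rhsPsi (P.par r (lam ^ 2)) (P.profPsi lam r z, P.profSigma lam r z) z) z := by
  refine (((isSol_sol _ _).psi hz).const_mul (P.mass lam r)⁻¹).congr_deriv ?_
  simp only [rhsPsi, profPsi, profSigma, rawSol]; ring

lemma hasDerivAt_profSigma {lam z : ℝ} (hz : z ∈ P.layers) :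
    HasDerivAt (P.profSigma lam r)
      (P.rhsSigma (P.par r (lam ^ 2)) (P.profPsi lam r z, P.profSigma lam r z) z) z := by
  refine (((isSol_sol _ _).sigma hz).const_mul (P.mass lam r)⁻¹).congr_deriv ?_
  simp only [rhsSigma, profPsi, profSigma, rawSol]; ring

lemma profPhi_eq (lam r z : ℝ) : P.profPhi lam r z = r / (lam ^ 2 + 4 * P.om ^ 2) *
    (P.g * P.profPsi lam r z - P.profSigma lam r z / P.ρ z) := by
  simp only [profPhi, phiOf, profPsi, profSigma]; ring

lemma continuousOn_profPsi (lam r : ℝ) : ContinuousOn (P.profPsi lam r) (Icc (-P.m) P.l) :=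
  continuousOn_const.mul (isSol_sol (P := P) _ _).continuousOn.fst

lemma continuousOn_profSigma (lam r : ℝ) : ContinuousOn (P.profSigma lam r) (Icc (-P.m) P.l) :=
  continuousOn_const.mul (isSol_sol (P := P) _ _).continuousOn.snd

lemma noJump_of_continuousOn {u : ℝ → ℝ} (h : ContinuousOn u (Icc (-P.m) P.l)) : NoJump u := by
  have h0 : ContinuousAt u 0 := h.continuousAt (Icc_mem_nhds (by linarith [P.m_pos]) P.l_pos)
  exact ⟨u 0, h0.tendsto.mono_left nhdsWithin_le_nhds, h0.tendsto.mono_left nhdsWithin_le_nhds⟩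

lemma layers_mem_nhdsGT_zero (P : Config) : P.layers ∈ 𝓝[>] (0 : ℝ) :=
  mem_of_superset (Ioo_mem_nhdsGT P.l_pos) subset_union_right

lemma layers_mem_nhdsLT_zero (P : Config) : P.layers ∈ 𝓝[<] (0 : ℝ) :=
  mem_of_superset (Ioo_mem_nhdsLT (neg_lt_zero.2 P.m_pos)) subset_union_left

lemma layers_mem_nhdsGT_wall (P : Config) : P.layers ∈ 𝓝[>] (-P.m) :=
  mem_of_superset (Ioo_mem_nhdsGT (neg_lt_zero.2 P.m_pos)) subset_union_left

lemma layers_mem_nhdsLT_wall (P : Config) : P.layers ∈ 𝓝[<] P.l :=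
  mem_of_superset (Ioo_mem_nhdsLT P.l_pos) subset_union_right

lemma _root_.RTI.NoJump.congr {u v : ℝ → ℝ} (h : NoJump u) (huv : EqOn v u P.layers) :
    NoJump v := by
  obtain ⟨a, h1, h2⟩ := h
  exact ⟨a, h1.congr' (by filter_upwards [P.layers_mem_nhdsGT_zero] with z hz using (huv hz).symm),
    h2.congr' (by filter_upwards [P.layers_mem_nhdsLT_zero] with z hz using (huv hz).symm)⟩

/-- The modes of the family solve the system of ordinary differential equations. -/
lemma isNormalMode_modeFamily {R₀ : ℝ} (hR : 0 < R₀)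
    (hpos : ∀ r > R₀, 0 < P.rate R₀ r)
    (hglb : ∀ r > R₀, IsGLB (P.energyValues r) (-(P.rate R₀ r) ^ 2)) (ξ : Plane)
    (hξ : R₀ < ‖ξ‖) :
    P.IsNormalMode ξ (P.rate R₀ ‖ξ‖) ((P.modeFamily R₀).φ ξ) ((P.modeFamily R₀).θ ξ)
      ((P.modeFamily R₀).ψ ξ) := by
  set r := ‖ξ‖
  set lam := P.rate R₀ r
  have hl : 0 < lam := hpos r hξ
  have hr : 0 < r := hR.trans hξ
  have hr2 : r ^ 2 = ξ 0 ^ 2 + ξ 1 ^ 2 := norm_sq_plane ξ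
  have hD : 0 < lam ^ 2 + 4 * P.om ^ 2 := by positivity
  have eφ : (P.modeFamily R₀).φ ξ = fun z => ξ 0 / r * P.profPhi lam r z
    - ξ 1 / r * P.profTheta lam r z := funext fun z => if_pos hξ
  have eθ : (P.modeFamily R₀).θ ξ = fun z => ξ 1 / r * P.profPhi lam r z
    + ξ 0 / r * P.profTheta lam r z := funext fun z => if_pos hξ
  have eψ : (P.modeFamily R₀).ψ ξ = P.profPsi lam r := funext fun z => if_pos hξ
  rw [eφ, eθ, eψ]
  obtain ⟨sψ, sσ⟩ := contDiffOn_of_system (P := P) (x := P.par r (lam ^ 2))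
    (f := P.profPsi lam r) (g := P.profSigma lam r)
    (fun z hz => hasDerivAt_profPsi hz) (fun z hz => hasDerivAt_profSigma hz)
  have sΦ : ContDiffOn ℝ ∞ (P.profPhi lam r) P.layers := by
    refine ContDiffOn.congr ?_ (fun z _ => profPhi_eq lam r z)
    exact contDiffOn_const.mul ((contDiffOn_const.mul sψ).sub
      (sσ.div contDiffOn_rho fun z hz => (rho_pos hz).ne'))
  have sΘ : ContDiffOn ℝ ∞ (P.profTheta lam r) P.layers := contDiffOn_const.mul sΦ
  have hflux : EqOn (P.flux ξ (fun z => ξ 0 / r * P.profPhi lam r z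
      - ξ 1 / r * P.profTheta lam r z) (fun z => ξ 1 / r * P.profPhi lam r z
      + ξ 0 / r * P.profTheta lam r z) (P.profPsi lam r)) (P.profSigma lam r) P.layers := by
    intro z hz
    have h1 := dp_pos hz
    have h2 := rho_pos hz
    have h3 : ξ 0 * (ξ 0 / r * P.profPhi lam r z - ξ 1 / r * P.profTheta lam r z)
        + ξ 1 * (ξ 1 / r * P.profPhi lam r z + ξ 0 / r * P.profTheta lam r z)
        = r * P.profPhi lam r z := by
      field_simp
      rw [hr2]; ring
    rw [flux, h3, (hasDerivAt_profPsi hz).deriv, profPhi_eq]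
    simp only [rhsPsi, par]
    field_simp
    ring
  -- Once θ = -(2ω/λ)φ is inserted at (r, 0), the two horizontal equations at ξ are the multiples of
  -- this identity by ξ₁ and ξ₂.
  have hPhi : ∀ z ∈ P.layers, (lam ^ 2 + 4 * P.om ^ 2) * P.ρ z * P.profPhi lam r z
      = r * (P.g * P.ρ z * P.profPsi lam r z - P.profSigma lam r z) := by
    intro z hz
    have h2 := rho_pos hz
    rw [profPhi_eq]
    field_simp
  refine ⟨(contDiffOn_const.mul sΦ).sub (contDiffOn_const.mul sΘ),
    (contDiffOn_const.mul sΦ).add (contDiffOn_const.mul sΘ), sψ, ?_, ?_, ?_,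
    noJump_of_continuousOn (continuousOn_profPsi _ _),
    (noJump_of_continuousOn (continuousOn_profSigma _ _)).congr hflux, ?_⟩
  · intro z hz
    rw [hflux hz]
    have h := hPhi z hz
    simp only [profTheta]
    field_simp
    linear_combination ξ 0 * h
  · intro z hz
    rw [hflux hz]
    have h := hPhi z hz
    simp only [profTheta]
    field_simp
    linear_combination ξ 1 * h
  · intro z hz
    have h2 := rho_pos hz
    have hd := ((hasDerivAt_profSigma (r := r) (lam := lam) hz).congr_of_eventuallyEq
      (hflux.eventuallyEq_of_mem (P.isOpen_layers.mem_nhds hz))).deriv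
    rw [hd]
    have h3 : ξ 0 * (ξ 0 / r * P.profPhi lam r z - ξ 1 / r * P.profTheta lam r z)
        + ξ 1 * (ξ 1 / r * P.profPhi lam r z + ξ 0 / r * P.profTheta lam r z)
        = r * P.profPhi lam r z := by
      field_simp
      rw [hr2]; ring
    rw [h3, profPhi_eq]
    simp only [rhsSigma, par]
    field_simp
    ring
  · have h0 : P.profPsi lam r (-P.m) = 0 := by
      simp only [profPsi, rawSol]; rw [sol_left]; simp
    -- The one condition not built into the initial value problem. Only here does it matter that -λ²
    -- is the infimum of the energy.
    have h1 : P.profPsi lam r P.l = 0 := by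
      simp only [profPsi, rawSol]
      rw [sol_at_upper_wall (by positivity) (hglb r hξ), mul_zero]
    have hc := continuousOn_profPsi (P := P) lam r
    constructor
    · rw [← h0]
      refine (hc (-P.m) ⟨le_rfl, P.neg_m_le_l⟩).tendsto.mono_left ?_
      exact nhdsWithin_le_of_mem (mem_of_superset P.layers_mem_nhdsGT_wall P.layers_subset_Icc)
    · rw [← h1]
      refine (hc P.l ⟨P.neg_m_le_l, le_rfl⟩).tendsto.mono_left ?_
      exact nhdsWithin_le_of_mem (mem_of_superset P.layers_mem_nhdsLT_wall P.layers_subset_Icc)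

/-- The normalization is an integral in z of a function continuous on parameters × layers, hence
measurable in the parameters. The first parameter of F carries the prefactor r/(λ² + 4ω²) of φ, the
other two the arguments of the solution. -/
lemma measurable_mass {α : Type*} [MeasurableSpace α] {lam r : α → ℝ} (hl : Measurable lam)
    (hr : Measurable r) : Measurable fun a => P.mass (lam a) (r a) := by
  let F : (ℝ × (ℝ × ℝ)) × ℝ → ℝ := fun q => P.ρ q.2 *
    ((q.1.1 * (P.g * (P.sol (0, 1) q.1.2 q.2).1 - (P.sol (0, 1) q.1.2 q.2).2 / P.ρ q.2)) ^ 2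
      + (P.sol (0, 1) q.1.2 q.2).1 ^ 2)
  have hS : MeasurableSet ((univ : Set (ℝ × (ℝ × ℝ))) ×ˢ P.layers) :=
    MeasurableSet.univ.prod P.measurableSet_layers
  have hsol : ContinuousOn (fun q : (ℝ × (ℝ × ℝ)) × ℝ => P.sol (0, 1) q.1.2 q.2)
      (univ ×ˢ P.layers) :=
    continuousOn_sol.comp (f := fun q : (ℝ × (ℝ × ℝ)) × ℝ => (q.1.2, q.2)) (by fun_prop)
      fun q hq => ⟨mem_univ _, P.layers_subset_Icc hq.2⟩
  have hρ : ContinuousOn (fun q : (ℝ × (ℝ × ℝ)) × ℝ => P.ρ q.2) (univ ×ˢ P.layers) :=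
    contDiffOn_rho.continuousOn.comp continuousOn_snd fun q hq => hq.2
  have hF : ContinuousOn F (univ ×ˢ P.layers) := by
    refine hρ.mul (ContinuousOn.add (ContinuousOn.pow ?_ 2) (hsol.fst.pow 2))
    exact (by fun_prop : ContinuousOn (fun q : (ℝ × (ℝ × ℝ)) × ℝ => q.1.1) _).mul
      ((continuousOn_const.mul hsol.fst).sub (hsol.snd.div hρ fun q hq => (rho_pos hq.2).ne'))
  classical
  have hG : StronglyMeasurable (((univ : Set (ℝ × (ℝ × ℝ))) ×ˢ P.layers).piecewise F 0) :=
    (hF.measurable_piecewise continuousOn_const hS).stronglyMeasurable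
  have hJ := (hG.integral_prod_right' (ν := volume.restrict P.layers)).measurable
  have hpar : Measurable fun a => (r a / (lam a ^ 2 + 4 * P.om ^ 2), P.par (r a) (lam a ^ 2)) :=
    (hr.div ((hl.pow_const 2).add_const _)).prodMk
      ((hl.pow_const 2).prodMk ((hr.pow_const 2).div ((hl.pow_const 2).add_const _)))
  have h2 : (fun a => P.mass (lam a) (r a)) = fun a => √((∫ z in P.layers,
      ((univ : Set (ℝ × (ℝ × ℝ))) ×ˢ P.layers).piecewise F 0
        ((r a / (lam a ^ 2 + 4 * P.om ^ 2), P.par (r a) (lam a ^ 2)), z)) / 2) := by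
    funext a
    rw [mass]
    congr 1
    rw [eq_div_iff two_ne_zero, mul_comm, two_mul_J]
    refine setIntegral_congr_fun P.measurableSet_layers fun z hz => ?_
    rw [piecewise_eq_of_mem _ _ _ (show ((r a / (lam a ^ 2 + 4 * P.om ^ 2),
      P.par (r a) (lam a ^ 2)), z) ∈ (univ : Set (ℝ × (ℝ × ℝ))) ×ˢ P.layers from ⟨mem_univ _, hz⟩)]
    rfl
  rw [h2]
  exact ((hJ.comp hpar).div_const 2).sqrt

lemma measurable_rawSol {α : Type*} [MeasurableSpace α] {lam r : α → ℝ} (hl : Measurable lam)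
    (hr : Measurable r) {z : ℝ} (hz : z ∈ P.layers) :
    Measurable fun a => P.rawSol (lam a) (r a) z := by
  have hpar : Measurable fun a => P.par (r a) (lam a ^ 2) :=
    ((hl.pow_const 2).prodMk ((hr.pow_const 2).div ((hl.pow_const 2).add_const _)))
  exact (continuous_sol_left (P.layers_subset_Icc hz)).measurable.comp hpar

/-- A family of normal modes exists. -/
theorem isNormalModeFamily_modeFamily {R₀ : ℝ} (hR : 0 < R₀)
    (h : ∀ r > R₀, IsGLB (P.energyValues r) (sInf (P.energyValues r)) ∧
      0 < -sInf (P.energyValues r)) : P.IsNormalModeFamily R₀ (P.modeFamily R₀) := by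
  have hpos : ∀ r > R₀, 0 < P.rate R₀ r := fun r hr => by
    rw [rate, if_pos hr]; exact Real.sqrt_pos.2 (h r hr).2
  have hglb : ∀ r > R₀, IsGLB (P.energyValues r) (-(P.rate R₀ r) ^ 2) := fun r hr => by
    rw [rate, if_pos hr, Real.sq_sqrt (h r hr).2.le, neg_neg]
    exact (h r hr).1
  have hzero : ∀ r ≤ R₀, P.rate R₀ r = 0 := fun r hr => if_neg (not_lt.2 hr)
  have hmeas : Measurable (P.rate R₀) := measurable_growthRate hpos hglb hzero
  have hm1 : Measurable fun ξ : Plane => P.rate R₀ ‖ξ‖ := hmeas.comp measurable_norm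
  have hm2 : Measurable fun ξ : Plane => ‖ξ‖ := measurable_norm
  have hset : MeasurableSet {ξ : Plane | R₀ < ‖ξ‖} := measurableSet_lt measurable_const hm2
  have hmm := measurable_mass (P := P) hm1 hm2
  have m0 : ∀ i, Measurable fun ξ : Plane => ξ i / ‖ξ‖ := fun i =>
    (by fun_prop : Measurable fun ξ : Plane => ξ i).div hm2
  have mΨ : ∀ z ∈ P.layers, Measurable fun ξ : Plane => P.profPsi (P.rate R₀ ‖ξ‖) ‖ξ‖ z :=
    fun z hz => hmm.inv.mul (measurable_rawSol hm1 hm2 hz).fst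
  have mΦ : ∀ z ∈ P.layers, Measurable fun ξ : Plane => P.profPhi (P.rate R₀ ‖ξ‖) ‖ξ‖ z :=
    fun z hz => hmm.inv.mul ((hm2.div ((hm1.pow_const 2).add_const _)).mul
      (((measurable_rawSol hm1 hm2 hz).fst.const_mul _).sub
        ((measurable_rawSol hm1 hm2 hz).snd.div_const _)))
  have mΘ : ∀ z ∈ P.layers, Measurable fun ξ : Plane => P.profTheta (P.rate R₀ ‖ξ‖) ‖ξ‖ z :=
    fun z hz => (hm1.const_div _).neg.mul (mΦ z hz)
  refine ⟨hpos, hglb, isNormalMode_modeFamily hR hpos hglb, ?_, ?_, ?_, ?_, ?_, ?_, ?_, hzero,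
    ?_, ?_, ?_⟩
  · intro r hr
    have hr0 : 0 < r := hR.trans hr
    have hn : ‖vec r 0‖ = r := norm_vec_zero hr0.le
    have e1 : (P.modeFamily R₀).φ (vec r 0) = P.profPhi (P.rate R₀ r) r := by
      funext z
      simp only [modeFamily, hn, vec_zero, vec_one]
      rw [if_pos hr, div_self hr0.ne']
      ring
    have e2 : (P.modeFamily R₀).ψ (vec r 0) = P.profPsi (P.rate R₀ r) r := by
      funext z
      simp only [modeFamily, hn]
      rw [if_pos hr]
    rw [e1, e2]
    exact J_prof (hpos r hr) hr0.ne'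
  · intro α ξ hξ z _
    simp only [modeFamily, norm_rot, rot_zero, rot_one, if_pos hξ]
    ring
  · intro α ξ hξ z _
    simp only [modeFamily, norm_rot, rot_zero, rot_one, if_pos hξ]
    ring
  · intro α ξ hξ z _
    simp only [modeFamily, norm_rot]
  · exact fun z hz => Measurable.ite hset (((m0 0).mul (mΦ z hz)).sub ((m0 1).mul (mΘ z hz)))
      measurable_const
  · exact fun z hz => Measurable.ite hset (((m0 1).mul (mΦ z hz)).add ((m0 0).mul (mΘ z hz)))
      measurable_const
  · exact fun z hz => Measurable.ite hset (mΨ z hz) measurable_const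
  · exact fun ξ hξ z => if_neg (not_lt.2 hξ)
  · exact fun ξ hξ z => if_neg (not_lt.2 hξ)
  · exact fun ξ hξ z => if_neg (not_lt.2 hξ)

end Config

/-! ### Estimates that hold for every family of modes. -/

namespace Config

variable {P : Config}

section Mode

variable {ξ : Plane} {lam : ℝ} {φ θ ψ : ℝ → ℝ}

/-- The horizontal equations form a 2×2 linear system for (φ, θ) with determinant ρ²λ²(λ² + 4ω²);
Cramer's rule expresses φ by ψ and the flux, without derivatives of the profiles. -/
lemma IsNormalMode.phi_eq (h : P.IsNormalMode ξ lam φ θ ψ) (hl : 0 < lam) {z : ℝ}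
    (hz : z ∈ P.layers) : φ z = (ξ 0 + 2 * P.om / lam * ξ 1) / (lam ^ 2 + 4 * P.om ^ 2) *
      (P.g * ψ z - P.flux ξ φ θ ψ z / P.ρ z) := by
  have h1 := h.eq₁ z hz
  have h2 := h.eq₂ z hz
  have hρ := rho_pos hz
  have hD : 0 < lam ^ 2 + 4 * P.om ^ 2 := by positivity
  field_simp
  have hl' := hl.ne'
  apply mul_left_cancel₀ hl'
  linear_combination lam * lam * h1 + 2 * P.om * lam * h2

lemma IsNormalMode.theta_eq (h : P.IsNormalMode ξ lam φ θ ψ) (hl : 0 < lam) {z : ℝ}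
    (hz : z ∈ P.layers) : θ z = (ξ 1 - 2 * P.om / lam * ξ 0) / (lam ^ 2 + 4 * P.om ^ 2) *
      (P.g * ψ z - P.flux ξ φ θ ψ z / P.ρ z) := by
  have h1 := h.eq₁ z hz
  have h2 := h.eq₂ z hz
  have hρ := rho_pos hz
  have hD : 0 < lam ^ 2 + 4 * P.om ^ 2 := by positivity
  field_simp
  have hl' := hl.ne'
  apply mul_left_cancel₀ hl'
  linear_combination lam * lam * h2 - 2 * P.om * lam * h1

lemma IsNormalMode.horizontal_eq (h : P.IsNormalMode ξ lam φ θ ψ) (hl : 0 < lam) {z : ℝ}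
    (hz : z ∈ P.layers) : ξ 0 * φ z + ξ 1 * θ z = ‖ξ‖ ^ 2 / (lam ^ 2 + 4 * P.om ^ 2) *
      (P.g * ψ z - P.flux ξ φ θ ψ z / P.ρ z) := by
  rw [h.phi_eq hl hz, h.theta_eq hl hz, norm_sq_plane]
  ring

lemma IsNormalMode.contDiffOn_deriv (h : P.IsNormalMode ξ lam φ θ ψ) :
    ContDiffOn ℝ ∞ (deriv ψ) P.layers :=
  ((contDiffOn_infty_iff_deriv_of_isOpen P.isOpen_layers).1 h.smooth_ψ).2

lemma IsNormalMode.contDiffOn_flux (h : P.IsNormalMode ξ lam φ θ ψ) :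
    ContDiffOn ℝ ∞ (P.flux ξ φ θ ψ) P.layers :=
  (contDiffOn_dp.mul contDiffOn_rho).mul (((contDiffOn_const.mul h.smooth_φ).add
    (contDiffOn_const.mul h.smooth_θ)).add h.contDiffOn_deriv)

/-- Every normal mode, constructed or not, solves the first order system. Together with
`IsNormalMode.hasDerivAt_flux` this makes the derivative estimates algebraic. -/
lemma IsNormalMode.hasDerivAt_psi (h : P.IsNormalMode ξ lam φ θ ψ) (hl : 0 < lam) {z : ℝ}
    (hz : z ∈ P.layers) :
    HasDerivAt ψ (P.rhsPsi (P.par ‖ξ‖ (lam ^ 2)) (ψ z, P.flux ξ φ θ ψ z) z) z := by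
  have hd := ((h.smooth_ψ.differentiableOn (by simp)).differentiableAt
    (P.isOpen_layers.mem_nhds hz)).hasDerivAt
  refine hd.congr_deriv ?_
  have h1 := h.horizontal_eq hl hz
  have h2 : P.flux ξ φ θ ψ z = P.dp z * P.ρ z * (ξ 0 * φ z + ξ 1 * θ z + deriv ψ z) := rfl
  rw [h1] at h2
  have hρ := rho_pos hz
  have hdp := dp_pos hz
  have h3 : (P.dp z * P.ρ z)⁻¹ * P.flux ξ φ θ ψ z = ‖ξ‖ ^ 2 / (lam ^ 2 + 4 * P.om ^ 2) *
      (P.g * ψ z - P.flux ξ φ θ ψ z / P.ρ z) + deriv ψ z := by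
    rw [inv_mul_eq_iff_eq_mul₀ (mul_pos hdp hρ).ne']
    exact h2
  simp only [rhsPsi, par]
  rw [add_mul, h3]
  ring

lemma IsNormalMode.hasDerivAt_flux (h : P.IsNormalMode ξ lam φ θ ψ) (hl : 0 < lam) {z : ℝ}
    (hz : z ∈ P.layers) : HasDerivAt (P.flux ξ φ θ ψ)
      (P.rhsSigma (P.par ‖ξ‖ (lam ^ 2)) (ψ z, P.flux ξ φ θ ψ z) z) z := by
  have hd := ((h.contDiffOn_flux.differentiableOn (by simp)).differentiableAt
    (P.isOpen_layers.mem_nhds hz)).hasDerivAt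
  refine hd.congr_deriv ?_
  have h1 := h.horizontal_eq hl hz
  have h2 := h.eq₃ z hz
  rw [h1] at h2
  have hρ := rho_pos hz
  simp only [rhsSigma, par]
  have h3 : P.ρ z * (P.flux ξ φ θ ψ z / P.ρ z) = P.flux ξ φ θ ψ z := mul_div_cancel₀ _ hρ.ne'
  linear_combination -h2 + P.g * (‖ξ‖ ^ 2 / (lam ^ 2 + 4 * P.om ^ 2)) * h3

end Mode

/-- Bounds for the growth rate that hold for every family of modes above the frequency `R₀`. -/
structure GrowthBounds (P : Config) (R₀ c : ℝ) : Prop where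
  one_lt : 1 < R₀
  pos : 0 < c
  two_le : 2 ≤ c * R₀
  isGLB : ∀ r > R₀, IsGLB (P.energyValues r) (sInf (P.energyValues r))
  lower : ∀ r > R₀, c * r ≤ -sInf (P.energyValues r)

lemma exists_growthBounds (P : Config) : ∃ R₀ c, P.GrowthBounds R₀ c := by
  obtain ⟨c, hc, r₀, hr₀, h⟩ := P.exists_isGLB
  -- The summand 2 gives R₀ > 1, and the summand 2/c gives cR₀ ≥ 2.
  refine ⟨r₀ + 2 + 2 / c, c, by have : 0 < 2 / c := by positivity
                                linarith, hc, ?_, fun r hr => (h r ?_).1, fun r hr => (h r ?_).2⟩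
  · have : c * (2 / c) = 2 := by field_simp
    nlinarith
  all_goals
    have : 0 < 2 / c := by positivity
    linarith

variable {R₀ c : ℝ} {M : ModeFamily}

/-- An infimum is unique, so all families share the same growth rate and the bounds do not depend on
the family. -/
lemma GrowthBounds.le_lam_sq (hB : P.GrowthBounds R₀ c) (hM : P.IsNormalModeFamily R₀ M) {r : ℝ}
    (hr : R₀ < r) : c * r ≤ M.lam r ^ 2 := by
  have h1 := (hM.lam_variational r hr).unique (hB.isGLB r hr)
  have := hB.lower r hr
  linarith

lemma GrowthBounds.pos_of_lt (hB : P.GrowthBounds R₀ c) {r : ℝ} (hr : R₀ < r) : 0 < r := by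
  linarith [hB.one_lt]

lemma GrowthBounds.lam_sq_le (hB : P.GrowthBounds R₀ c) (hM : P.IsNormalModeFamily R₀ M) {r : ℝ}
    (hr : R₀ < r) : M.lam r ^ 2 ≤ P.g * r := by
  have h1 := (hM.lam_variational r hr).2 (neg_mem_lowerBounds (hB.pos_of_lt hr).le)
  linarith

lemma GrowthBounds.one_le_lam (hB : P.GrowthBounds R₀ c) (hM : P.IsNormalModeFamily R₀ M) {r : ℝ}
    (hr : R₀ < r) : 1 ≤ M.lam r := by
  have h1 := hB.le_lam_sq hM hr
  have h2 : c * R₀ ≤ c * r := mul_le_mul_of_nonneg_left hr.le hB.pos.le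
  have h3 := hB.two_le
  have h4 := hM.lam_pos r hr
  nlinarith

/-- The flux of the mode at the frequency `ξ`. -/
def sig (P : Config) (M : ModeFamily) (ξ : Plane) : ℝ → ℝ := P.flux ξ (M.φ ξ) (M.θ ξ) (M.ψ ξ)

/-- The size of a mode, which controls all its derivatives. -/
def amp (P : Config) (M : ModeFamily) (ξ : Plane) (z : ℝ) : ℝ := |M.ψ ξ z| + |P.sig M ξ z|

lemma amp_nonneg (ξ : Plane) (z : ℝ) : 0 ≤ P.amp M ξ z := by unfold amp; positivity

/-- The lower bound λ² ≥ cr brings μ = r²/(λ² + 4ω²) down from order r² to order r, so that a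
vertical derivative costs one power of the frequency and not two. -/
lemma GrowthBounds.mu_le (hB : P.GrowthBounds R₀ c) (hM : P.IsNormalModeFamily R₀ M) {r : ℝ}
    (hr : R₀ < r) : r ^ 2 / (M.lam r ^ 2 + 4 * P.om ^ 2) ≤ c⁻¹ * r := by
  have h1 := hB.le_lam_sq hM hr
  have h2 := hB.pos_of_lt hr
  have hc := hB.pos
  have h3 : 0 < c * r := by positivity
  have hl := hM.lam_pos r hr
  rw [div_le_iff₀ (by positivity)]
  have h4 : c * r ≤ M.lam r ^ 2 + 4 * P.om ^ 2 := h1.trans (by nlinarith [sq_nonneg P.om])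
  calc r ^ 2 = c⁻¹ * r * (c * r) := by field_simp
    _ ≤ _ := by gcongr

lemma GrowthBounds.coef_le (hB : P.GrowthBounds R₀ c) (hM : P.IsNormalModeFamily R₀ M) {ξ : Plane}
    (hξ : R₀ < ‖ξ‖) {a b : ℝ} (ha : |a| ≤ ‖ξ‖) (hb : |b| ≤ ‖ξ‖) :
    |(a + 2 * P.om / M.lam ‖ξ‖ * b) / (M.lam ‖ξ‖ ^ 2 + 4 * P.om ^ 2)|
      ≤ (1 + 2 * |P.om|) * c⁻¹ := by
  have h1 := hB.one_le_lam hM hξ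
  have h2 := hB.mu_le hM hξ
  have h3 := hB.pos_of_lt hξ
  have hl := hM.lam_pos _ hξ
  have hc := hB.pos
  have h5 : |2 * P.om / M.lam ‖ξ‖| ≤ 2 * |P.om| := by
    rw [abs_div, abs_mul, abs_two, abs_of_pos hl]
    exact div_le_self (by positivity) h1
  have hD : 0 < M.lam ‖ξ‖ ^ 2 + 4 * P.om ^ 2 := by positivity
  rw [abs_div, abs_of_pos hD]
  have h6 : |a + 2 * P.om / M.lam ‖ξ‖ * b| ≤ (1 + 2 * |P.om|) * ‖ξ‖ := by
    refine (abs_add_le _ _).trans ?_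
    rw [abs_mul, add_mul, one_mul]
    gcongr
  have h7 : ‖ξ‖ / (M.lam ‖ξ‖ ^ 2 + 4 * P.om ^ 2) ≤ c⁻¹ := by
    rw [pow_two, mul_div_assoc, mul_comm] at h2
    exact le_of_mul_le_mul_right h2 h3
  calc _ ≤ (1 + 2 * |P.om|) * ‖ξ‖ / (M.lam ‖ξ‖ ^ 2 + 4 * P.om ^ 2) := by gcongr
    _ = (1 + 2 * |P.om|) * (‖ξ‖ / (M.lam ‖ξ‖ ^ 2 + 4 * P.om ^ 2)) := by ring
    _ ≤ _ := by gcongr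

lemma abs_coord_le (ξ : Plane) (i : Fin 2) : |ξ i| ≤ ‖ξ‖ := PiLp.norm_apply_le ξ i

/-- Linear combinations of `ψ` and the flux whose coefficients are smooth functions of the density
times functions of the frequency of growth at most `|ξ|^j`. -/
inductive ModeSpan (P : Config) (R₀ : ℝ) (I : Set ℝ) :
    ℕ → (ModeFamily → Plane → ℝ → ℝ) → Prop
  | psi (j : ℕ) (a : ModeFamily → Plane → ℝ) (F : ℝ → ℝ) (hF : ContDiffOn ℝ ∞ F (Ioi 0)) (C : ℝ)
      (ha : ∀ M, P.IsNormalModeFamily R₀ M → ∀ ξ, R₀ < ‖ξ‖ → |a M ξ| ≤ C * ‖ξ‖ ^ j) :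
      ModeSpan P R₀ I j fun M ξ z => a M ξ * F (P.ρ z) * M.ψ ξ z
  | sigma (j : ℕ) (a : ModeFamily → Plane → ℝ) (F : ℝ → ℝ) (hF : ContDiffOn ℝ ∞ F (Ioi 0)) (C : ℝ)
      (ha : ∀ M, P.IsNormalModeFamily R₀ M → ∀ ξ, R₀ < ‖ξ‖ → |a M ξ| ≤ C * ‖ξ‖ ^ j) :
      ModeSpan P R₀ I j fun M ξ z => a M ξ * F (P.ρ z) * P.sig M ξ z
  | add {j : ℕ} {h h' : ModeFamily → Plane → ℝ → ℝ} (H : ModeSpan P R₀ I j h) (H' : ModeSpan P R₀ I j h') :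
      ModeSpan P R₀ I j fun M ξ z => h M ξ z + h' M ξ z
  | congr {j : ℕ} {h h' : ModeFamily → Plane → ℝ → ℝ} (H : ModeSpan P R₀ I j h)
      (heq : ∀ M, P.IsNormalModeFamily R₀ M → ∀ ξ, R₀ < ‖ξ‖ → EqOn (h' M ξ) (h M ξ) I) : ModeSpan P R₀ I j h'

section Span

variable {I : Set ℝ} {p : ℝ → ℝ} {j : ℕ} {h : ModeFamily → Plane → ℝ → ℝ}

lemma ModeSpan.bound (hI : I ⊆ P.layers) (H : ModeSpan P R₀ I j h) :
    ∃ C > 0, ∀ M, P.IsNormalModeFamily R₀ M → ∀ ξ, R₀ < ‖ξ‖ → ∀ z ∈ I, |h M ξ z| ≤ C * ‖ξ‖ ^ j * P.amp M ξ z := by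
  induction H with
  | psi a F hF C ha =>
    obtain ⟨D, hD, h1⟩ := P.exists_bound_comp hF.continuousOn
    refine ⟨max C 1 * D, by positivity, fun M hM ξ hξ z hz => ?_⟩
    rw [abs_mul, abs_mul]
    have e1 : |a M ξ| ≤ max C 1 * ‖ξ‖ ^ j := (ha M hM ξ hξ).trans (by gcongr; exact le_max_left _ _)
    have e2 := h1 z (hI hz)
    have e3 : |M.ψ ξ z| ≤ P.amp M ξ z := le_add_of_nonneg_right (abs_nonneg _)
    calc _ ≤ (max C 1 * ‖ξ‖ ^ j) * D * P.amp M ξ z := by gcongr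
      _ = _ := by ring
  | sigma a F hF C ha =>
    obtain ⟨D, hD, h1⟩ := P.exists_bound_comp hF.continuousOn
    refine ⟨max C 1 * D, by positivity, fun M hM ξ hξ z hz => ?_⟩
    rw [abs_mul, abs_mul]
    have e1 : |a M ξ| ≤ max C 1 * ‖ξ‖ ^ j := (ha M hM ξ hξ).trans (by gcongr; exact le_max_left _ _)
    have e2 := h1 z (hI hz)
    have e3 : |P.sig M ξ z| ≤ P.amp M ξ z := le_add_of_nonneg_left (abs_nonneg _)
    calc _ ≤ (max C 1 * ‖ξ‖ ^ j) * D * P.amp M ξ z := by gcongr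
      _ = _ := by ring
  | add _ _ ih ih' =>
    obtain ⟨C, hC, h1⟩ := ih
    obtain ⟨C', hC', h2⟩ := ih'
    refine ⟨C + C', by positivity, fun M hM ξ hξ z hz => (abs_add_le _ _).trans ?_⟩
    rw [add_mul, add_mul]
    exact add_le_add (h1 M hM ξ hξ z hz) (h2 M hM ξ hξ z hz)
  | congr _ heq ih =>
    obtain ⟨C, hC, h1⟩ := ih
    exact ⟨C, hC, fun M hM ξ hξ z hz => by rw [heq M hM ξ hξ hz]; exact h1 M hM ξ hξ z hz⟩

/-- A derivative falls either on F(ρ), giving F'(ρ)G(ρ), or on ψ or σ, where the system returns ψ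
and σ with coefficients of order at most one in |ξ|, namely constants, μ and λ². Terms of lower
order are lifted by |ξ| ≥ 1. -/
lemma ModeSpan.hasDerivAt (hB : P.GrowthBounds R₀ c)
    (hI : P.IsLayer I p) (H : ModeSpan P R₀ I j h) :
    ∃ h', ModeSpan P R₀ I (j + 1) h' ∧
      ∀ M, P.IsNormalModeFamily R₀ M → ∀ ξ, R₀ < ‖ξ‖ → ∀ z ∈ I, HasDerivAt (h M ξ) (h' M ξ z) z := by
  have hone : ∀ ξ : Plane, R₀ < ‖ξ‖ → 1 ≤ ‖ξ‖ := fun ξ hξ => hB.one_lt.le.trans hξ.le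
  have hc := hB.pos
  have hg := P.g_pos
  set μ : ModeFamily → Plane → ℝ := fun M ξ => ‖ξ‖ ^ 2 / (M.lam ‖ξ‖ ^ 2 + 4 * P.om ^ 2)
  have hμ0 : ∀ M ξ, 0 ≤ μ M ξ := fun M ξ => by positivity
  have hμ : ∀ M, P.IsNormalModeFamily R₀ M → ∀ ξ, R₀ < ‖ξ‖ → |μ M ξ| ≤ c⁻¹ * ‖ξ‖ := fun M hM ξ hξ => by
    rw [abs_of_nonneg (hμ0 M ξ)]; exact hB.mu_le hM hξ
  have hmul : ∀ {j : ℕ} {a b : ModeFamily → Plane → ℝ} {C D : ℝ},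
      (∀ M, P.IsNormalModeFamily R₀ M → ∀ ξ, R₀ < ‖ξ‖ → |a M ξ| ≤ C * ‖ξ‖ ^ j) →
      (∀ M, P.IsNormalModeFamily R₀ M → ∀ ξ, R₀ < ‖ξ‖ → |b M ξ| ≤ D * ‖ξ‖) →
      ∀ M, P.IsNormalModeFamily R₀ M → ∀ ξ, R₀ < ‖ξ‖ →
        |a M ξ * b M ξ| ≤ C * D * ‖ξ‖ ^ (j + 1) := by
    intro j a b C D ha hb M hM ξ hξ
    rw [abs_mul, pow_succ]
    calc _ ≤ (C * ‖ξ‖ ^ j) * (D * ‖ξ‖) :=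
          mul_le_mul (ha M hM ξ hξ) (hb M hM ξ hξ) (abs_nonneg _) ((abs_nonneg _).trans (ha M hM ξ hξ))
      _ = _ := by ring
  have hlift : ∀ {j : ℕ} {a : ModeFamily → Plane → ℝ} {C : ℝ},
      (∀ M, P.IsNormalModeFamily R₀ M → ∀ ξ, R₀ < ‖ξ‖ → |a M ξ| ≤ C * ‖ξ‖ ^ j) →
      ∀ M, P.IsNormalModeFamily R₀ M → ∀ ξ, R₀ < ‖ξ‖ → |a M ξ| ≤ C * ‖ξ‖ ^ (j + 1) := by
    intro j a C ha M hM ξ hξ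
    have h0 := (abs_nonneg _).trans (ha M hM ξ hξ)
    calc _ ≤ (C * ‖ξ‖ ^ j) * 1 := by rw [mul_one]; exact ha M hM ξ hξ
      _ ≤ (C * ‖ξ‖ ^ j) * ‖ξ‖ := mul_le_mul_of_nonneg_left (hone ξ hξ) h0
      _ = _ := by ring
  have sid : ContDiffOn ℝ ∞ (fun x : ℝ => x) (Ioi 0) := contDiffOn_id
  have sinv : ContDiffOn ℝ ∞ (fun x : ℝ => x⁻¹) (Ioi 0) := sid.inv fun x hx => (ne_of_gt hx)
  have sG := hI.slope_smooth
  have sdp : ContDiffOn ℝ ∞ (fun x : ℝ => (deriv p x * x)⁻¹) (Ioi 0) :=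
    ((hI.deriv_smooth hI.law).mul sid).inv
      fun x hx => (mul_pos (hI.law.deriv_pos hx) hx).ne'
  have sder : ∀ {F : ℝ → ℝ}, ContDiffOn ℝ ∞ F (Ioi 0) →
      ContDiffOn ℝ ∞ (fun x => deriv F x * P.slope p x) (Ioi 0) := fun hF =>
    ((contDiffOn_infty_iff_deriv_of_isOpen isOpen_Ioi).1 hF).2.mul sG
  induction H with
  | psi a F hF C ha =>
    refine ⟨_, ((ModeSpan.psi (j + 1) a _ (sder hF) C (hlift ha)).add
      (ModeSpan.psi (j + 1) (fun M ξ => a M ξ * (-P.g * μ M ξ)) F hF _ (hmul (D := P.g * c⁻¹) ha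
        fun M hM ξ hξ => ?_))).add ((ModeSpan.sigma (j + 1) a _ (hF.mul sdp) C (hlift ha)).add
      (ModeSpan.sigma (j + 1) (fun M ξ => a M ξ * μ M ξ) _ (hF.mul sinv) _ (hmul ha hμ))), ?_⟩
    · rw [abs_mul, abs_neg, abs_of_pos hg, mul_assoc]
      exact mul_le_mul_of_nonneg_left (hμ M hM ξ hξ) hg.le
    · intro M hM ξ hξ z hz
      have hz' := hI.subset hz
      have h1 := ((hI.hasDerivAt_comp hF hz).const_mul (a M ξ)).mul
        ((hM.mode ξ hξ).hasDerivAt_psi (hM.lam_pos _ hξ) hz')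
      refine h1.congr_deriv ?_
      simp only [rhsPsi, par, hI.dp_eq z hz, sig, μ]
      ring
  | sigma a F hF C ha =>
    refine ⟨_, ((ModeSpan.sigma (j + 1) a _ (sder hF) C (hlift ha)).add
      (ModeSpan.sigma (j + 1) (fun M ξ => a M ξ * (P.g * μ M ξ)) F hF _ (hmul (D := P.g * c⁻¹) ha
        fun M hM ξ hξ => ?_))).add (ModeSpan.psi (j + 1)
          (fun M ξ => a M ξ * (M.lam ‖ξ‖ ^ 2 - P.g ^ 2 * μ M ξ)) _ (hF.mul sid) _
          (hmul (D := P.g + P.g ^ 2 * c⁻¹) ha fun M hM ξ hξ => ?_)), ?_⟩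
    · rw [abs_mul, abs_of_pos hg, mul_assoc]
      exact mul_le_mul_of_nonneg_left (hμ M hM ξ hξ) hg.le
    · refine (abs_sub _ _).trans ?_
      rw [abs_of_nonneg (sq_nonneg _), abs_mul, abs_of_pos (pow_pos hg 2), add_mul, mul_assoc]
      exact add_le_add (hB.lam_sq_le hM hξ) (mul_le_mul_of_nonneg_left (hμ M hM ξ hξ) (by positivity))
    · intro M hM ξ hξ z hz
      have hz' := hI.subset hz
      have h1 := ((hI.hasDerivAt_comp hF hz).const_mul (a M ξ)).mul
        ((hM.mode ξ hξ).hasDerivAt_flux (hM.lam_pos _ hξ) hz')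
      refine h1.congr_deriv ?_
      simp only [rhsSigma, par, sig, μ]
      ring
  | add _ _ ih ih' =>
    obtain ⟨h1, H1, d1⟩ := ih
    obtain ⟨h2, H2, d2⟩ := ih'
    exact ⟨_, H1.add H2, fun M hM ξ hξ z hz => (d1 M hM ξ hξ z hz).add (d2 M hM ξ hξ z hz)⟩
  | congr _ heq ih =>
    obtain ⟨h1, H1, d1⟩ := ih
    exact ⟨_, H1, fun M hM ξ hξ z hz => (d1 M hM ξ hξ z hz).congr_of_eventuallyEq
      ((heq M hM ξ hξ).eventuallyEq_of_mem (hI.isOpen.mem_nhds hz))⟩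

lemma ModeSpan.iteratedDeriv (hB : P.GrowthBounds R₀ c)
    (hI : P.IsLayer I p) (H : ModeSpan P R₀ I j h) (n : ℕ) :
    ∃ h', ModeSpan P R₀ I (j + n) h' ∧
      ∀ M, P.IsNormalModeFamily R₀ M → ∀ ξ, R₀ < ‖ξ‖ →
        EqOn (iteratedDeriv n (h M ξ)) (h' M ξ) I := by
  induction n with
  | zero => exact ⟨h, H, fun M _ ξ _ z _ => by simp⟩
  | succ n ih =>
    obtain ⟨h1, H1, e1⟩ := ih
    obtain ⟨h2, H2, d2⟩ := H1.hasDerivAt hB hI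
    refine ⟨h2, H2, fun M hM ξ hξ z hz => ?_⟩
    rw [iteratedDeriv_succ]
    exact ((d2 M hM ξ hξ z hz).congr_of_eventuallyEq
      ((e1 M hM ξ hξ).eventuallyEq_of_mem (hI.isOpen.mem_nhds hz))).deriv

end Span

/-- A function of the mode that is, in each of the layers, such a combination of order `0`. -/
def IsModeFunction (P : Config) (R₀ : ℝ) (h : ModeFamily → Plane → ℝ → ℝ) : Prop :=
  ∀ I p, P.IsLayer I p → ModeSpan P R₀ I 0 h

lemma IsModeFunction.bound {h : ModeFamily → Plane → ℝ → ℝ} (H : P.IsModeFunction R₀ h)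
    (hB : P.GrowthBounds R₀ c) (n : ℕ) :
    ∃ C > 0, ∀ M, P.IsNormalModeFamily R₀ M → ∀ ξ, R₀ < ‖ξ‖ → ∀ z ∈ P.layers,
      |iteratedDeriv n (h M ξ) z| ≤ C * ‖ξ‖ ^ n * P.amp M ξ z := by
  have key : ∀ I p, P.IsLayer I p → ∃ C > 0, ∀ M, P.IsNormalModeFamily R₀ M → ∀ ξ, R₀ < ‖ξ‖ →
      ∀ z ∈ I, |iteratedDeriv n (h M ξ) z| ≤ C * ‖ξ‖ ^ n * P.amp M ξ z := by
    intro I p hI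
    obtain ⟨h', H', e⟩ := (H I p hI).iteratedDeriv hB hI n
    obtain ⟨C, hC, hb⟩ := H'.bound hI.subset
    refine ⟨C, hC, fun M hM ξ hξ z hz => ?_⟩
    rw [e M hM ξ hξ hz]
    simpa using hb M hM ξ hξ z hz
  obtain ⟨C, hC, h1⟩ := key _ _ isLayer_upper
  obtain ⟨D, hD, h2⟩ := key _ _ isLayer_lower
  refine ⟨max C D, by positivity, fun M hM ξ hξ z hz => ?_⟩
  have h0 := amp_nonneg (P := P) (M := M) ξ z
  rcases hz with hz | hz
  · exact (h2 M hM ξ hξ z hz).trans (by gcongr; exact le_max_right _ _)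
  · exact (h1 M hM ξ hξ z hz).trans (by gcongr; exact le_max_left _ _)

lemma isModeFunction_psi : P.IsModeFunction R₀ ModeFamily.ψ := fun I _ _ =>
  (ModeSpan.psi 0 (fun _ _ => 1) (fun _ => 1) contDiffOn_const 1 (by simp)).congr
    fun M _ ξ _ z _ => by simp

lemma isModeFunction_sig : P.IsModeFunction R₀ P.sig := fun I _ _ =>
  (ModeSpan.sigma 0 (fun _ _ => 1) (fun _ => 1) contDiffOn_const 1 (by simp)).congr
    fun M _ ξ _ z _ => by simp

lemma isModeFunction_combination {a : ModeFamily → Plane → ℝ} {C : ℝ}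
    (ha : ∀ M, P.IsNormalModeFamily R₀ M → ∀ ξ, R₀ < ‖ξ‖ → |a M ξ| ≤ C)
    {h : ModeFamily → Plane → ℝ → ℝ} (heq : ∀ M, P.IsNormalModeFamily R₀ M → ∀ ξ, R₀ < ‖ξ‖ → ∀ z ∈ P.layers,
      h M ξ z = a M ξ * (P.g * M.ψ ξ z - P.sig M ξ z / P.ρ z)) : P.IsModeFunction R₀ h := by
  intro I p hI
  have sinv : ContDiffOn ℝ ∞ (fun x : ℝ => x⁻¹) (Ioi 0) :=
    contDiffOn_id.inv fun x hx => (ne_of_gt hx)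
  refine ((ModeSpan.psi 0 a (fun _ => P.g) contDiffOn_const C (by simpa using ha)).add
    (ModeSpan.sigma 0 (fun M ξ => -a M ξ) _ sinv C (by simpa using ha))).congr fun M hM ξ hξ z hz => ?_
  rw [heq M hM ξ hξ z (hI.subset hz)]
  ring

lemma isModeFunction_phi (hB : P.GrowthBounds R₀ c) : P.IsModeFunction R₀ ModeFamily.φ :=
  isModeFunction_combination
    (fun _ hM ξ hξ => hB.coef_le hM hξ (abs_coord_le ξ 0) (abs_coord_le ξ 1))
    fun _ hM ξ hξ _ hz => (hM.mode ξ hξ).phi_eq (hM.lam_pos _ hξ) hz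

lemma isModeFunction_theta (hB : P.GrowthBounds R₀ c) :
    P.IsModeFunction R₀ ModeFamily.θ :=
  isModeFunction_combination (a := fun M ξ => (ξ 1 + 2 * P.om / M.lam ‖ξ‖ * -ξ 0) /
      (M.lam ‖ξ‖ ^ 2 + 4 * P.om ^ 2))
    (fun M hM ξ hξ => hB.coef_le hM hξ (abs_coord_le ξ 1) (by rw [abs_neg]; exact abs_coord_le ξ 0))
    fun _ hM ξ hξ _ hz => by
      rw [mul_neg, ← sub_eq_add_neg]
      exact (hM.mode ξ hξ).theta_eq (hM.lam_pos _ hξ) hz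

/-- The profile of the density perturbation. -/
def dens (P : Config) (M : ModeFamily) (ξ : Plane) (z : ℝ) : ℝ :=
  -P.ρ z * (ξ 0 * M.φ ξ z + ξ 1 * M.θ ξ z + deriv (M.ψ ξ) z)

lemma sig_eq_dens (ξ : Plane) (z : ℝ) : P.sig M ξ z = -(P.dp z * P.dens M ξ z) := by
  simp only [sig, flux, dens]; ring

/-- The density profile contains ξ and ψ', but it is just -σ/p'(ρ) and hence of order zero. -/
lemma isModeFunction_dens : P.IsModeFunction R₀ P.dens := fun I p hI =>
  (ModeSpan.sigma 0 (fun _ _ => -1) (fun x => (deriv p x)⁻¹)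
    ((hI.deriv_smooth hI.law).inv fun x hx => (hI.law.deriv_pos hx).ne') 1 (by simp)).congr
    fun M _ ξ _ z hz => by
      have h1 := dp_pos (hI.subset hz)
      beta_reduce
      rw [sig_eq_dens, ← hI.dp_eq z hz]
      field_simp

/-! ### Normalization -/

lemma exists_rot (ξ : Plane) : ∃ α, ξ 0 = ‖ξ‖ * Real.cos α ∧ ξ 1 = ‖ξ‖ * Real.sin α := by
  set w : ℂ := ⟨ξ 0, ξ 1⟩
  have hw : ‖w‖ = ‖ξ‖ := by
    have h : ‖w‖ ^ 2 = ‖ξ‖ ^ 2 := by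
      rw [norm_sq_plane, Complex.sq_norm, Complex.normSq_apply]; ring
    exact (sq_eq_sq₀ (norm_nonneg _) (norm_nonneg _)).1 h
  exact ⟨w.arg, by rw [← hw, Complex.norm_mul_cos_arg], by rw [← hw, Complex.norm_mul_sin_arg]⟩

/-- By equivariance the component of (φ, θ)(ξ) along ξ is φ at (|ξ|, 0), which carries the
normalization to all directions. The value 2 compensates the factor 1/2 in J. -/
lemma mass_eq_two (hR : 0 ≤ R₀) (hM : P.IsNormalModeFamily R₀ M) {ξ : Plane} (hξ : R₀ < ‖ξ‖) :
    ∫ z in P.layers, P.ρ z * (((ξ 0 * M.φ ξ z + ξ 1 * M.θ ξ z) / ‖ξ‖) ^ 2 + M.ψ ξ z ^ 2) = 2 := by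
  obtain ⟨α, h0, h1⟩ := exists_rot ξ
  have hr : 0 < ‖ξ‖ := hR.trans_lt hξ
  have hv : R₀ < ‖vec ‖ξ‖ 0‖ := by rwa [norm_vec_zero hr.le]
  have hrot : rot α (vec ‖ξ‖ 0) = ξ := by
    ext i
    fin_cases i
    · change Real.cos α * ‖ξ‖ - Real.sin α * 0 = ξ 0
      rw [h0]; ring
    · change Real.sin α * ‖ξ‖ + Real.cos α * 0 = ξ 1
      rw [h1]; ring
  have hn := congrArg (2 * ·) (hM.normalized ‖ξ‖ hξ)
  simp only [mul_one] at hn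
  rw [two_mul_J] at hn
  rw [← hn]
  refine setIntegral_congr_fun P.measurableSet_layers fun z hz => ?_
  have e1 := hM.rot_φ α _ hv z hz
  have e2 := hM.rot_θ α _ hv z hz
  have e3 := hM.rot_ψ α _ hv z hz
  rw [hrot] at e1 e2 e3
  have e4 : (ξ 0 * M.φ ξ z + ξ 1 * M.θ ξ z) / ‖ξ‖ = M.φ (vec ‖ξ‖ 0) z := by
    rw [div_eq_iff hr.ne', e1, e2, h0, h1]
    linear_combination (M.φ (vec ‖ξ‖ 0) z * ‖ξ‖) * Real.sin_sq_add_cos_sq α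
  simp only [e4, e3]

/-- The size of a normalized mode is bounded in `L²` uniformly in the frequency. -/
lemma exists_amp_bound (hB : P.GrowthBounds R₀ c) : ∃ C > 0, ∀ M : ModeFamily,
    P.IsNormalModeFamily R₀ M → ∀ ξ, R₀ < ‖ξ‖ →
      IntegrableOn (fun z => P.amp M ξ z ^ 2) P.layers ∧
        ∫ z in P.layers, P.amp M ξ z ^ 2 ≤ C := by
  have hg := P.g_pos
  have ha := P.rhoMin_pos
  have hb := P.rhoMax_pos
  set k := 2 * P.rhoMin⁻¹ + 4 * P.g ^ 2 * P.rhoMax + 4 * (P.g + 4 * P.om ^ 2) ^ 2 * P.rhoMax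
  have hk : 0 < k := by positivity
  refine ⟨k * 2, by positivity, fun M hM ξ hξ => ?_⟩
  have hr : 0 < ‖ξ‖ := hB.pos_of_lt hξ
  have hr1 : 1 ≤ ‖ξ‖ := hB.one_lt.le.trans hξ.le
  have hmass := mass_eq_two (by linarith [hB.one_lt]) hM hξ
  -- Integrability is not part of the normalization, but a nonzero Bochner integral implies it.
  have hint : IntegrableOn (fun z => P.ρ z * (((ξ 0 * M.φ ξ z + ξ 1 * M.θ ξ z) / ‖ξ‖) ^ 2
      + M.ψ ξ z ^ 2)) P.layers := by
    by_contra hcon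
    rw [integral_undef hcon] at hmass
    norm_num at hmass
  have hmode := hM.mode ξ hξ
  have hpt : ∀ z ∈ P.layers, P.amp M ξ z ^ 2 ≤ k * (P.ρ z *
      (((ξ 0 * M.φ ξ z + ξ 1 * M.θ ξ z) / ‖ξ‖) ^ 2 + M.ψ ξ z ^ 2)) := by
    intro z hz
    set Φ := (ξ 0 * M.φ ξ z + ξ 1 * M.θ ξ z) / ‖ξ‖
    have hρ := rho_pos hz
    have hl := hM.lam_pos _ hξ
    have hD : 0 < M.lam ‖ξ‖ ^ 2 + 4 * P.om ^ 2 := by positivity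
    -- Solving the horizontal equation for the flux. The coefficient (λ² + 4ω²)/|ξ| is at most g +
    -- 4ω², by λ² ≤ g|ξ| and |ξ| ≥ 1, so the normalized quantities control σ pointwise and uniformly
    -- in ξ.
    have hσ : P.sig M ξ z = P.g * P.ρ z * M.ψ ξ z
        - (M.lam ‖ξ‖ ^ 2 + 4 * P.om ^ 2) / ‖ξ‖ * P.ρ z * Φ := by
      have h1 := hmode.horizontal_eq hl hz
      have h2 : Φ = ‖ξ‖ / (M.lam ‖ξ‖ ^ 2 + 4 * P.om ^ 2) * (P.g * M.ψ ξ z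
          - P.sig M ξ z / P.ρ z) := by
        simp only [Φ]
        rw [h1, sig]
        field_simp
      rw [h2]
      field_simp
      ring
    set d := (M.lam ‖ξ‖ ^ 2 + 4 * P.om ^ 2) / ‖ξ‖
    have hd0 : 0 ≤ d := by positivity
    have hd : d ≤ P.g + 4 * P.om ^ 2 := by
      simp only [d]
      rw [div_le_iff₀ hr]
      have := hB.lam_sq_le hM hξ
      nlinarith [sq_nonneg P.om]
    have hd2 : d ^ 2 ≤ (P.g + 4 * P.om ^ 2) ^ 2 := by gcongr
    have s1 : P.amp M ξ z ^ 2 ≤ 2 * (M.ψ ξ z ^ 2 + P.sig M ξ z ^ 2) := by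
      rw [amp]
      nlinarith [sq_nonneg (|M.ψ ξ z| - |P.sig M ξ z|), sq_abs (M.ψ ξ z), sq_abs (P.sig M ξ z)]
    have s2 : P.sig M ξ z ^ 2 ≤ 2 * (P.g * P.ρ z * M.ψ ξ z) ^ 2 + 2 * (d * P.ρ z * Φ) ^ 2 := by
      rw [hσ]; nlinarith [sq_nonneg (P.g * P.ρ z * M.ψ ξ z + d * P.ρ z * Φ)]
    have s3 : M.ψ ξ z ^ 2 ≤ P.rhoMin⁻¹ * (P.ρ z * M.ψ ξ z ^ 2) := by
      rw [← mul_assoc]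
      refine le_mul_of_one_le_left (sq_nonneg _) ?_
      rw [inv_mul_eq_div, one_le_div ha]
      exact rhoMin_le hz
    have s4 : (P.g * P.ρ z * M.ψ ξ z) ^ 2 ≤ P.g ^ 2 * P.rhoMax * (P.ρ z * M.ψ ξ z ^ 2) := by
      have := le_rhoMax hz
      calc _ = P.g ^ 2 * P.ρ z * (P.ρ z * M.ψ ξ z ^ 2) := by ring
        _ ≤ _ := by gcongr
    have s5 : (d * P.ρ z * Φ) ^ 2 ≤ (P.g + 4 * P.om ^ 2) ^ 2 * P.rhoMax * (P.ρ z * Φ ^ 2) := by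
      have := le_rhoMax hz
      calc _ = d ^ 2 * P.ρ z * (P.ρ z * Φ ^ 2) := by ring
        _ ≤ _ := by gcongr
    have t1 : 0 ≤ P.ρ z * Φ ^ 2 := by positivity
    have t2 : 0 ≤ P.ρ z * M.ψ ξ z ^ 2 := by positivity
    have t3 : k * (P.ρ z * (Φ ^ 2 + M.ψ ξ z ^ 2)) = k * (P.ρ z * Φ ^ 2)
        + k * (P.ρ z * M.ψ ξ z ^ 2) := by ring
    have t4 : 4 * (P.g + 4 * P.om ^ 2) ^ 2 * P.rhoMax * (P.ρ z * Φ ^ 2)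
        ≤ k * (P.ρ z * Φ ^ 2) := by
      refine mul_le_mul_of_nonneg_right ?_ t1
      simp only [k]
      have : 0 ≤ 2 * P.rhoMin⁻¹ + 4 * P.g ^ 2 * P.rhoMax := by positivity
      linarith
    have t5 : (2 * P.rhoMin⁻¹ + 4 * P.g ^ 2 * P.rhoMax) * (P.ρ z * M.ψ ξ z ^ 2)
        ≤ k * (P.ρ z * M.ψ ξ z ^ 2) := by
      refine mul_le_mul_of_nonneg_right ?_ t2
      simp only [k]
      have : 0 ≤ 4 * (P.g + 4 * P.om ^ 2) ^ 2 * P.rhoMax := by positivity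
      linarith
    rw [t3]
    linarith
  have hampc : ContinuousOn (fun z => P.amp M ξ z ^ 2) P.layers :=
    (hmode.smooth_ψ.continuousOn.abs.add hmode.contDiffOn_flux.continuousOn.abs).pow 2
  have hI : IntegrableOn (fun z => P.amp M ξ z ^ 2) P.layers := by
    refine Integrable.mono' (hint.const_mul k)
      (hampc.aestronglyMeasurable P.measurableSet_layers)
      ((ae_restrict_iff' P.measurableSet_layers).2 (Eventually.of_forall fun z hz => ?_))
    rw [Real.norm_of_nonneg (sq_nonneg _)]
    exact hpt z hz
  refine ⟨hI, ?_⟩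
  rw [← hmass, ← integral_const_mul]
  exact setIntegral_mono_on hI (hint.const_mul k) P.measurableSet_layers hpt

end Config

/-! ### Pointwise bounds for the modes on bounded sets of frequencies. -/

namespace Config

variable {P : Config} {R₀ c : ℝ} {M : ModeFamily}

lemma odeBound_le_of_le {x : ℝ × ℝ} {A : ℝ} (h1 : |x.1| ≤ A) (h2 : |x.2| ≤ A) :
    P.odeBound x ≤ P.odeBound (A, A) := by
  have hg := P.g_pos
  have hb := P.rhoMax_pos
  have ha := P.rhoMin_pos
  have hA : 0 ≤ A := (abs_nonneg _).trans h1
  unfold odeBound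
  rw [abs_of_nonneg hA]
  gcongr

/-- On a layer the size of a solution is controlled by its mean square. -/
lemma sq_le_integral_of_deriv_le {a b K : ℝ} (hab : a < b) {w w' : ℝ → ℝ}
    (hd : ∀ z ∈ Ioo a b, HasDerivAt w (w' z) z) (hK : ∀ z ∈ Ioo a b, |w' z| ≤ K * w z)
    (h0 : ∀ z ∈ Ioo a b, 0 ≤ w z) (hi : IntegrableOn w (Ioo a b)) (hK0 : 0 ≤ K) {z : ℝ}
    (hz : z ∈ Ioo a b) :
    w z * (b - a) ≤ Real.exp (K * (b - a)) * ∫ ζ in Ioo a b, w ζ := by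
  have hcon : Convex ℝ (Ioo a b) := convex_Ioo a b
  have hint : interior (Ioo a b) = Ioo a b := interior_Ioo
  have hwc : ContinuousOn w (Ioo a b) := fun z hz => (hd z hz).continuousAt.continuousWithinAt
  have hexp : ∀ k z : ℝ, HasDerivAt (fun z => Real.exp (k * z)) (Real.exp (k * z) * k) z := by
    intro k z
    simpa using ((hasDerivAt_id z).const_mul k).exp
  have hup : MonotoneOn (fun z => Real.exp (K * z) * w z) (Ioo a b) := by
    refine monotoneOn_of_deriv_nonneg hcon
      ((by fun_prop : Continuous fun z => Real.exp (K * z)).continuousOn.mul hwc) ?_ ?_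
    · rw [hint]
      exact fun z hz => ((hexp K z).mul (hd z hz)).differentiableAt.differentiableWithinAt
    · rw [hint]
      intro z hz
      have e := ((hexp K z).mul (hd z hz)).deriv
      have e' : deriv (fun z => Real.exp (K * z) * w z) z = _ := e
      rw [e', mul_assoc, ← mul_add]
      have := neg_abs_le (w' z)
      have := hK z hz
      exact mul_nonneg (Real.exp_pos _).le (by linarith)
  have hdown : AntitoneOn (fun z => Real.exp (-K * z) * w z) (Ioo a b) := by
    refine antitoneOn_of_deriv_nonpos hcon
      ((by fun_prop : Continuous fun z => Real.exp (-K * z)).continuousOn.mul hwc) ?_ ?_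
    · rw [hint]
      exact fun z hz => ((hexp (-K) z).mul (hd z hz)).differentiableAt.differentiableWithinAt
    · rw [hint]
      intro z hz
      have e := ((hexp (-K) z).mul (hd z hz)).deriv
      have e' : deriv (fun z => Real.exp (-K * z) * w z) z = _ := e
      rw [e', mul_assoc, ← mul_add]
      have := le_abs_self (w' z)
      have := hK z hz
      exact mul_nonpos_of_nonneg_of_nonpos (Real.exp_pos _).le (by linarith)
  -- A Harnack inequality: |w'| ≤ Kw makes any two values comparable. Averaging over ζ then replaces
  -- w(ζ) by the mean.
  have hpt : ∀ ζ ∈ Ioo a b, w z ≤ Real.exp (K * (b - a)) * w ζ := by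
    intro ζ hζ
    rcases le_total z ζ with h | h
    · have h1 := hup hz hζ h
      simp only at h1
      have h2 : w z ≤ Real.exp (K * (ζ - z)) * w ζ := by
        have : Real.exp (K * (ζ - z)) = Real.exp (K * ζ) / Real.exp (K * z) := by
          rw [← Real.exp_sub]; ring_nf
        rw [this, div_mul_eq_mul_div, le_div_iff₀ (Real.exp_pos _), mul_comm]
        exact h1
      refine h2.trans (mul_le_mul_of_nonneg_right (Real.exp_le_exp.2 ?_) (h0 ζ hζ))
      exact mul_le_mul_of_nonneg_left (by linarith [hz.1, hζ.2]) hK0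
    · have h1 := hdown hζ hz h
      simp only at h1
      have h2 : w z ≤ Real.exp (K * (z - ζ)) * w ζ := by
        have : Real.exp (K * (z - ζ)) = Real.exp (-K * ζ) / Real.exp (-K * z) := by
          rw [← Real.exp_sub]; ring_nf
        rw [this, div_mul_eq_mul_div, le_div_iff₀ (Real.exp_pos _), mul_comm]
        exact h1
      refine h2.trans (mul_le_mul_of_nonneg_right (Real.exp_le_exp.2 ?_) (h0 ζ hζ))
      exact mul_le_mul_of_nonneg_left (by linarith [hz.2, hζ.1]) hK0
  have hle := setIntegral_mono_on (integrableOn_const (by simp)) (hi.const_mul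
    (Real.exp (K * (b - a)))) measurableSet_Ioo (f := fun _ => w z) hpt
  rw [integral_const_mul, setIntegral_const] at hle
  simpa [Real.volume_real_Ioo_of_le hab.le, mul_comm] using hle

/-- Locally uniform bound for the size of the modes. -/
lemma exists_amp_le (hB : P.GrowthBounds R₀ c) (hM : P.IsNormalModeFamily R₀ M) (B : ℝ) :
    ∃ C, ∀ ξ, R₀ < ‖ξ‖ → ‖ξ‖ ≤ B → ∀ z ∈ P.layers, P.amp M ξ z ≤ C := by
  obtain ⟨C, hC, hamp⟩ := exists_amp_bound hB
  have hg := P.g_pos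
  have hc := hB.pos
  -- A bounds both parameters λ² and μ for |ξ| ≤ B, so the coefficients of the system are bounded by
  -- one k. The resulting constant depends on B, which suffices because f has compact support.
  set A := max (P.g * B) (c⁻¹ * B)
  set k := P.odeBound (A, A)
  have hk : 0 ≤ k := odeBound_nonneg _
  have key : ∀ a b, a < b → Ioo a b ⊆ P.layers → ∃ D, ∀ ξ, R₀ < ‖ξ‖ → ‖ξ‖ ≤ B →
      ∀ z ∈ Ioo a b, P.amp M ξ z ≤ D := by
    intro a b hab hI
    refine ⟨√(2 * (Real.exp (4 * k * (b - a)) * C / (b - a))), fun ξ hξ hξB z hz => ?_⟩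
    have hmode := hM.mode ξ hξ
    have hl := hM.lam_pos _ hξ
    have hr := hB.pos_of_lt hξ
    obtain ⟨hAi, hAb⟩ := hamp M hM ξ hξ
    set x := P.par ‖ξ‖ (M.lam ‖ξ‖ ^ 2)
    have hx : P.odeBound x ≤ k := by
      refine odeBound_le_of_le ?_ ?_
      · simp only [x, par]
        rw [abs_of_nonneg (sq_nonneg _)]
        exact (hB.lam_sq_le hM hξ).trans ((mul_le_mul_of_nonneg_left hξB hg.le).trans
          (le_max_left _ _))
      · simp only [x, par]
        rw [abs_of_nonneg (by positivity)]
        exact (hB.mu_le hM hξ).trans ((mul_le_mul_of_nonneg_left hξB (by positivity)).trans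
          (le_max_right _ _))
    have hle : ∀ z, M.ψ ξ z ^ 2 + P.sig M ξ z ^ 2 ≤ P.amp M ξ z ^ 2 := by
      intro z
      have h1 := abs_nonneg (M.ψ ξ z)
      have h2 := abs_nonneg (P.sig M ξ z)
      rw [amp, ← sq_abs (M.ψ ξ z), ← sq_abs (P.sig M ξ z)]
      nlinarith
    have hge : ∀ z, P.amp M ξ z ^ 2 ≤ 2 * (M.ψ ξ z ^ 2 + P.sig M ξ z ^ 2) := by
      intro z
      rw [amp]
      nlinarith [sq_nonneg (|M.ψ ξ z| - |P.sig M ξ z|), sq_abs (M.ψ ξ z), sq_abs (P.sig M ξ z)]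
    have hd : ∀ z ∈ Ioo a b, HasDerivAt (fun z => M.ψ ξ z ^ 2 + P.sig M ξ z ^ 2)
        (2 * (M.ψ ξ z * P.rhsPsi x (M.ψ ξ z, P.sig M ξ z) z
          + P.sig M ξ z * P.rhsSigma x (M.ψ ξ z, P.sig M ξ z) z)) z := by
      intro z hz
      refine (((hmode.hasDerivAt_psi hl (hI hz)).pow 2).add
        ((hmode.hasDerivAt_flux hl (hI hz)).pow 2)).congr_deriv ?_
      simp only [sig, x]
      ring
    have hcs : ContinuousOn (fun z => M.ψ ξ z ^ 2 + P.sig M ξ z ^ 2) (Ioo a b) :=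
      fun z hz => (hd z hz).continuousAt.continuousWithinAt
    have hi : IntegrableOn (fun z => M.ψ ξ z ^ 2 + P.sig M ξ z ^ 2) (Ioo a b) := by
      refine Integrable.mono' (hAi.mono_set hI) (hcs.aestronglyMeasurable measurableSet_Ioo)
        (Eventually.of_forall fun z => ?_)
      rw [Real.norm_of_nonneg (by positivity)]
      exact hle z
    have h1 := sq_le_integral_of_deriv_le hab hd (K := 4 * k) (fun z hz => ?_)
      (fun z _ => by positivity) hi (by positivity) hz
    · have h2 : ∫ ζ in Ioo a b, (M.ψ ξ ζ ^ 2 + P.sig M ξ ζ ^ 2) ≤ C := by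
        refine (setIntegral_mono_on hi (hAi.mono_set hI) measurableSet_Ioo fun z _ => hle z).trans ?_
        exact (setIntegral_mono_set hAi (Eventually.of_forall fun z => sq_nonneg _)
          hI.eventuallyLE).trans hAb
      refine Real.le_sqrt_of_sq_le ((hge z).trans ?_)
      have h3 : M.ψ ξ z ^ 2 + P.sig M ξ z ^ 2 ≤ Real.exp (4 * k * (b - a)) * C / (b - a) := by
        rw [le_div_iff₀ (by linarith)]
        exact h1.trans (mul_le_mul_of_nonneg_left h2 (Real.exp_pos _).le)
      linarith
    · set Y : ℝ × ℝ := (M.ψ ξ z, P.sig M ξ z)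
      have hn : ‖Y‖ ^ 2 ≤ M.ψ ξ z ^ 2 + P.sig M ξ z ^ 2 := by
        rw [Prod.norm_def, Real.norm_eq_abs, Real.norm_eq_abs]
        rcases max_choice |Y.1| |Y.2| with h | h <;> rw [h, sq_abs]
        · exact le_add_of_nonneg_right (sq_nonneg _)
        · exact le_add_of_nonneg_left (sq_nonneg _)
      have b1 := (abs_rhsPsi_le x Y (hI hz)).trans
        (mul_le_mul_of_nonneg_right hx (norm_nonneg Y))
      have b2 := (abs_rhsSigma_le x Y (hI hz)).trans
        (mul_le_mul_of_nonneg_right hx (norm_nonneg Y))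
      have n1 : |M.ψ ξ z * P.rhsPsi x Y z| ≤ k * ‖Y‖ ^ 2 := by
        rw [abs_mul]
        calc _ ≤ ‖Y‖ * (k * ‖Y‖) :=
              mul_le_mul (norm_fst_le Y) b1 (abs_nonneg _) (norm_nonneg _)
          _ = _ := by ring
      have n2 : |P.sig M ξ z * P.rhsSigma x Y z| ≤ k * ‖Y‖ ^ 2 := by
        rw [abs_mul]
        calc _ ≤ ‖Y‖ * (k * ‖Y‖) :=
              mul_le_mul (norm_snd_le Y) b2 (abs_nonneg _) (norm_nonneg _)
          _ = _ := by ring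
      rw [abs_mul, abs_two]
      have n3 := abs_add_le (M.ψ ξ z * P.rhsPsi x Y z) (P.sig M ξ z * P.rhsSigma x Y z)
      have n4 := mul_le_mul_of_nonneg_left hn hk
      linarith
  obtain ⟨D, hD⟩ := key 0 P.l P.l_pos subset_union_right
  obtain ⟨D', hD'⟩ := key (-P.m) 0 (by linarith [P.m_pos]) subset_union_left
  refine ⟨max D D', fun ξ h1 h2 z hz => ?_⟩
  rcases hz with hz | hz
  · exact (hD' ξ h1 h2 z hz).trans (le_max_right _ _)
  · exact (hD ξ h1 h2 z hz).trans (le_max_left _ _)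

/-! ### Kernels -/

/-- Amplitudes that are smooth in the vertical variable, with bounded derivatives, and supported in
the ball of radius `B` of the frequency plane. -/
structure IsKernel (P : Config) (B : ℝ) (a : Plane → ℝ → ℝ) : Prop where
  meas : ∀ z ∈ P.layers, Measurable fun ξ => a ξ z
  smooth : ∀ ξ, ContDiffOn ℝ ∞ (a ξ) P.layers
  bound : ∀ n, ∃ C, ∀ ξ, ∀ z ∈ P.layers, |iteratedDeriv n (a ξ) z| ≤ C
  supp : ∀ ξ, B < ‖ξ‖ → ∀ z, a ξ z = 0

variable {B : ℝ} {a : Plane → ℝ → ℝ}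

lemma contDiffOn_deriv_layers {u : ℝ → ℝ} (h : ContDiffOn ℝ ∞ u P.layers) :
    ContDiffOn ℝ ∞ (deriv u) P.layers :=
  ((contDiffOn_infty_iff_deriv_of_isOpen P.isOpen_layers).1 h).2

/-- A limit of measurable difference quotients; N is chosen so large that the shifted points stay in
the layers. -/
lemma measurable_deriv_param (hm : ∀ z ∈ P.layers, Measurable fun ξ => a ξ z)
    (hs : ∀ ξ, ContDiffOn ℝ ∞ (a ξ) P.layers) {z : ℝ} (hz : z ∈ P.layers) :
    Measurable fun ξ => deriv (a ξ) z := by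
  obtain ⟨ε, hε, hball⟩ := Metric.isOpen_iff.1 P.isOpen_layers z hz
  obtain ⟨N, hN⟩ := exists_nat_gt ε⁻¹
  have hu : ∀ n : ℕ, z + ((n : ℝ) + N + 1)⁻¹ ∈ P.layers := by
    intro n
    have hε' : 0 < ε⁻¹ := inv_pos.2 hε
    have hpos : 0 < (n : ℝ) + N + 1 := by positivity
    refine hball ?_
    rw [Metric.mem_ball, Real.dist_eq, add_sub_cancel_left, abs_of_pos (inv_pos.2 hpos)]
    refine inv_lt_of_inv_lt₀ hε ?_
    have : (0 : ℝ) ≤ n := Nat.cast_nonneg n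
    linarith
  have hlim : Tendsto (fun n : ℕ => ((n : ℝ) + N + 1)⁻¹) atTop (𝓝[≠] 0) := by
    refine tendsto_nhdsWithin_iff.2 ⟨tendsto_inv_atTop_zero.comp ?_, Eventually.of_forall
      fun n => ?_⟩
    · exact tendsto_atTop_add_const_right _ _ (tendsto_atTop_add_const_right _ _
        tendsto_natCast_atTop_atTop)
    · have : (0 : ℝ) < (n : ℝ) + N + 1 := by positivity
      exact (inv_pos.2 this).ne'
  refine measurable_of_tendsto_metrizable
    (f := fun (n : ℕ) ξ => (((n : ℝ) + N + 1)⁻¹)⁻¹ • (a ξ (z + ((n : ℝ) + N + 1)⁻¹) - a ξ z))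
    (fun n => ((hm _ (hu n)).sub (hm z hz)).const_mul _) ?_
  rw [tendsto_pi_nhds]
  intro ξ
  have hd := (((hs ξ).differentiableOn (by simp)).differentiableAt
    (P.isOpen_layers.mem_nhds hz)).hasDerivAt
  exact (hasDerivAt_iff_tendsto_slope_zero.1 hd).comp hlim

lemma IsKernel.vderiv (h : P.IsKernel B a) : P.IsKernel B fun ξ => deriv (a ξ) where
  meas _ hz := measurable_deriv_param h.meas h.smooth hz
  smooth ξ := contDiffOn_deriv_layers (h.smooth ξ)
  bound n := by
    obtain ⟨C, hC⟩ := h.bound (n + 1)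
    exact ⟨C, fun ξ z hz => by rw [← iteratedDeriv_succ']; exact hC ξ z hz⟩
  supp ξ hξ z := by
    have : a ξ = fun _ => 0 := funext (h.supp ξ hξ)
    rw [this]; simp

lemma iteratedDeriv_const_mul_field' (n : ℕ) (b : ℝ) (u : ℝ → ℝ) (z : ℝ) :
    iteratedDeriv n (fun z => b * u z) z = b * iteratedDeriv n u z := by
  induction n generalizing u with
  | zero => simp
  | succ n ih =>
    rw [iteratedDeriv_succ', iteratedDeriv_succ', ← ih]
    congr 1
    funext w
    exact deriv_const_mul_field b

lemma IsKernel.mul (h : P.IsKernel B a) {b : Plane → ℝ} (hb : Measurable b) {D : ℝ}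
    (hD : ∀ ξ, ‖ξ‖ ≤ B → |b ξ| ≤ D) : P.IsKernel B fun ξ z => b ξ * a ξ z where
  meas z hz := hb.mul (h.meas z hz)
  smooth ξ := contDiffOn_const.mul (h.smooth ξ)
  bound n := by
    obtain ⟨C, hC⟩ := h.bound n
    refine ⟨|D| * |C|, fun ξ z hz => ?_⟩
    rw [iteratedDeriv_const_mul_field', abs_mul]
    rcases le_or_gt ‖ξ‖ B with hξ | hξ
    · exact mul_le_mul ((hD ξ hξ).trans (le_abs_self D)) ((hC ξ z hz).trans (le_abs_self C))
        (abs_nonneg _) (abs_nonneg _)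
    · have : a ξ = fun _ => 0 := funext (h.supp ξ hξ)
      rw [this]
      have e : iteratedDeriv n (fun _ : ℝ => (0 : ℝ)) z = 0 := by
        simp
      rw [e, abs_zero, mul_zero]
      positivity
  supp ξ hξ z := by rw [h.supp ξ hξ z, mul_zero]

/-- A function of the mode times a compactly supported cut-off is a kernel. -/
lemma IsModeFunction.isKernel {h : ModeFamily → Plane → ℝ → ℝ} (H : P.IsModeFunction R₀ h)
    (hB : P.GrowthBounds R₀ c) (hM : P.IsNormalModeFamily R₀ M)
    (hm : ∀ z ∈ P.layers, Measurable fun ξ => h M ξ z) (hs : ∀ ξ, ContDiffOn ℝ ∞ (h M ξ) P.layers)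
    (h0 : ∀ ξ, ‖ξ‖ ≤ R₀ → ∀ z, h M ξ z = 0) {f : Plane → ℝ} (hf : Continuous f)
    (hsupp : ∀ ξ, B < ‖ξ‖ → f ξ = 0) : P.IsKernel B fun ξ z => f ξ * h M ξ z where
  meas z hz := hf.measurable.mul (hm z hz)
  smooth ξ := contDiffOn_const.mul (hs ξ)
  bound n := by
    obtain ⟨C, hC, hb⟩ := H.bound hB n
    obtain ⟨A, hA⟩ := exists_amp_le hB hM B
    obtain ⟨D, hD⟩ := (isCompact_closedBall (0 : Plane) B).exists_bound_of_continuousOn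
      hf.continuousOn
    refine ⟨|D| * (C * |B| ^ n * |A|), fun ξ z hz => ?_⟩
    rw [iteratedDeriv_const_mul_field', abs_mul]
    rcases le_or_gt ‖ξ‖ B with hξ | hξ
    · have e1 : |f ξ| ≤ |D| := (hD ξ (by simpa using hξ)).trans (le_abs_self D)
      rcases le_or_gt ‖ξ‖ R₀ with hR | hR
      · have : h M ξ = fun _ => 0 := funext (h0 ξ hR)
        rw [this]
        have e : iteratedDeriv n (fun _ : ℝ => (0 : ℝ)) z = 0 := by simp
        rw [e, abs_zero, mul_zero]
        positivity
      · refine mul_le_mul e1 ((hb M hM ξ hR z hz).trans ?_) (abs_nonneg _) (abs_nonneg _)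
        have e2 := (hA ξ hR hξ z hz).trans (le_abs_self A)
        have e3 : ‖ξ‖ ≤ |B| := hξ.trans (le_abs_self B)
        have := amp_nonneg (P := P) (M := M) ξ z
        gcongr
    · rw [hsupp ξ hξ, abs_zero, zero_mul]
      positivity
  supp ξ hξ z := by rw [hsupp ξ hξ, zero_mul]

end Config

/-! ### Superpositions of real plane waves and their derivatives. -/

namespace Config

variable {P : Config} {B D : ℝ} {L : Plane → ℝ} {a : Plane → ℝ → ℝ}

/-- Measurable growth rates that are bounded by `D` on the ball of radius `B`. -/
structure IsRate (B D : ℝ) (L : Plane → ℝ) : Prop where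
  meas : Measurable L
  bound : ∀ ξ, ‖ξ‖ ≤ B → |L ξ| ≤ D

/-- The real plane wave with amplitude `a` and growth rate `L` at the point `y = (t,x,z)`. -/
def wave (L : Plane → ℝ) (a : Plane → ℝ → ℝ) (β : ℝ) (y : ℝ × Plane × ℝ) (ξ : Plane) : ℝ :=
  a ξ y.2.2 * (Real.exp (L ξ * y.1) * Real.cos (inner ℝ y.2.1 ξ + β))

/-- Superposition of plane waves. -/
def synthR (L : Plane → ℝ) (a : Plane → ℝ → ℝ) (β t : ℝ) (x : Plane) (z : ℝ) : ℝ :=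
  (4 * Real.pi ^ 2)⁻¹ * ∫ ξ, wave L a β (t, x, z) ξ

/-- Compact support in frequency gives a dominating function that is uniform over bounded times and
all positions in the layers. Bounds of this kind justify all limits and derivatives under the
integral. -/
lemma IsKernel.abs_wave_le (ha : P.IsKernel B a) (hL : IsRate B D L) {C T : ℝ}
    (hC : ∀ ξ, ∀ z ∈ P.layers, |a ξ z| ≤ C) (β : ℝ) {y : ℝ × Plane × ℝ} (hz : y.2.2 ∈ P.layers)
    (ht : |y.1| ≤ T) (ξ : Plane) :
    |wave L a β y ξ| ≤ (Metric.closedBall (0 : Plane) B).indicator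
      (fun _ => C * Real.exp (D * T)) ξ := by
  by_cases hξ : ‖ξ‖ ≤ B
  · rw [indicator_of_mem (by simpa using hξ), wave, abs_mul, abs_mul, Real.abs_exp]
    have h1 := hC ξ _ hz
    have h2 : L ξ * y.1 ≤ D * T := by
      refine (le_abs_self _).trans ?_
      rw [abs_mul]
      have := hL.bound ξ hξ
      exact mul_le_mul this ht (abs_nonneg _) ((abs_nonneg _).trans this)
    have h3 := Real.abs_cos_le_one (inner ℝ y.2.1 ξ + β)
    calc _ ≤ C * (Real.exp (D * T) * 1) := by
          refine mul_le_mul h1 ?_ (by positivity) ((abs_nonneg _).trans h1)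
          gcongr
      _ = _ := by ring
  · rw [indicator_of_notMem (by simpa using hξ), wave, ha.supp ξ (not_le.1 hξ)]
    simp

lemma integrable_indicator_ball (B C : ℝ) :
    Integrable ((Metric.closedBall (0 : Plane) B).indicator fun _ => C) :=
  (integrableOn_const (by exact measure_closedBall_lt_top.ne)).integrable_indicator
    measurableSet_closedBall

lemma IsKernel.measurable_wave (ha : P.IsKernel B a) (hL : IsRate B D L) (β : ℝ)
    {y : ℝ × Plane × ℝ} (hz : y.2.2 ∈ P.layers) : Measurable (wave L a β y) := by
  have h1 := ha.meas _ hz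
  have h2 := hL.meas
  unfold wave
  refine h1.mul ((h2.mul_const _).exp.mul ?_)
  fun_prop

lemma IsKernel.integrable_wave (ha : P.IsKernel B a) (hL : IsRate B D L) (β : ℝ)
    {y : ℝ × Plane × ℝ} (hz : y.2.2 ∈ P.layers) : Integrable (wave L a β y) := by
  obtain ⟨C, hC⟩ := ha.bound 0
  exact Integrable.mono' (integrable_indicator_ball B _)
    (ha.measurable_wave hL β hz).aestronglyMeasurable
    (Eventually.of_forall (ha.abs_wave_le hL (by simpa using hC) β hz le_rfl))

/-- The derivative of a plane wave in time and space. -/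
def waveDeriv (L : Plane → ℝ) (a : Plane → ℝ → ℝ) (β : ℝ) (y : ℝ × Plane × ℝ) (ξ : Plane) :
    ℝ × Plane × ℝ →L[ℝ] ℝ :=
  wave L (fun ξ z => L ξ * a ξ z) β y ξ • ContinuousLinearMap.fst ℝ ℝ (Plane × ℝ)
    + wave L a (β + Real.pi / 2) y ξ • (innerSL ℝ ξ).comp
        ((ContinuousLinearMap.fst ℝ Plane ℝ).comp (ContinuousLinearMap.snd ℝ ℝ (Plane × ℝ)))
    + wave L (fun ξ => deriv (a ξ)) β y ξ •
        (ContinuousLinearMap.snd ℝ Plane ℝ).comp (ContinuousLinearMap.snd ℝ ℝ (Plane × ℝ))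

lemma IsKernel.rate_mul (ha : P.IsKernel B a) (hL : IsRate B D L) :
    P.IsKernel B fun ξ z => L ξ * a ξ z :=
  ha.mul hL.meas hL.bound

lemma IsKernel.coord_mul (ha : P.IsKernel B a) (j : Fin 2) :
    P.IsKernel B fun ξ z => ξ j * a ξ z :=
  ha.mul (by fun_prop) fun ξ hξ => (abs_coord_le ξ j).trans hξ

/-- Time derivatives multiply the amplitude by L, vertical ones differentiate it, and horizontal
ones multiply it by ξ_j while advancing the phase by π/2. Waves are thus closed under
differentiation. -/
lemma IsKernel.hasFDerivAt_wave (ha : P.IsKernel B a) (β : ℝ)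
    {y : ℝ × Plane × ℝ} (hz : y.2.2 ∈ P.layers) (ξ : Plane) :
    HasFDerivAt (fun y => wave L a β y ξ) (waveDeriv L a β y ξ) y := by
  have h1 : HasFDerivAt (fun y : ℝ × Plane × ℝ => y.1)
      (ContinuousLinearMap.fst ℝ ℝ (Plane × ℝ)) y := hasFDerivAt_fst
  have h2 : HasFDerivAt (fun y : ℝ × Plane × ℝ => inner ℝ y.2.1 ξ) ((innerSL ℝ ξ).comp
      ((ContinuousLinearMap.fst ℝ Plane ℝ).comp (ContinuousLinearMap.snd ℝ ℝ (Plane × ℝ)))) y := by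
    have := ((innerSL ℝ ξ).comp ((ContinuousLinearMap.fst ℝ Plane ℝ).comp
      (ContinuousLinearMap.snd ℝ ℝ (Plane × ℝ)))).hasFDerivAt (x := y)
    refine this.congr_of_eventuallyEq (Eventually.of_forall fun y => ?_)
    simp [real_inner_comm]
  have h3 : HasFDerivAt (fun y : ℝ × Plane × ℝ => y.2.2) ((ContinuousLinearMap.snd ℝ Plane ℝ).comp
      (ContinuousLinearMap.snd ℝ ℝ (Plane × ℝ))) y :=
    ((ContinuousLinearMap.snd ℝ Plane ℝ).comp
      (ContinuousLinearMap.snd ℝ ℝ (Plane × ℝ))).hasFDerivAt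
  have h4 := ((((ha.smooth ξ).differentiableOn (by simp)).differentiableAt
    (P.isOpen_layers.mem_nhds hz)).hasDerivAt).comp_hasFDerivAt y h3
  refine (h4.mul ((h1.const_mul (L ξ)).exp.mul (h2.add_const β).cos)).congr_fderiv ?_
  ext v
  · simp [waveDeriv, wave]
    ring
  · simp [waveDeriv, wave, Real.cos_add_pi_div_two, ← add_assoc]
    ring
  · simp [waveDeriv, wave]
    ring

lemma IsKernel.measurable_waveDeriv (ha : P.IsKernel B a) (hL : IsRate B D L) (β : ℝ)
    {y : ℝ × Plane × ℝ} (hz : y.2.2 ∈ P.layers) :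
    AEStronglyMeasurable (waveDeriv L a β y) := by
  have h1 := ((ha.rate_mul hL).measurable_wave hL β hz).aestronglyMeasurable (μ := volume)
  have h2 := (ha.measurable_wave hL (β + Real.pi / 2) hz).aestronglyMeasurable (μ := volume)
  have h3 := (ha.vderiv.measurable_wave hL β hz).aestronglyMeasurable (μ := volume)
  refine ((h1.smul_const _).add (h2.smul ?_)).add (h3.smul_const _)
  refine Continuous.aestronglyMeasurable ?_
  exact (innerSL ℝ).continuous.clm_comp continuous_const

lemma IsKernel.exists_waveDeriv_bound (ha : P.IsKernel B a) (hL : IsRate B D L) (β T : ℝ) :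
    ∃ K, ∀ y : ℝ × Plane × ℝ, y.2.2 ∈ P.layers → |y.1| ≤ T → ∀ ξ,
      ‖waveDeriv L a β y ξ‖ ≤ (Metric.closedBall (0 : Plane) B).indicator (fun _ => K) ξ := by
  obtain ⟨C, hC⟩ := ha.bound 0
  obtain ⟨C', hC'⟩ := (ha.rate_mul hL).bound 0
  obtain ⟨C'', hC''⟩ := ha.vderiv.bound 0
  set e := Real.exp (D * T)
  refine ⟨C' * e + C * e * B + C'' * e, fun y hz ht ξ => ?_⟩
  have b1 := (ha.rate_mul hL).abs_wave_le hL (by simpa using hC') β hz ht ξ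
  have b2 := ha.abs_wave_le hL (by simpa using hC) (β + Real.pi / 2) hz ht ξ
  have b3 := ha.vderiv.abs_wave_le hL (by simpa using hC'') β hz ht ξ
  by_cases hξ : ‖ξ‖ ≤ B
  · rw [indicator_of_mem (by simpa using hξ)] at b1 b2 b3 ⊢
    have n1 := ContinuousLinearMap.norm_fst_le ℝ ℝ (Plane × ℝ)
    have n2 : ‖(innerSL ℝ ξ).comp ((ContinuousLinearMap.fst ℝ Plane ℝ).comp
        (ContinuousLinearMap.snd ℝ ℝ (Plane × ℝ)))‖ ≤ B := by
      refine ContinuousLinearMap.opNorm_le_bound _ ((norm_nonneg _).trans hξ) fun v => ?_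
      refine (norm_inner_le_norm ξ v.2.1).trans ?_
      exact mul_le_mul hξ ((norm_fst_le v.2).trans (norm_snd_le v)) (norm_nonneg _)
        ((norm_nonneg _).trans hξ)
    have n3 : ‖(ContinuousLinearMap.snd ℝ Plane ℝ).comp
        (ContinuousLinearMap.snd ℝ ℝ (Plane × ℝ))‖ ≤ 1 := by
      refine ContinuousLinearMap.opNorm_le_bound _ zero_le_one fun v => ?_
      rw [one_mul]
      exact (norm_snd_le v.2).trans (norm_snd_le v)
    refine (norm_add₃_le).trans ?_
    rw [norm_smul, norm_smul, norm_smul]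
    simp only [Real.norm_eq_abs]
    refine add_le_add (add_le_add ?_ ?_) ?_
    · exact (mul_le_of_le_one_right (abs_nonneg _) n1).trans b1
    · exact mul_le_mul b2 n2 (norm_nonneg _) ((abs_nonneg _).trans b2)
    · exact (mul_le_of_le_one_right (abs_nonneg _) n3).trans b3
  · rw [indicator_of_notMem (by simpa using hξ)] at b1 b2 b3 ⊢
    have e1 := abs_nonpos_iff.1 b1
    have e2 := abs_nonpos_iff.1 b2
    have e3 := abs_nonpos_iff.1 b3
    rw [waveDeriv, e1, e2, e3]
    simp

lemma region_mem_nhds {y : ℝ × Plane × ℝ} (hz : y.2.2 ∈ P.layers) :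
    {y' : ℝ × Plane × ℝ | |y'.1| ≤ |y.1| + 1 ∧ y'.2.2 ∈ P.layers} ∈ 𝓝 y := by
  refine inter_mem ?_ ?_
  · have : Tendsto (fun y' : ℝ × Plane × ℝ => |y'.1|) (𝓝 y) (𝓝 |y.1|) :=
      (continuous_abs.comp continuous_fst).tendsto y
    exact this.eventually_le_const (by linarith)
  · exact (continuous_snd.comp continuous_snd).continuousAt.preimage_mem_nhds
      (P.isOpen_layers.mem_nhds hz)

lemma IsKernel.hasFDerivAt_integral (ha : P.IsKernel B a) (hL : IsRate B D L) (β : ℝ)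
    {y : ℝ × Plane × ℝ} (hz : y.2.2 ∈ P.layers) :
    HasFDerivAt (fun y => ∫ ξ, wave L a β y ξ) (∫ ξ, waveDeriv L a β y ξ) y := by
  obtain ⟨K, hK⟩ := ha.exists_waveDeriv_bound hL β (|y.1| + 1)
  refine hasFDerivAt_integral_of_dominated_of_fderiv_le (region_mem_nhds hz) ?_
    (ha.integrable_wave hL β hz) (ha.measurable_waveDeriv hL β hz)
    (Eventually.of_forall fun ξ y' hy' => hK y' hy'.2 hy'.1 ξ) (integrable_indicator_ball B K)
    (Eventually.of_forall fun ξ y' hy' => ha.hasFDerivAt_wave β hy'.2 ξ)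
  filter_upwards [region_mem_nhds hz] with y' hy'
  exact (ha.measurable_wave hL β hy'.2).aestronglyMeasurable

lemma IsKernel.continuousAt_wave (ha : P.IsKernel B a) (β : ℝ) {y : ℝ × Plane × ℝ}
    (hz : y.2.2 ∈ P.layers) (ξ : Plane) : ContinuousAt (fun y => wave L a β y ξ) y :=
  (ha.hasFDerivAt_wave β hz ξ).continuousAt

lemma IsKernel.continuousAt_integral_deriv (ha : P.IsKernel B a) (hL : IsRate B D L) (β : ℝ)
    {y : ℝ × Plane × ℝ} (hz : y.2.2 ∈ P.layers) :
    ContinuousAt (fun y => ∫ ξ, waveDeriv L a β y ξ) y := by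
  obtain ⟨K, hK⟩ := ha.exists_waveDeriv_bound hL β (|y.1| + 1)
  refine continuousAt_of_dominated ?_ ?_ (integrable_indicator_ball B K)
    (Eventually.of_forall fun ξ => ?_)
  · filter_upwards [region_mem_nhds hz] with y' hy'
    exact ha.measurable_waveDeriv hL β hy'.2
  · filter_upwards [region_mem_nhds hz] with y' hy'
    exact Eventually.of_forall (hK y' hy'.2 hy'.1)
  · exact ((((ha.rate_mul hL).continuousAt_wave β hz ξ).smul continuousAt_const).add
      ((ha.continuousAt_wave _ hz ξ).smul continuousAt_const)).add
      ((ha.vderiv.continuousAt_wave β hz ξ).smul continuousAt_const)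

lemma IsKernel.isC1 (ha : P.IsKernel B a) (hL : IsRate B D L) (β : ℝ) :
    P.IsC1 (synthR L a β) := by
  have hU : IsOpen ((univ : Set ℝ) ×ˢ ((univ : Set Plane) ×ˢ P.layers)) :=
    isOpen_univ.prod (isOpen_univ.prod P.isOpen_layers)
  have h : ContDiffOn ℝ 1 (fun y : ℝ × Plane × ℝ => ∫ ξ, wave L a β y ξ)
      ((univ : Set ℝ) ×ˢ ((univ : Set Plane) ×ˢ P.layers)) := by
    refine (contDiffOn_succ_iff_hasFDerivWithinAt_of_uniqueDiffOn (n := 0) hU.uniqueDiffOn).2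
      ⟨by simp, fun y => ∫ ξ, waveDeriv L a β y ξ, contDiffOn_zero.2 fun y hy => ?_, fun y hy => ?_⟩
    · exact (ha.continuousAt_integral_deriv hL β hy.2.2).continuousWithinAt
    · exact (ha.hasFDerivAt_integral hL β hy.2.2).hasFDerivWithinAt
  exact (contDiffOn_const.mul h).mono (prod_mono (subset_univ _) Subset.rfl)

lemma IsKernel.integrable_waveDeriv (ha : P.IsKernel B a) (hL : IsRate B D L) (β : ℝ)
    {y : ℝ × Plane × ℝ} (hz : y.2.2 ∈ P.layers) : Integrable (waveDeriv L a β y) := by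
  obtain ⟨K, hK⟩ := ha.exists_waveDeriv_bound hL β |y.1|
  exact Integrable.mono' (integrable_indicator_ball B K) (ha.measurable_waveDeriv hL β hz)
    (Eventually.of_forall (hK y hz le_rfl))

lemma IsKernel.hasDerivAt_synthR_time (ha : P.IsKernel B a) (hL : IsRate B D L) (β t : ℝ)
    (x : Plane) {z : ℝ} (hz : z ∈ P.layers) :
    HasDerivAt (fun τ => synthR L a β τ x z) (synthR L (fun ξ z => L ξ * a ξ z) β t x z) t := by
  have h1 : HasDerivAt (fun τ : ℝ => (τ, x, z)) (1, 0, 0) t :=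
    (hasDerivAt_id t).prodMk ((hasDerivAt_const t x).prodMk (hasDerivAt_const t z))
  have h2 := ((ha.hasFDerivAt_integral hL β (y := (t, x, z)) hz).comp_hasDerivAt t h1).const_mul
    (4 * Real.pi ^ 2)⁻¹
  refine h2.congr_deriv ?_
  rw [ContinuousLinearMap.integral_apply (ha.integrable_waveDeriv hL β hz), synthR]
  simp [waveDeriv]

lemma IsKernel.dt_synthR (ha : P.IsKernel B a) (hL : IsRate B D L) (β : ℝ) {t : ℝ} (ht : 0 ≤ t)
    (x : Plane) {z : ℝ} (hz : z ∈ P.layers) :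
    dt (synthR L a β) t x z = synthR L (fun ξ z => L ξ * a ξ z) β t x z :=
  (ha.hasDerivAt_synthR_time hL β t x hz).hasDerivWithinAt.derivWithin (uniqueDiffOn_Ici 0 t ht)

lemma IsKernel.dh_synthR (ha : P.IsKernel B a) (hL : IsRate B D L) (j : Fin 2) (β t : ℝ)
    (x : Plane) {z : ℝ} (hz : z ∈ P.layers) :
    dh j (synthR L a β) t x z
      = synthR L (fun ξ z => ξ j * a ξ z) (β + Real.pi / 2) t x z := by
  have h1 : HasFDerivAt (fun y : Plane => (t, y, z)) ((0 : Plane →L[ℝ] ℝ).prod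
      ((ContinuousLinearMap.id ℝ Plane).prod 0)) x :=
    (hasFDerivAt_const t x).prodMk ((hasFDerivAt_id x).prodMk (hasFDerivAt_const z x))
  have h2 := ((ha.hasFDerivAt_integral hL β (y := (t, x, z)) hz).comp x h1).const_mul
    (4 * Real.pi ^ 2)⁻¹
  have h3 := (h2.hasLineDerivAt (EuclideanSpace.single j 1)).lineDeriv
  refine h3.trans ?_
  simp only [smul_apply, ContinuousLinearMap.comp_apply, synthR]
  rw [ContinuousLinearMap.integral_apply (ha.integrable_waveDeriv hL β hz)]
  simp [waveDeriv, wave]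
  congr 1
  ext ξ
  simp [EuclideanSpace.inner_single_right]
  ring

lemma IsKernel.hasDerivAt_synthR (ha : P.IsKernel B a) (hL : IsRate B D L) (β t : ℝ)
    (x : Plane) {z : ℝ} (hz : z ∈ P.layers) :
    HasDerivAt (fun s => synthR L a β t x s) (synthR L (fun ξ => deriv (a ξ)) β t x z) z := by
  have h1 : HasDerivAt (fun s : ℝ => (t, x, s)) (0, 0, 1) z :=
    (hasDerivAt_const z t).prodMk ((hasDerivAt_const z x).prodMk (hasDerivAt_id z))
  have h2 := ((ha.hasFDerivAt_integral hL β (y := (t, x, z)) hz).comp_hasDerivAt z h1).const_mul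
    (4 * Real.pi ^ 2)⁻¹
  refine h2.congr_deriv ?_
  rw [ContinuousLinearMap.integral_apply (ha.integrable_waveDeriv hL β hz), synthR]
  simp [waveDeriv]

lemma IsKernel.dz_synthR (ha : P.IsKernel B a) (hL : IsRate B D L) (β t : ℝ)
    (x : Plane) {z : ℝ} (hz : z ∈ P.layers) :
    dz (synthR L a β) t x z = synthR L (fun ξ => deriv (a ξ)) β t x z :=
  (ha.hasDerivAt_synthR hL β t x hz).deriv

lemma mul_synthR_eq (F : ℝ → ℝ) (β t : ℝ) (x : Plane) (z : ℝ) :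
    F z * synthR L a β t x z = synthR L (fun ξ z => F z * a ξ z) β t x z := by
  simp only [synthR, wave, mul_assoc]
  rw [integral_const_mul]
  ring

lemma synthR_congr {a' : Plane → ℝ → ℝ} {z : ℝ} (h : ∀ ξ, a ξ z = a' ξ z) (β t : ℝ) (x : Plane) :
    synthR L a β t x z = synthR L a' β t x z := by
  simp only [synthR, wave, h]

lemma synthR_half_turn (β t : ℝ) (x : Plane) (z : ℝ) :
    synthR L a (β + Real.pi) t x z = -synthR L a β t x z := by
  simp only [synthR, wave, ← add_assoc, Real.cos_add_pi, mul_neg]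
  rw [integral_neg, mul_neg]

/-- A pointwise linear relation between amplitudes carries over to the superpositions. -/
lemma synthR_relation {a₁ a₂ a₃ a₄ : Plane → ℝ → ℝ} (h₁ : P.IsKernel B a₁) (h₂ : P.IsKernel B a₂)
    (h₃ : P.IsKernel B a₃) (h₄ : P.IsKernel B a₄) (hL : IsRate B D L) (β t : ℝ) (x : Plane) {z : ℝ}
    (hz : z ∈ P.layers) {c₁ c₂ c₃ c₄ : ℝ}
    (h : ∀ ξ, c₁ * a₁ ξ z + c₂ * a₂ ξ z + c₃ * a₃ ξ z + c₄ * a₄ ξ z = 0) :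
    c₁ * synthR L a₁ β t x z + c₂ * synthR L a₂ β t x z + c₃ * synthR L a₃ β t x z
      + c₄ * synthR L a₄ β t x z = 0 := by
  have i : ∀ {a}, P.IsKernel B a → ∀ c : ℝ, Integrable fun ξ => c * wave L a β (t, x, z) ξ :=
    fun ha c => (ha.integrable_wave hL β (y := (t, x, z)) hz).const_mul c
  have key : ∫ ξ, (c₁ * wave L a₁ β (t, x, z) ξ + c₂ * wave L a₂ β (t, x, z) ξ
      + c₃ * wave L a₃ β (t, x, z) ξ + c₄ * wave L a₄ β (t, x, z) ξ) = 0 := by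
    rw [← integral_zero Plane ℝ (μ := volume)]
    congr 1
    ext ξ
    have := h ξ
    simp only [wave]
    linear_combination (Real.exp (L ξ * t) * Real.cos (inner ℝ x ξ + β)) * this
  have i₂ : Integrable fun ξ => c₁ * wave L a₁ β (t, x, z) ξ + c₂ * wave L a₂ β (t, x, z) ξ :=
    (i h₁ c₁).add (i h₂ c₂)
  have i₃ : Integrable fun ξ => c₁ * wave L a₁ β (t, x, z) ξ + c₂ * wave L a₂ β (t, x, z) ξ
      + c₃ * wave L a₃ β (t, x, z) ξ := i₂.add (i h₃ c₃)
  rw [integral_add i₃ (i h₄ c₄), integral_add i₂ (i h₃ c₃), integral_add (i h₁ c₁) (i h₂ c₂),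
    integral_const_mul, integral_const_mul, integral_const_mul, integral_const_mul] at key
  simp only [synthR]
  linear_combination (4 * Real.pi ^ 2)⁻¹ * key

/-- Traces pass under the integral because the amplitude bound is uniform in z. The limit amplitude
no longer depends on z, so the last argument 0 is a dummy. -/
lemma IsKernel.tendsto_synthR (ha : P.IsKernel B a) (hL : IsRate B D L) (β t : ℝ) (x : Plane)
    {l : Filter ℝ} [l.IsCountablyGenerated] (hl : P.layers ∈ l) {b : Plane → ℝ}
    (hb : ∀ ξ, Tendsto (a ξ) l (𝓝 (b ξ))) :
    Tendsto (fun z => synthR L a β t x z) l (𝓝 (synthR L (fun ξ _ => b ξ) β t x 0)) := by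
  obtain ⟨C, hC⟩ := ha.bound 0
  refine Tendsto.const_mul _ (tendsto_integral_filter_of_dominated_convergence _ ?_ ?_
    (integrable_indicator_ball B (C * Real.exp (D * |t|))) (Eventually.of_forall fun ξ => ?_))
  · filter_upwards [hl] with z hz
    exact (ha.measurable_wave hL β hz).aestronglyMeasurable
  · filter_upwards [hl] with z hz
    exact Eventually.of_forall
      (ha.abs_wave_le hL (by simpa using hC) β (y := (t, x, z)) hz le_rfl)
  · exact (hb ξ).mul_const _

end Config

/-! ### The synthesized fields and the linearized problem. -/

/-- The components `φ`, `θ`, `ψ` of a family of modes. -/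
def ModeFamily.profile (M : ModeFamily) (i : Fin 3) (ξ : Plane) (z : ℝ) : ℝ :=
  ![M.φ ξ z, M.θ ξ z, M.ψ ξ z] i

/-- The phase shifts that belong to the factors `-i`, `-i`, `1` of the amplitude of the flow map. -/
def phase (i : Fin 3) : ℝ := ![-(Real.pi / 2), -(Real.pi / 2), 0] i

namespace Config

variable {P : Config} {R₀ c B : ℝ} {M : ModeFamily} {f : Plane → ℝ}

lemma GrowthBounds.isRate (hB : P.GrowthBounds R₀ c) (hM : P.IsNormalModeFamily R₀ M) (B : ℝ) :
    IsRate B √(P.g * B) fun ξ => M.lam ‖ξ‖ where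
  meas := (measurable_growthRate hM.lam_pos hM.lam_variational hM.zero_lam).comp measurable_norm
  bound ξ hξ := by
    rcases le_or_gt ‖ξ‖ R₀ with h | h
    · rw [hM.zero_lam _ h, abs_zero]
      positivity
    · refine Real.abs_le_sqrt ((hB.lam_sq_le hM h).trans ?_)
      exact mul_le_mul_of_nonneg_left hξ P.g_pos.le

section Family

variable (hM : P.IsNormalModeFamily R₀ M)

include hM

lemma IsNormalModeFamily.phi_eq_zero {ξ : Plane} (hξ : ‖ξ‖ ≤ R₀) : M.φ ξ = fun _ => 0 :=
  funext (hM.zero_φ ξ hξ)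

lemma IsNormalModeFamily.theta_eq_zero {ξ : Plane} (hξ : ‖ξ‖ ≤ R₀) : M.θ ξ = fun _ => 0 :=
  funext (hM.zero_θ ξ hξ)

lemma IsNormalModeFamily.psi_eq_zero {ξ : Plane} (hξ : ‖ξ‖ ≤ R₀) : M.ψ ξ = fun _ => 0 :=
  funext (hM.zero_ψ ξ hξ)

lemma IsNormalModeFamily.dens_eq_zero {ξ : Plane} (hξ : ‖ξ‖ ≤ R₀) : P.dens M ξ = fun _ => 0 := by
  funext z
  simp [dens, hM.phi_eq_zero hξ, hM.theta_eq_zero hξ, hM.psi_eq_zero hξ]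

lemma IsNormalModeFamily.sig_eq_zero {ξ : Plane} (hξ : ‖ξ‖ ≤ R₀) : P.sig M ξ = fun _ => 0 := by
  funext z
  rw [sig_eq_dens, hM.dens_eq_zero hξ]
  simp

lemma IsNormalModeFamily.smooth_phi (ξ : Plane) : ContDiffOn ℝ ∞ (M.φ ξ) P.layers := by
  rcases le_or_gt ‖ξ‖ R₀ with h | h
  · rw [hM.phi_eq_zero h]; exact contDiffOn_const
  · exact (hM.mode ξ h).smooth_φ

lemma IsNormalModeFamily.smooth_theta (ξ : Plane) : ContDiffOn ℝ ∞ (M.θ ξ) P.layers := by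
  rcases le_or_gt ‖ξ‖ R₀ with h | h
  · rw [hM.theta_eq_zero h]; exact contDiffOn_const
  · exact (hM.mode ξ h).smooth_θ

lemma IsNormalModeFamily.smooth_psi (ξ : Plane) : ContDiffOn ℝ ∞ (M.ψ ξ) P.layers := by
  rcases le_or_gt ‖ξ‖ R₀ with h | h
  · rw [hM.psi_eq_zero h]; exact contDiffOn_const
  · exact (hM.mode ξ h).smooth_ψ

lemma IsNormalModeFamily.smooth_dens (ξ : Plane) : ContDiffOn ℝ ∞ (P.dens M ξ) P.layers :=
  contDiffOn_rho.neg.mul (((contDiffOn_const.mul (hM.smooth_phi ξ)).add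
    (contDiffOn_const.mul (hM.smooth_theta ξ))).add (contDiffOn_deriv_layers (hM.smooth_psi ξ)))

lemma IsNormalModeFamily.smooth_sig (ξ : Plane) : ContDiffOn ℝ ∞ (P.sig M ξ) P.layers :=
  (contDiffOn_dp.mul (hM.smooth_dens ξ)).neg.congr fun z _ => sig_eq_dens ξ z

lemma IsNormalModeFamily.measurable_dens {z : ℝ} (hz : z ∈ P.layers) :
    Measurable fun ξ => P.dens M ξ z := by
  have h1 := hM.meas_φ z hz
  have h2 := hM.meas_θ z hz
  have h3 := measurable_deriv_param hM.meas_ψ hM.smooth_psi hz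
  unfold dens
  have h4 : Measurable fun ξ : Plane => ξ 0 := by fun_prop
  have h5 : Measurable fun ξ : Plane => ξ 1 := by fun_prop
  exact (((h4.mul h1).add (h5.mul h2)).add h3).const_mul _

lemma IsNormalModeFamily.measurable_sig {z : ℝ} (hz : z ∈ P.layers) :
    Measurable fun ξ => P.sig M ξ z := by
  simp only [sig_eq_dens]
  exact ((hM.measurable_dens hz).const_mul _).neg

/-- Below R₀ everything vanishes, so the mode equations hold for all ξ and can be used under the
integral without case distinctions. -/
lemma IsNormalModeFamily.momentum₁ (ξ : Plane) {z : ℝ} (hz : z ∈ P.layers) :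
    M.lam ‖ξ‖ ^ 2 * P.ρ z * M.φ ξ z + ξ 0 * P.sig M ξ z
      = ξ 0 * P.g * P.ρ z * M.ψ ξ z + 2 * M.lam ‖ξ‖ * P.om * P.ρ z * M.θ ξ z := by
  rcases le_or_gt ‖ξ‖ R₀ with h | h
  · simp [hM.phi_eq_zero h, hM.theta_eq_zero h, hM.psi_eq_zero h, hM.sig_eq_zero h]
  · exact (hM.mode ξ h).eq₁ z hz

lemma IsNormalModeFamily.momentum₂ (ξ : Plane) {z : ℝ} (hz : z ∈ P.layers) :
    M.lam ‖ξ‖ ^ 2 * P.ρ z * M.θ ξ z + ξ 1 * P.sig M ξ z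
      = ξ 1 * P.g * P.ρ z * M.ψ ξ z - 2 * M.lam ‖ξ‖ * P.om * P.ρ z * M.φ ξ z := by
  rcases le_or_gt ‖ξ‖ R₀ with h | h
  · simp [hM.phi_eq_zero h, hM.theta_eq_zero h, hM.psi_eq_zero h, hM.sig_eq_zero h]
  · exact (hM.mode ξ h).eq₂ z hz

lemma IsNormalModeFamily.momentum₃ (ξ : Plane) {z : ℝ} (hz : z ∈ P.layers) :
    M.lam ‖ξ‖ ^ 2 * P.ρ z * M.ψ ξ z - deriv (P.sig M ξ) z
      = P.g * P.ρ z * (ξ 0 * M.φ ξ z + ξ 1 * M.θ ξ z) := by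
  rcases le_or_gt ‖ξ‖ R₀ with h | h
  · simp [hM.phi_eq_zero h, hM.theta_eq_zero h, hM.psi_eq_zero h, hM.sig_eq_zero h]
  · exact (hM.mode ξ h).eq₃ z hz

variable (hB : P.GrowthBounds R₀ c) (hf : Continuous f) (hsupp : ∀ ξ, B < ‖ξ‖ → f ξ = 0)

include hB hf hsupp

lemma IsNormalModeFamily.isKernel_profile (i : Fin 3) :
    P.IsKernel B fun ξ z => f ξ * M.profile i ξ z := by
  fin_cases i
  · exact (isModeFunction_phi hB).isKernel hB hM hM.meas_φ hM.smooth_phi hM.zero_φ hf hsupp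
  · exact (isModeFunction_theta hB).isKernel hB hM hM.meas_θ hM.smooth_theta hM.zero_θ hf hsupp
  · exact isModeFunction_psi.isKernel hB hM hM.meas_ψ hM.smooth_psi hM.zero_ψ hf hsupp

lemma IsNormalModeFamily.isKernel_dens : P.IsKernel B fun ξ z => f ξ * P.dens M ξ z :=
  isModeFunction_dens.isKernel hB hM (fun _ hz => hM.measurable_dens hz) hM.smooth_dens
    (fun _ hξ z => congrFun (hM.dens_eq_zero hξ) z) hf hsupp

lemma IsNormalModeFamily.isKernel_sig : P.IsKernel B fun ξ z => f ξ * P.sig M ξ z :=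
  isModeFunction_sig.isKernel hB hM (fun _ hz => hM.measurable_sig hz) hM.smooth_sig
    (fun _ hξ z => congrFun (hM.sig_eq_zero hξ) z) hf hsupp

end Family

end Config

namespace ModeFamily

variable (M : ModeFamily) (f : Plane → ℝ)

/-- The flow map. -/
def flow (i : Fin 3) : ℝ → Plane → ℝ → ℝ :=
  Config.synthR (fun ξ => M.lam ‖ξ‖) (fun ξ z => f ξ * M.profile i ξ z) (phase i)

/-- The velocity. -/
def velocity (i : Fin 3) : ℝ → Plane → ℝ → ℝ :=
  Config.synthR (fun ξ => M.lam ‖ξ‖) (fun ξ z => M.lam ‖ξ‖ * (f ξ * M.profile i ξ z)) (phase i)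

/-- The density perturbation. -/
def density (P : Config) : ℝ → Plane → ℝ → ℝ :=
  Config.synthR (fun ξ => M.lam ‖ξ‖) (fun ξ z => f ξ * P.dens M ξ z) 0

end ModeFamily

namespace Config

variable {P : Config} {R₀ c B D : ℝ} {M : ModeFamily} {f L : Plane → ℝ} {a : Plane → ℝ → ℝ}

lemma IsKernel.noJump (ha : P.IsKernel B a) (hL : IsRate B D L) (β t : ℝ) (x : Plane)
    (h : ∀ ξ, NoJump (a ξ)) : NoJump fun z => synthR L a β t x z := by
  choose b hb hb' using h
  exact ⟨_, ha.tendsto_synthR hL β t x P.layers_mem_nhdsGT_zero hb,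
    ha.tendsto_synthR hL β t x P.layers_mem_nhdsLT_zero hb'⟩

lemma _root_.RTI.NoJump.const_mul {u : ℝ → ℝ} (h : NoJump u) (k : ℝ) : NoJump fun z => k * u z := by
  obtain ⟨b, h1, h2⟩ := h
  exact ⟨k * b, h1.const_mul k, h2.const_mul k⟩

lemma IsKernel.vanishesAtWalls (ha : P.IsKernel B a) (hL : IsRate B D L) (β t : ℝ) (x : Plane)
    (h : ∀ ξ, P.VanishesAtWalls (a ξ)) : P.VanishesAtWalls fun z => synthR L a β t x z := by
  have e : synthR L (fun _ _ => 0) β t x 0 = 0 := by simp [synthR, wave]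
  constructor
  · have := ha.tendsto_synthR hL β t x P.layers_mem_nhdsGT_wall fun ξ => (h ξ).1
    rwa [e] at this
  · have := ha.tendsto_synthR hL β t x P.layers_mem_nhdsLT_wall fun ξ => (h ξ).2
    rwa [e] at this

lemma dp_mul_density (t : ℝ) (x : Plane) (z : ℝ) : P.dp z * M.density f P t x z
    = synthR (fun ξ => M.lam ‖ξ‖) (fun ξ z => (-1) * (f ξ * P.sig M ξ z)) 0 t x z := by
  rw [ModeFamily.density, mul_synthR_eq P.dp]
  refine synthR_congr (fun ξ => ?_) 0 t x
  rw [sig_eq_dens]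
  ring

/-- The synthesized fields solve the linearized problem. -/
theorem IsNormalModeFamily.isLinearSolution (hM : P.IsNormalModeFamily R₀ M)
    (hB : P.GrowthBounds R₀ c) (hf : Continuous f) (hsupp : ∀ ξ, B < ‖ξ‖ → f ξ = 0) :
    P.IsLinearSolution (M.flow f) (M.velocity f) (M.density f P) := by
  have hL := hB.isRate hM B
  have kw := hM.isKernel_profile hB hf hsupp
  have kv := fun i => (kw i).rate_mul hL
  have kd := hM.isKernel_dens hB hf hsupp
  have ks := (hM.isKernel_sig hB hf hsupp)
  have ks' : P.IsKernel B fun ξ z => (-1) * (f ξ * P.sig M ξ z) :=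
    ks.mul measurable_const (D := 1) (by simp)
  have hdp : (fun τ y s => P.dp s * M.density f P τ y s)
      = synthR (fun ξ => M.lam ‖ξ‖) (fun ξ z => (-1) * (f ξ * P.sig M ξ z)) 0 := by
    funext τ y s
    exact dp_mul_density τ y s
  -- Horizontal gradients of phase zero fields carry the phase π/2, whereas the horizontal
  -- velocities carry -π/2. The half turn between them is a change of sign.
  have hturn : ∀ (a : Plane → ℝ → ℝ) (t : ℝ) (x : Plane) (z : ℝ),
      synthR (fun ξ => M.lam ‖ξ‖) a (0 + Real.pi / 2) t x z
        = -synthR (fun ξ => M.lam ‖ξ‖) a (-(Real.pi / 2)) t x z := by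
    intro a t x z
    rw [← synthR_half_turn]
    congr 1
    ring
  refine ⟨fun i => (kw i).isC1 hL _, fun i => (kv i).isC1 hL _, kd.isC1 hL _,
    fun i t ht x z hz => (kw i).dt_synthR hL _ ht x hz, ?_, ?_, ?_, ?_, ?_, ?_, ?_⟩
  · intro t ht x z hz
    have d0 := (kv 0).dh_synthR hL 0 (phase 0) t x hz
    have d1 := (kv 1).dh_synthR hL 1 (phase 1) t x hz
    -- The real form of iξ_j·(-i) = ξ_j: the divergence has the same phase as the density, so
    -- amplitudes can be compared.
    have e0 : phase 0 + Real.pi / 2 = 0 := neg_add_cancel _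
    have e1 : phase 1 + Real.pi / 2 = 0 := neg_add_cancel _
    rw [e0] at d0
    rw [e1] at d1
    have dq := kd.dt_synthR hL 0 ht x hz
    have d2 := (kv 2).dz_synthR hL (phase 2) t x hz
    have := synthR_relation (kd.rate_mul hL) ((kv 0).coord_mul 0) ((kv 1).coord_mul 1)
      (kv 2).vderiv hL 0 t x hz (c₁ := 1) (c₂ := P.ρ z) (c₃ := P.ρ z) (c₄ := P.ρ z) (fun ξ => ?_)
    · simp only [ModeFamily.density, ModeFamily.velocity]
      rw [dq, d0, d1, d2]
      change _ + _ * (_ + _ + synthR _ _ 0 t x z) = 0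
      linear_combination this
    · have e : deriv (fun z => M.lam ‖ξ‖ * (f ξ * M.profile 2 ξ z)) z
          = M.lam ‖ξ‖ * (f ξ * deriv (M.ψ ξ) z) := by
        rw [deriv_const_mul_field, deriv_const_mul_field]
        rfl
      rw [e]
      simp only [dens, ModeFamily.profile, Matrix.cons_val]
      ring
  · intro t ht x z hz
    have dv := (kv 0).dt_synthR hL (phase 0) ht x hz
    have dη := (kw 2).dh_synthR hL 0 (phase 2) t x hz
    have dq := ks'.dh_synthR hL 0 0 t x hz
    rw [hdp, dq, hturn]
    simp only [ModeFamily.flow, ModeFamily.velocity]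
    rw [dv, dη]
    change _ * synthR _ _ (-(Real.pi / 2)) t x z + _ = _ * synthR _ _ (0 + Real.pi / 2) t x z
      + _ * synthR _ _ (-(Real.pi / 2)) t x z
    rw [hturn]
    have := synthR_relation ((kv 0).rate_mul hL) (ks'.coord_mul 0) ((kw 2).coord_mul 0) (kv 1)
      hL (-(Real.pi / 2)) t x hz (c₁ := P.ρ z) (c₂ := -1) (c₃ := -(P.g * P.ρ z))
      (c₄ := -(2 * P.ρ z * P.om)) (fun ξ => ?_)
    · linear_combination this
    · have := hM.momentum₁ ξ hz
      simp only [ModeFamily.profile, Matrix.cons_val]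
      linear_combination f ξ * this
  · intro t ht x z hz
    have dv := (kv 1).dt_synthR hL (phase 1) ht x hz
    have dη := (kw 2).dh_synthR hL 1 (phase 2) t x hz
    have dq := ks'.dh_synthR hL 1 0 t x hz
    rw [hdp, dq, hturn]
    simp only [ModeFamily.flow, ModeFamily.velocity]
    rw [dv, dη]
    change _ * synthR _ _ (-(Real.pi / 2)) t x z + _ = _ * synthR _ _ (0 + Real.pi / 2) t x z
      - _ * synthR _ _ (-(Real.pi / 2)) t x z
    rw [hturn]
    have := synthR_relation ((kv 1).rate_mul hL) (ks'.coord_mul 1) ((kw 2).coord_mul 1) (kv 0)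
      hL (-(Real.pi / 2)) t x hz (c₁ := P.ρ z) (c₂ := -1) (c₃ := -(P.g * P.ρ z))
      (c₄ := 2 * P.ρ z * P.om) (fun ξ => ?_)
    · linear_combination this
    · have := hM.momentum₂ ξ hz
      simp only [ModeFamily.profile, Matrix.cons_val]
      linear_combination f ξ * this
  · intro t ht x z hz
    have dv := (kv 2).dt_synthR hL (phase 2) ht x hz
    have dη := (kw 2).dz_synthR hL (phase 2) t x hz
    have dq := ks'.dz_synthR hL 0 t x hz
    rw [hdp, dq]
    simp only [ModeFamily.flow, ModeFamily.velocity, ModeFamily.density]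
    rw [dv, dη]
    change _ * synthR _ _ 0 t x z + _ = _ - _ * synthR _ _ 0 t x z
    have := synthR_relation ((kv 2).rate_mul hL) ks'.vderiv kd (kw 2).vderiv
      hL 0 t x hz (c₁ := P.ρ z) (c₂ := 1) (c₃ := P.g) (c₄ := P.g * P.ρ z) (fun ξ => ?_)
    · linear_combination this
    · have h1 := hM.momentum₃ ξ hz
      have e : deriv (fun z => (-1) * (f ξ * P.sig M ξ z)) z = -(f ξ * deriv (P.sig M ξ) z) := by
        rw [deriv_const_mul_field, deriv_const_mul_field]
        ring
      have e' : deriv (fun z => f ξ * M.profile 2 ξ z) z = f ξ * deriv (M.ψ ξ) z := by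
        rw [deriv_const_mul_field]
        rfl
      rw [e, e']
      simp only [dens, ModeFamily.profile, Matrix.cons_val]
      linear_combination f ξ * h1
  · intro t _ x
    refine (kv 2).noJump hL _ t x fun ξ => ?_
    rcases le_or_gt ‖ξ‖ R₀ with h | h
    · exact ⟨0, by simp [hM.zero_lam _ h], by simp [hM.zero_lam _ h]⟩
    · exact ((hM.mode ξ h).jump_ψ.const_mul _).const_mul _
  · intro t _ x
    simp only [dp_mul_density]
    refine ks'.noJump hL _ t x fun ξ => ?_
    rcases le_or_gt ‖ξ‖ R₀ with h | h
    · exact ⟨0, by simp [hM.sig_eq_zero h], by simp [hM.sig_eq_zero h]⟩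
    · exact ((hM.mode ξ h).jump_flux.const_mul _).const_mul _
  · intro t _ x
    refine (kv 2).vanishesAtWalls hL _ t x fun ξ => ?_
    rcases le_or_gt ‖ξ‖ R₀ with h | h
    · exact ⟨by simp [hM.zero_lam _ h], by simp [hM.zero_lam _ h]⟩
    · have hw := (hM.mode ξ h).walls
      constructor
      · simpa [ModeFamily.profile] using (hw.1.const_mul (f ξ)).const_mul (M.lam ‖ξ‖)
      · simpa [ModeFamily.profile] using (hw.2.const_mul (f ξ)).const_mul (M.lam ‖ξ‖)

end Config

/-! ### Complex amplitudes, parity and reality. -/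

namespace Config

variable {P : Config} {R₀ c B D : ℝ} {M : ModeFamily} {f L : Plane → ℝ} {a : Plane → ℝ → ℝ}

/-- The amplitude of a superposition of plane waves. -/
def amplitude (L : Plane → ℝ) (a : Plane → ℝ → ℝ) (β t z : ℝ) (ξ : Plane) : ℂ :=
  ((a ξ z * Real.exp (L ξ * t) : ℝ) : ℂ) * Complex.exp (Complex.I * β)

lemma IsKernel.integrable_mul_exp (ha : P.IsKernel B a) (hL : IsRate B D L) (t : ℝ) {z : ℝ}
    (hz : z ∈ P.layers) : Integrable fun ξ => a ξ z * Real.exp (L ξ * t) := by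
  have e : wave L a 0 (t, 0, z) = fun ξ => a ξ z * Real.exp (L ξ * t) := by
    funext ξ
    simp [wave]
  rw [← e]
  exact ha.integrable_wave hL 0 hz

lemma IsKernel.integrable_amplitude (ha : P.IsKernel B a) (hL : IsRate B D L) (β t : ℝ) {z : ℝ}
    (hz : z ∈ P.layers) : Integrable (amplitude L a β t z) :=
  (ha.integrable_mul_exp hL t hz).ofReal.mul_const _

/-- The complex integral splits into a cosine part, which is the real wave, and i times a sine part,
whose integrand is odd in ξ and integrates to zero. -/
lemma IsKernel.ofReal_synthR (ha : P.IsKernel B a) (hL : IsRate B D L) {β t z : ℝ} {x : Plane}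
    (hz : z ∈ P.layers) (hLn : ∀ ξ, L (-ξ) = L ξ) (hodd : ∀ ξ, a (-ξ) z *
      Real.sin (inner ℝ x (-ξ) + β) = -(a ξ z * Real.sin (inner ℝ x ξ + β))) :
    (synthR L a β t x z : ℂ) = synth (amplitude L a β t z) x := by
  have hi := ha.integrable_mul_exp hL t hz
  have hc : Integrable fun ξ => wave L a β (t, x, z) ξ := ha.integrable_wave hL β hz
  have hs : Integrable fun ξ => a ξ z * Real.exp (L ξ * t) * Real.sin (inner ℝ x ξ + β) := by
    refine hi.mul_bdd (c := 1) (Continuous.aestronglyMeasurable (by fun_prop))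
      (Eventually.of_forall fun ξ => ?_)
    exact Real.abs_sin_le_one _
  have h0 : ∫ ξ, a ξ z * Real.exp (L ξ * t) * Real.sin (inner ℝ x ξ + β) = 0 := by
    have h := integral_neg_eq_self
      (fun ξ => a ξ z * Real.exp (L ξ * t) * Real.sin (inner ℝ x ξ + β)) volume
    have e : ∀ ξ, a (-ξ) z * Real.exp (L (-ξ) * t) * Real.sin (inner ℝ x (-ξ) + β)
        = -(a ξ z * Real.exp (L ξ * t) * Real.sin (inner ℝ x ξ + β)) := by
      intro ξ
      rw [hLn]
      linear_combination Real.exp (L ξ * t) * hodd ξ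
    simp only [e, integral_neg] at h
    linarith
  have key : ∀ ξ, amplitude L a β t z ξ * Complex.exp (Complex.I * ((inner ℝ x ξ : ℝ) : ℂ))
      = (wave L a β (t, x, z) ξ : ℂ)
        + ((a ξ z * Real.exp (L ξ * t) * Real.sin (inner ℝ x ξ + β) : ℝ) : ℂ) * Complex.I := by
    intro ξ
    rw [amplitude, mul_assoc, ← Complex.exp_add]
    have : Complex.I * (β : ℂ) + Complex.I * ((inner ℝ x ξ : ℝ) : ℂ)
        = ((inner ℝ x ξ + β : ℝ) : ℂ) * Complex.I := by push_cast; ring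
    rw [this, Complex.exp_mul_I, ← Complex.ofReal_cos, ← Complex.ofReal_sin, wave]
    push_cast
    ring
  rw [synth]
  simp only [key]
  rw [integral_add hc.ofReal (hs.ofReal.mul_const _), integral_mul_const, integral_complex_ofReal,
    integral_complex_ofReal, h0, synthR]
  push_cast
  ring

/-- Equivariance under the half turn makes φ and θ odd and ψ and the density profile even in ξ; the
fields are real for this reason. -/
lemma rot_pi (ξ : Plane) : rot Real.pi ξ = -ξ := by
  ext i
  fin_cases i
  · change Real.cos Real.pi * ξ 0 - Real.sin Real.pi * ξ 1 = -ξ 0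
    simp
  · change Real.sin Real.pi * ξ 0 + Real.cos Real.pi * ξ 1 = -ξ 1
    simp

section Parity

variable (hM : P.IsNormalModeFamily R₀ M)

include hM

lemma IsNormalModeFamily.phi_neg (ξ : Plane) {z : ℝ} (hz : z ∈ P.layers) :
    M.φ (-ξ) z = -M.φ ξ z := by
  rcases le_or_gt ‖ξ‖ R₀ with h | h
  · rw [hM.zero_φ ξ h, hM.zero_φ (-ξ) (by rwa [norm_neg]), neg_zero]
  · rw [← rot_pi, hM.rot_φ _ ξ h z hz]
    simp

lemma IsNormalModeFamily.theta_neg (ξ : Plane) {z : ℝ} (hz : z ∈ P.layers) :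
    M.θ (-ξ) z = -M.θ ξ z := by
  rcases le_or_gt ‖ξ‖ R₀ with h | h
  · rw [hM.zero_θ ξ h, hM.zero_θ (-ξ) (by rwa [norm_neg]), neg_zero]
  · rw [← rot_pi, hM.rot_θ _ ξ h z hz]
    simp

lemma IsNormalModeFamily.psi_neg (ξ : Plane) {z : ℝ} (hz : z ∈ P.layers) :
    M.ψ (-ξ) z = M.ψ ξ z := by
  rcases le_or_gt ‖ξ‖ R₀ with h | h
  · rw [hM.zero_ψ ξ h, hM.zero_ψ (-ξ) (by rwa [norm_neg])]
  · rw [← rot_pi, hM.rot_ψ _ ξ h z hz]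

lemma IsNormalModeFamily.dens_neg (ξ : Plane) {z : ℝ} (hz : z ∈ P.layers) :
    P.dens M (-ξ) z = P.dens M ξ z := by
  have e : deriv (M.ψ (-ξ)) z = deriv (M.ψ ξ) z := Filter.EventuallyEq.deriv_eq <| by
    filter_upwards [P.isOpen_layers.mem_nhds hz] with s hs using hM.psi_neg ξ hs
  rw [dens, dens, hM.phi_neg ξ hz, hM.theta_neg ξ hz, e]
  simp

variable (hB : P.GrowthBounds R₀ c) (hf : Continuous f) (hsupp : ∀ ξ, B < ‖ξ‖ → f ξ = 0)
  (hrad : ∀ ξ ξ' : Plane, ‖ξ‖ = ‖ξ'‖ → f ξ = f ξ')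

include hrad in
lemma IsNormalModeFamily.profile_parity (i : Fin 3) (x ξ : Plane) {z : ℝ} (hz : z ∈ P.layers) :
    f (-ξ) * M.profile i (-ξ) z * Real.sin (inner ℝ x (-ξ) + phase i)
      = -(f ξ * M.profile i ξ z * Real.sin (inner ℝ x ξ + phase i)) := by
  rw [hrad (-ξ) ξ (norm_neg ξ), inner_neg_right]
  have e : ∀ s : ℝ, Real.sin (-s + -(Real.pi / 2)) = Real.sin (s + -(Real.pi / 2)) := by
    intro s
    rw [← sub_eq_add_neg, ← sub_eq_add_neg, Real.sin_sub_pi_div_two, Real.sin_sub_pi_div_two,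
      Real.cos_neg]
  fin_cases i
  · change f ξ * M.φ (-ξ) z * Real.sin (-inner ℝ x ξ + -(Real.pi / 2))
      = -(f ξ * M.φ ξ z * Real.sin (inner ℝ x ξ + -(Real.pi / 2)))
    rw [e, hM.phi_neg ξ hz]
    ring
  · change f ξ * M.θ (-ξ) z * Real.sin (-inner ℝ x ξ + -(Real.pi / 2))
      = -(f ξ * M.θ ξ z * Real.sin (inner ℝ x ξ + -(Real.pi / 2)))
    rw [e, hM.theta_neg ξ hz]
    ring
  · change f ξ * M.ψ (-ξ) z * Real.sin (-inner ℝ x ξ + 0)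
      = -(f ξ * M.ψ ξ z * Real.sin (inner ℝ x ξ + 0))
    rw [add_zero, add_zero, hM.psi_neg ξ hz, Real.sin_neg]
    ring

omit hM in
lemma exp_phase_mul (i : Fin 3) (ξ : Plane) (z : ℝ) :
    (M.profile i ξ z : ℂ) * Complex.exp (Complex.I * (phase i : ℂ)) = M.wHat i ξ z := by
  have e : Complex.exp (Complex.I * ((-(Real.pi / 2) : ℝ) : ℂ)) = -Complex.I := by
    rw [mul_comm, Complex.exp_mul_I, ← Complex.ofReal_cos, ← Complex.ofReal_sin, Real.cos_neg,
      Real.sin_neg, Real.cos_pi_div_two, Real.sin_pi_div_two]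
    simp
  fin_cases i
  · change (M.φ ξ z : ℂ) * Complex.exp (Complex.I * ((-(Real.pi / 2) : ℝ) : ℂ))
      = -Complex.I * (M.φ ξ z : ℂ)
    rw [e, mul_comm]
  · change (M.θ ξ z : ℂ) * Complex.exp (Complex.I * ((-(Real.pi / 2) : ℝ) : ℂ))
      = -Complex.I * (M.θ ξ z : ℂ)
    rw [e, mul_comm]
  · change (M.ψ ξ z : ℂ) * Complex.exp (Complex.I * ((0 : ℝ) : ℂ)) = (M.ψ ξ z : ℂ)
    simp

omit hM in
lemma amplitude_flow (i : Fin 3) (t z : ℝ) :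
    amplitude (fun ξ => M.lam ‖ξ‖) (fun ξ z => f ξ * M.profile i ξ z) (phase i) t z
      = M.etaHat f i t z := by
  funext ξ
  rw [ModeFamily.etaHat, ← exp_phase_mul, amplitude]
  push_cast
  ring

omit hM in
lemma amplitude_velocity (i : Fin 3) (t z : ℝ) :
    amplitude (fun ξ => M.lam ‖ξ‖) (fun ξ z => M.lam ‖ξ‖ * (f ξ * M.profile i ξ z)) (phase i) t z
      = M.vHat f i t z := by
  funext ξ
  rw [ModeFamily.vHat, ← exp_phase_mul, amplitude]
  push_cast
  ring

omit hM in
lemma amplitude_density (t z : ℝ) :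
    amplitude (fun ξ => M.lam ‖ξ‖) (fun ξ z => f ξ * P.dens M ξ z) 0 t z = M.qHat f P t z := by
  funext ξ
  rw [ModeFamily.qHat, amplitude, dens, Complex.ofReal_zero, mul_zero, Complex.exp_zero, mul_one]
  congr 1
  ring

include hB hf hsupp

lemma IsNormalModeFamily.integrable_etaHat (i : Fin 3) (t : ℝ) {z : ℝ} (hz : z ∈ P.layers) :
    Integrable (M.etaHat f i t z) := by
  rw [← amplitude_flow]
  exact (hM.isKernel_profile hB hf hsupp i).integrable_amplitude (hB.isRate hM B) _ t hz

lemma IsNormalModeFamily.integrable_vHat (i : Fin 3) (t : ℝ) {z : ℝ} (hz : z ∈ P.layers) :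
    Integrable (M.vHat f i t z) := by
  rw [← amplitude_velocity]
  exact ((hM.isKernel_profile hB hf hsupp i).rate_mul (hB.isRate hM B)).integrable_amplitude
    (hB.isRate hM B) _ t hz

lemma IsNormalModeFamily.integrable_qHat (t : ℝ) {z : ℝ} (hz : z ∈ P.layers) :
    Integrable (M.qHat f P t z) := by
  rw [← amplitude_density]
  exact (hM.isKernel_dens hB hf hsupp).integrable_amplitude (hB.isRate hM B) _ t hz

include hrad

lemma IsNormalModeFamily.ofReal_flow (i : Fin 3) (t : ℝ) (x : Plane) {z : ℝ} (hz : z ∈ P.layers) :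
    (M.flow f i t x z : ℂ) = synth (M.etaHat f i t z) x := by
  rw [← amplitude_flow]
  exact (hM.isKernel_profile hB hf hsupp i).ofReal_synthR (hB.isRate hM B) hz (by simp)
    fun ξ => hM.profile_parity hrad i x ξ hz

lemma IsNormalModeFamily.ofReal_velocity (i : Fin 3) (t : ℝ) (x : Plane) {z : ℝ}
    (hz : z ∈ P.layers) : (M.velocity f i t x z : ℂ) = synth (M.vHat f i t z) x := by
  rw [← amplitude_velocity]
  refine ((hM.isKernel_profile hB hf hsupp i).rate_mul (hB.isRate hM B)).ofReal_synthR
    (hB.isRate hM B) hz (by simp) fun ξ => ?_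
  rw [norm_neg, mul_assoc, hM.profile_parity hrad i x ξ hz]
  ring

lemma IsNormalModeFamily.ofReal_density (t : ℝ) (x : Plane) {z : ℝ} (hz : z ∈ P.layers) :
    (M.density f P t x z : ℂ) = synth (M.qHat f P t z) x := by
  rw [← amplitude_density]
  refine (hM.isKernel_dens hB hf hsupp).ofReal_synthR (hB.isRate hM B) hz (by simp) fun ξ => ?_
  rw [hrad (-ξ) ξ (norm_neg ξ), hM.dens_neg ξ hz, inner_neg_right, add_zero, add_zero, Real.sin_neg]
  ring

end Parity

end Config

/-! ### Fourier transforms of amplitudes in L¹ ∩ L². -/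

section Plancherel

open FourierTransform

variable {U V u : Plane → ℂ}

/-- The kernel here is e^{ix·ξ}, while 𝓕⁻ has e^{2πix·ξ}; the conventions differ by a dilation by
2π. -/
lemma synth_eq_fourierInv (U : Plane → ℂ) (x : Plane) :
    synth U x = (1 / (4 * (Real.pi : ℂ) ^ 2)) * 𝓕⁻ U ((2 * Real.pi)⁻¹ • x) := by
  rw [synth, Real.fourierInv_eq']
  congr 2
  ext ξ
  have : 2 * Real.pi * inner ℝ ξ ((2 * Real.pi)⁻¹ • x) = inner ℝ x ξ := by
    rw [real_inner_smul_right, real_inner_comm, ← mul_assoc,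
      mul_inv_cancel₀ (by positivity), one_mul]
  rw [this, smul_eq_mul, mul_comm, mul_comm Complex.I]

lemma fourier_scaled (χ : 𝓢(Plane, ℂ)) (x : Plane) :
    ∫ ξ, χ ξ * Complex.exp (-Complex.I * ((inner ℝ x ξ : ℝ) : ℂ))
      = (𝓕 χ) ((2 * Real.pi)⁻¹ • x) := by
  rw [SchwartzMap.fourier_coe, Real.fourier_eq']
  congr 1
  ext ξ
  have : -2 * Real.pi * inner ℝ ξ ((2 * Real.pi)⁻¹ • x) = -inner ℝ x ξ := by
    rw [real_inner_smul_right, real_inner_comm, neg_mul, neg_mul, ← mul_assoc,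
      mul_inv_cancel₀ (by positivity), one_mul]
  rw [this, smul_eq_mul, mul_comm]
  congr 2
  push_cast
  ring

lemma integral_fourierInv_mul (hU : Integrable U) (g : 𝓢(Plane, ℂ)) :
    ∫ y, 𝓕⁻ U y * g y = ∫ ξ, U ξ * (𝓕⁻ g) ξ := by
  have h := VectorFourier.integral_fourierIntegral_smul_eq_flip (L := -innerₗ Plane)
    (μ := (volume : Measure Plane)) (ν := (volume : Measure Plane))
    Real.continuous_fourierChar (by exact continuous_inner.neg) hU g.integrable
  simp only [smul_eq_mul] at h
  refine h.trans (integral_congr_ae (Eventually.of_forall fun ξ => ?_))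
  beta_reduce
  rw [SchwartzMap.fourierInv_coe, Real.fourierInv_eq]
  congr 1
  simp [VectorFourier.fourierIntegral, real_inner_comm]

lemma continuous_fourierInv (hU : Integrable U) : Continuous (𝓕⁻ U) :=
  VectorFourier.fourierIntegral_continuous Real.continuous_fourierChar (by exact continuous_inner.neg) hU

lemma ae_eq_of_integral_schwartz (hu : LocallyIntegrable u) (hV : LocallyIntegrable V)
    (h : ∀ χ : 𝓢(Plane, ℂ), ∫ x, u x * χ x = ∫ x, V x * χ x) : u =ᵐ[volume] V := by
  refine ae_eq_of_integral_contDiff_smul_eq hu hV fun g hg hgc => ?_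
  have hc : HasCompactSupport fun x => (g x : ℂ) := hgc.comp_left (g := Complex.ofReal) rfl
  have hs : ContDiff ℝ ∞ fun x => (g x : ℂ) := Complex.ofRealCLM.contDiff.comp hg
  have := h (hc.toSchwartzMap hs)
  simpa [mul_comm] using this

/-- The integral formula and the L² inverse transform agree as tempered distributions, hence almost
everywhere. -/
lemma memLp_fourierInv (hU : Integrable U) (hU2 : MemLp U 2) : MemLp (𝓕⁻ U) 2 := by
  set w : Lp ℂ 2 (volume : Measure Plane) := 𝓕⁻ (hU2.toLp U)
  have hw := Lp.memLp w
  refine hw.ae_eq ?_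
  refine (ae_eq_of_integral_schwartz (continuous_fourierInv hU).locallyIntegrable
    (hw.locallyIntegrable (by norm_num)) fun χ => ?_).symm
  have h := congrArg (fun T => T χ) (Lp.fourierInv_toTemperedDistribution_eq (hU2.toLp U))
  simp only [TemperedDistribution.fourierInv_apply, Lp.toTemperedDistribution_apply,
    smul_eq_mul] at h
  rw [integral_fourierInv_mul hU]
  have e : ∫ ξ, U ξ * (𝓕⁻ χ) ξ = ∫ ξ, (𝓕⁻ χ) ξ * (hU2.toLp U) ξ := by
    refine integral_congr_ae ?_
    filter_upwards [hU2.coeFn_toLp] with ξ hξ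
    rw [hξ, mul_comm]
  rw [e, h]
  exact integral_congr_ae (Eventually.of_forall fun x => mul_comm _ _)

lemma memLp_comp_smul {r : ℝ} (hr : r ≠ 0) (hu : MemLp u 2) : MemLp (fun x => u (r • x)) 2 := by
  refine MemLp.comp_of_map (f := fun x : Plane => r • x) (g := u) ?_
    (measurable_const_smul r).aemeasurable
  rw [Measure.map_addHaar_smul volume hr]
  exact hu.smul_measure ENNReal.ofReal_ne_top

/-- The synthesis of an amplitude in `L¹ ∩ L²` has this amplitude as its Fourier transform. -/
lemma isFourier_synth (hU : Integrable U) (hU2 : MemLp U 2) : IsFourier (synth U) U := by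
  have hπ : (2 * Real.pi)⁻¹ ≠ 0 := by positivity
  refine ⟨?_, hU2, fun χ => ?_⟩
  · have := (memLp_comp_smul hπ (memLp_fourierInv hU hU2)).const_mul (1 / (4 * (Real.pi : ℂ) ^ 2))
    exact this.ae_eq (Eventually.of_forall fun x => (synth_eq_fourierInv U x).symm)
  · simp only [synth_eq_fourierInv, fourier_scaled, mul_assoc]
    rw [integral_const_mul, Measure.integral_comp_smul volume
      (fun y => 𝓕⁻ U y * (𝓕 χ : 𝓢(Plane, ℂ)) y), integral_fourierInv_mul hU, fourierInv_fourier_eq]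
    have hd : Module.finrank ℝ Plane = 2 := by simp
    rw [hd, Complex.real_smul, ← mul_assoc]
    -- The Jacobian of the dilation in dimension two is (2π)², which cancels the prefactor of the
    -- synthesis.
    have : (1 / (4 * (Real.pi : ℂ) ^ 2)) * ((|((2 * Real.pi)⁻¹ ^ 2)⁻¹| : ℝ) : ℂ) = 1 := by
      rw [abs_of_pos (by positivity)]
      push_cast
      have : (Real.pi : ℂ) ≠ 0 := by exact_mod_cast Real.pi_ne_zero
      field_simp
      norm_num
    rw [this, one_mul]

lemma IsFourier.unique (hU : IsFourier u U) (hV : IsFourier u V) : U =ᵐ[volume] V :=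
  ae_eq_of_integral_schwartz (hU.2.1.locallyIntegrable (by norm_num))
    (hV.2.1.locallyIntegrable (by norm_num)) fun χ => (hU.2.2 χ).trans (hV.2.2 χ).symm

lemma IsFourier.congr (hU : IsFourier u U) (h : U =ᵐ[volume] V) : IsFourier u V := by
  refine ⟨hU.1, hU.2.1.ae_eq h, fun χ => ?_⟩
  rw [← hU.2.2 χ]
  refine integral_congr_ae ?_
  filter_upwards [h] with ξ hξ
  rw [hξ]

end Plancherel

/-! ### Fourier multipliers on the piecewise Sobolev norms, and weak derivatives. -/

section Multiplier

variable {I : Set ℝ} {k : ℕ} {u u' U : Plane → ℝ → ℂ} {D : ℕ → Plane → ℝ → ℂ} {m : Plane → ℝ}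

lemma IsWeakDeriv.const_mul {v w : ℝ → ℂ} (h : IsWeakDeriv I v w) (b : ℂ) :
    IsWeakDeriv I (fun z => b * v z) (fun z => b * w z) := by
  refine ⟨fun z hz => ?_, fun z hz => ?_, fun χ h1 h2 h3 => ?_⟩
  · obtain ⟨s, hs, hi⟩ := h.1 z hz
    exact ⟨s, hs, hi.const_mul b⟩
  · obtain ⟨s, hs, hi⟩ := h.2.1 z hz
    exact ⟨s, hs, hi.const_mul b⟩
  · simp only [mul_assoc]
    rw [integral_const_mul, integral_const_mul, h.2.2 χ h1 h2 h3, mul_neg]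

/-- A multiplier in ξ commutes with weak derivatives in x₃. The jet D is arbitrary and is tied to U
only by uniqueness of the Fourier transform almost everywhere, which is why this handles the infimum
in `hkSq`. -/
lemma IsTransformJet.multiplier (h : IsTransformJet I k u D) (hm : Measurable m)
    (hu' : AEStronglyMeasurable (fun y : Plane × ℝ => u' y.1 y.2)
      (volume.restrict ((univ : Set Plane) ×ˢ I)))
    (hU : ∀ᵐ z ∂(volume.restrict I), IsFourier (fun x => u x z) (fun ξ => U ξ z))
    (hU' : ∀ᵐ z ∂(volume.restrict I), IsFourier (fun x => u' x z) (fun ξ => (m ξ : ℂ) * U ξ z)) :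
    IsTransformJet I k u' fun j ξ z => (m ξ : ℂ) * D j ξ z where
  meas_u := hu'
  meas_D j hj := by
    refine AEStronglyMeasurable.mul (f := fun y : Plane × ℝ => (m y.1 : ℂ)) ?_ (h.meas_D j hj)
    exact (Complex.measurable_ofReal.comp (hm.comp measurable_fst)).aestronglyMeasurable
  fourier := by
    filter_upwards [h.fourier, hU, hU'] with z h1 h2 h3
    refine h3.congr ?_
    filter_upwards [h2.unique h1] with ξ hξ
    rw [hξ]
  weakDeriv j hj := by
    filter_upwards [h.weakDeriv j hj] with ξ hξ
    exact hξ.const_mul _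

/-- A bounded Fourier multiplier is bounded on the Sobolev spaces. -/
lemma hkSq_le_of_multiplier {b : ℝ} (hb : 0 < b) (hm : Measurable m) (hmb : ∀ ξ, |m ξ| ≤ b)
    (hu' : AEStronglyMeasurable (fun y : Plane × ℝ => u' y.1 y.2)
      (volume.restrict ((univ : Set Plane) ×ˢ I)))
    (hU : ∀ᵐ z ∂(volume.restrict I), IsFourier (fun x => u x z) (fun ξ => U ξ z))
    (hU' : ∀ᵐ z ∂(volume.restrict I), IsFourier (fun x => u' x z) (fun ξ => (m ξ : ℂ) * U ξ z)) :
    hkSq I k u' ≤ ENNReal.ofReal b ^ 2 * hkSq I k u := by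
  have hb0 : ENNReal.ofReal b ≠ 0 := by simpa using hb
  have hb2 : ENNReal.ofReal b ^ 2 ≠ 0 := pow_ne_zero 2 hb0
  have hbt : ENNReal.ofReal b ^ 2 ≠ ⊤ := ENNReal.pow_ne_top ENNReal.ofReal_ne_top
  rw [mul_comm, ← ENNReal.div_le_iff hb2 hbt]
  refine le_iInf₂ fun D hD => ?_
  rw [ENNReal.div_le_iff hb2 hbt]
  refine (iInf₂_le _ (hD.multiplier hm hu' hU hU')).trans ?_
  rw [Finset.sum_mul]
  refine Finset.sum_le_sum fun j _ => ?_
  rw [← lintegral_mul_const' _ _ hbt]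
  refine lintegral_mono fun z => ?_
  rw [← lintegral_mul_const' _ _ hbt]
  refine lintegral_mono fun ξ => ?_
  have e : ‖(m ξ : ℂ)‖ₑ ≤ ENNReal.ofReal b := by
    rw [← ofReal_norm, Complex.norm_real]
    exact ENNReal.ofReal_le_ofReal (hmb ξ)
  rw [enorm_mul, mul_pow, mul_assoc, mul_comm (‖(m ξ : ℂ)‖ₑ ^ 2)]
  gcongr

end Multiplier

lemma contDiff_mul_of_tsupport_subset {I : Set ℝ} (hI : IsOpen I) {g χ : ℝ → ℝ}
    (hg : ContDiffOn ℝ ∞ g I) (hχ : ContDiff ℝ ∞ χ) (hs : tsupport χ ⊆ I) :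
    ContDiff ℝ ∞ fun z => g z * χ z := by
  refine contDiff_iff_contDiffAt.2 fun z => ?_
  by_cases hz : z ∈ I
  · exact (hg.contDiffAt (hI.mem_nhds hz)).mul hχ.contDiffAt
  · have h0 : χ =ᶠ[𝓝 z] 0 := notMem_tsupport_iff_eventuallyEq.1 fun h => hz (hs h)
    refine (contDiffAt_const (c := (0 : ℝ))).congr_of_eventuallyEq ?_
    filter_upwards [h0] with s hs
    simp [hs]

/-- The classical derivative of a function that is smooth in an open set is its weak derivative. -/
lemma isWeakDeriv_of_contDiffOn {I : Set ℝ} (hI : IsOpen I) {g : ℝ → ℝ}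
    (hg : ContDiffOn ℝ ∞ g I) :
    IsWeakDeriv I (fun z => (g z : ℂ)) (fun z => ((deriv g z : ℝ) : ℂ)) := by
  have hg' := ((contDiffOn_infty_iff_deriv_of_isOpen hI).1 hg).2
  refine ⟨(Complex.continuous_ofReal.comp_continuousOn hg.continuousOn).locallyIntegrableOn
    hI.measurableSet, (Complex.continuous_ofReal.comp_continuousOn
    hg'.continuousOn).locallyIntegrableOn hI.measurableSet, fun χ h1 h2 h3 => ?_⟩
  have h1' : ContDiff ℝ ∞ (deriv χ) := (contDiff_infty_iff_deriv.1 h1).2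
  have h3' : tsupport (deriv χ) ⊆ I := tsupport_deriv_subset.trans h3
  have i0 : ContDiff ℝ ∞ fun z => g z * χ z := contDiff_mul_of_tsupport_subset hI hg h1 h3
  have i1 : Integrable fun z => g z * deriv χ z :=
    (contDiff_mul_of_tsupport_subset hI hg h1' h3').continuous.integrable_of_hasCompactSupport
      h2.deriv.mul_left
  have i2 : Integrable fun z => deriv g z * χ z :=
    (contDiff_mul_of_tsupport_subset hI hg' h1 h3).continuous.integrable_of_hasCompactSupport
      h2.mul_left
  have hd : ∀ z, HasDerivAt (fun z => g z * χ z) (deriv g z * χ z + g z * deriv χ z) z := by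
    intro z
    by_cases hz : z ∈ I
    · exact ((hg.differentiableOn (by simp)).differentiableAt
        (hI.mem_nhds hz)).hasDerivAt.mul ((h1.differentiable (by simp)) z).hasDerivAt
    · have hz' : z ∉ tsupport χ := fun h => hz (h3 h)
      have h0 : χ =ᶠ[𝓝 z] 0 := notMem_tsupport_iff_eventuallyEq.1 hz'
      rw [h0.eq_of_nhds, deriv_of_notMem_tsupport hz']
      refine ((hasDerivAt_const z (0 : ℝ)).congr_of_eventuallyEq ?_).congr_deriv (by simp)
      filter_upwards [h0] with s hs
      simp [hs]
  have h0 := integral_eq_zero_of_hasDerivAt_of_integrable hd (i2.add i1)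
    (i0.continuous.integrable_of_hasCompactSupport h2.mul_left)
  rw [integral_add i2 i1] at h0
  have e1 : ∫ z in I, g z * deriv χ z = ∫ z, g z * deriv χ z :=
    setIntegral_eq_integral_of_forall_compl_eq_zero fun z hz => by
      rw [deriv_of_notMem_tsupport fun h => hz (h3 h), mul_zero]
  have e2 : ∫ z in I, deriv g z * χ z = ∫ z, deriv g z * χ z :=
    setIntegral_eq_integral_of_forall_compl_eq_zero fun z hz => by
      rw [image_eq_zero_of_notMem_tsupport fun h => hz (h3 h), mul_zero]
  have key : ∫ z in I, g z * deriv χ z = -∫ z in I, deriv g z * χ z := by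
    rw [e1, e2]
    linarith
  simp only [← Complex.ofReal_mul]
  rw [integral_complex_ofReal, integral_complex_ofReal, key, Complex.ofReal_neg]

/-! ### Sobolev norms of superpositions and their growth in time. -/

namespace Config

variable {P : Config} {R₀ c B D : ℝ} {M : ModeFamily} {f L : Plane → ℝ} {a : Plane → ℝ → ℝ}
  {I : Set ℝ} {β t : ℝ}

lemma IsKernel.vderiv_iterate (ha : P.IsKernel B a) (n : ℕ) :
    P.IsKernel B fun ξ => iteratedDeriv n (a ξ) := by
  induction n with
  | zero => simpa using ha
  | succ n ih =>
    simp only [iteratedDeriv_succ]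
    exact ih.vderiv

/-- A Carathéodory function: continuous in z and measurable in ξ, hence jointly measurable on the
layers. -/
lemma IsKernel.aestronglyMeasurable (ha : P.IsKernel B a) :
    AEStronglyMeasurable (fun y : Plane × ℝ => a y.1 y.2)
      (volume.restrict ((univ : Set Plane) ×ˢ P.layers)) := by
  have hS : MeasurableSet ((univ : Set Plane) ×ˢ P.layers) :=
    MeasurableSet.univ.prod P.measurableSet_layers
  have hu : Measurable (Function.uncurry fun (z : P.layers) (ξ : Plane) => a ξ z) :=
    measurable_uncurry_of_continuous_of_measurable
      (fun ξ => (ha.smooth ξ).continuousOn.domRestrict) fun z => ha.meas z z.2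
  rw [← map_comap_subtype_coe hS, (MeasurableEmbedding.subtype_coe hS).aestronglyMeasurable_map_iff]
  refine Measurable.aestronglyMeasurable ?_
  have hφ : Measurable fun y : ((univ : Set Plane) ×ˢ P.layers : Set (Plane × ℝ)) =>
      ((⟨y.1.2, y.2.2⟩ : P.layers), y.1.1) :=
    (Measurable.subtype_mk (measurable_snd.comp measurable_subtype_coe)).prodMk
      (measurable_fst.comp measurable_subtype_coe)
  exact hu.comp hφ

lemma IsKernel.aestronglyMeasurable_amplitude (ha : P.IsKernel B a) (hL : IsRate B D L)
    (hI : I ⊆ P.layers) : AEStronglyMeasurable (fun y : Plane × ℝ => amplitude L a β t y.2 y.1)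
      (volume.restrict ((univ : Set Plane) ×ˢ I)) := by
  have h1 := ha.aestronglyMeasurable.mono_measure
    (Measure.restrict_mono (prod_mono (Subset.refl (univ : Set Plane)) hI) le_rfl)
  have h2 : Measurable fun y : Plane × ℝ => Real.exp (L y.1 * t) :=
    ((hL.meas.comp measurable_fst).mul_const t).exp
  exact (Complex.continuous_ofReal.comp_aestronglyMeasurable
    (h1.mul h2.aestronglyMeasurable)).mul_const _

lemma IsKernel.aestronglyMeasurable_synthR (ha : P.IsKernel B a) (hL : IsRate B D L)
    (hI : I ⊆ P.layers) (hm : MeasurableSet I) :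
    AEStronglyMeasurable (fun y : Plane × ℝ => (synthR L a β t y.1 y.2 : ℂ))
      (volume.restrict ((univ : Set Plane) ×ˢ I)) := by
  refine ContinuousOn.aestronglyMeasurable ?_ (MeasurableSet.univ.prod hm)
  refine Complex.continuous_ofReal.comp_continuousOn fun y hy => ?_
  have h := ((ha.hasFDerivAt_integral hL β (y := (t, y.1, y.2)) (hI hy.2)).continuousAt).const_mul
    (4 * Real.pi ^ 2)⁻¹
  have h2 : ContinuousAt (fun y : Plane × ℝ => (t, y.1, y.2)) y := by fun_prop
  exact (ContinuousAt.comp (f := fun y : Plane × ℝ => (t, y.1, y.2)) h h2).continuousWithinAt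

lemma norm_amplitude (z : ℝ) (ξ : Plane) :
    ‖amplitude L a β t z ξ‖ = |a ξ z| * Real.exp (L ξ * t) := by
  rw [amplitude, norm_mul, mul_comm Complex.I, Complex.norm_exp_ofReal_mul_I, mul_one,
    Complex.norm_real, Real.norm_eq_abs, abs_mul, Real.abs_exp]

lemma IsKernel.memLp_amplitude (ha : P.IsKernel B a) (hL : IsRate B D L) {z : ℝ}
    (hz : z ∈ P.layers) : MemLp (amplitude L a β t z) 2 := by
  obtain ⟨C, hC⟩ := ha.bound 0
  refine (memLp_indicator_const 2 (measurableSet_closedBall (x := (0 : Plane)) (ε := B))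
    (C * Real.exp (D * |t|)) (Or.inr measure_closedBall_lt_top.ne)).mono'
    (ha.integrable_amplitude hL β t hz).aestronglyMeasurable (Eventually.of_forall fun ξ => ?_)
  have h := ha.abs_wave_le hL (by simpa using hC) 0 (y := (t, 0, z)) hz le_rfl ξ
  rw [norm_amplitude]
  simpa [wave, abs_mul] using h

lemma IsKernel.isFourier_amplitude (ha : P.IsKernel B a) (hL : IsRate B D L)
    (hreal : ∀ t, ∀ z ∈ P.layers, ∀ x, (synthR L a β t x z : ℂ) = synth (amplitude L a β t z) x)
    {z : ℝ} (hz : z ∈ P.layers) :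
    IsFourier (fun x => (synthR L a β t x z : ℂ)) (amplitude L a β t z) := by
  have h := isFourier_synth (ha.integrable_amplitude hL β t hz) (ha.memLp_amplitude hL hz)
  simp only [hreal t z hz]
  exact h

/-- The horizontal Fourier transform of a superposition of plane waves together with its vertical
derivatives. -/
lemma IsKernel.isTransformJet (ha : P.IsKernel B a) (hL : IsRate B D L)
    (hreal : ∀ t, ∀ z ∈ P.layers, ∀ x, (synthR L a β t x z : ℂ) = synth (amplitude L a β t z) x)
    (hI : I ⊆ P.layers) (ho : IsOpen I) (k : ℕ) :
    IsTransformJet I k (fun x z => (synthR L a β t x z : ℂ))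
      fun j ξ z => amplitude L (fun ξ => iteratedDeriv j (a ξ)) β t z ξ where
  meas_u := ha.aestronglyMeasurable_synthR hL hI ho.measurableSet
  meas_D j _ := (ha.vderiv_iterate j).aestronglyMeasurable_amplitude hL hI
  fourier := (ae_restrict_iff' ho.measurableSet).2 (Eventually.of_forall fun z hz => by
    simpa using! ha.isFourier_amplitude hL hreal (hI hz))
  weakDeriv j _ := Eventually.of_forall fun ξ => by
    have h := (isWeakDeriv_of_contDiffOn ho (((ha.vderiv_iterate j).smooth ξ).mono hI)).const_mul
      ((Real.exp (L ξ * t) : ℂ) * Complex.exp (Complex.I * β))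
    convert! h using 2 with z z
    · rw [amplitude]; push_cast; ring
    · rw [amplitude, iteratedDeriv_succ]; push_cast; ring

lemma upper_subset : P.upper ⊆ P.layers := subset_union_right

lemma lower_subset : P.lower ⊆ P.layers := subset_union_left

lemma isOpen_upper : IsOpen P.upper := isOpen_Ioo

lemma isOpen_lower : IsOpen P.lower := isOpen_Ioo

lemma hkNorm_le_of_hkSq_le {k : ℕ} {u u' : Plane → ℝ → ℝ} {b : ℝ≥0∞}
    (h : ∀ I ⊆ P.layers, IsOpen I → hkSq I k (fun x z => (u' x z : ℂ))
      ≤ b ^ 2 * hkSq I k (fun x z => (u x z : ℂ))) : P.hkNorm k u' ≤ b * P.hkNorm k u := by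
  unfold hkNorm
  have e : b = (b ^ 2) ^ (1 / 2 : ℝ) := by
    rw [← ENNReal.rpow_natCast, ← ENNReal.rpow_mul]
    norm_num
  nth_rewrite 1 [e]
  rw [← ENNReal.mul_rpow_of_nonneg _ _ (by norm_num), mul_add]
  exact ENNReal.rpow_le_rpow (add_le_add (h _ upper_subset isOpen_upper)
    (h _ lower_subset isOpen_lower)) (by norm_num)

/-- Plane waves whose growth rates lie between `lo` and `hi` grow at these rates in the Sobolev
norms. -/
lemma IsKernel.hkNorm_growth (ha : P.IsKernel B a) (hL : IsRate B D L)
    (hreal : ∀ t, ∀ z ∈ P.layers, ∀ x, (synthR L a β t x z : ℂ) = synth (amplitude L a β t z) x)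
    {lo hi : ℝ} (hrate : ∀ ξ, (∃ z ∈ P.layers, a ξ z ≠ 0) → lo ≤ L ξ ∧ L ξ ≤ hi) (ht : 0 ≤ t)
    (k : ℕ) :
    ENNReal.ofReal (Real.exp (t * lo)) * P.hkNorm k (synthR L a β 0)
        ≤ P.hkNorm k (synthR L a β t) ∧
      P.hkNorm k (synthR L a β t)
        ≤ ENNReal.ofReal (Real.exp (t * hi)) * P.hkNorm k (synthR L a β 0) := by
  have hset : MeasurableSet {ξ | lo ≤ L ξ ∧ L ξ ≤ hi} :=
    (measurableSet_le measurable_const hL.meas).inter (measurableSet_le hL.meas measurable_const)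
  have hzero : ∀ ξ, ξ ∉ {ξ | lo ≤ L ξ ∧ L ξ ≤ hi} → ∀ z ∈ P.layers, a ξ z = 0 := by
    intro ξ hξ z hz
    by_contra h
    exact hξ (hrate ξ ⟨z, hz, h⟩)
  -- The state at s' is the multiplier e^{L(s'-s)} applied to the state at s. Cutting it off to
  -- rates in [lo, hi] makes it bounded everywhere and changes nothing, since the amplitude vanishes
  -- elsewhere. Going backward from t to 0 gives the lower estimate.
  have main : ∀ s s' b : ℝ, 0 < b → (∀ ξ, lo ≤ L ξ → L ξ ≤ hi → Real.exp (L ξ * (s' - s)) ≤ b) →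
      P.hkNorm k (synthR L a β s') ≤ ENNReal.ofReal b * P.hkNorm k (synthR L a β s) := by
    intro s s' b hb hle
    refine hkNorm_le_of_hkSq_le fun I hI ho => ?_
    refine hkSq_le_of_multiplier hb (U := fun ξ z => amplitude L a β s z ξ)
      (m := indicator {ξ | lo ≤ L ξ ∧ L ξ ≤ hi} fun ξ => Real.exp (L ξ * (s' - s)))
      ((hL.meas.mul_const _).exp.indicator hset) (fun ξ => ?_)
      (ha.aestronglyMeasurable_synthR hL hI ho.measurableSet)
      ((ae_restrict_iff' ho.measurableSet).2 (Eventually.of_forall fun z hz =>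
        ha.isFourier_amplitude hL hreal (hI hz)))
      ((ae_restrict_iff' ho.measurableSet).2 (Eventually.of_forall fun z hz => ?_))
    · by_cases hξ : ξ ∈ {ξ | lo ≤ L ξ ∧ L ξ ≤ hi}
      · rw [indicator_of_mem hξ, Real.abs_exp]
        exact hle ξ hξ.1 hξ.2
      · rw [indicator_of_notMem hξ, abs_zero]
        exact hb.le
    · have e : (fun ξ => ((indicator {ξ | lo ≤ L ξ ∧ L ξ ≤ hi}
          (fun ξ => Real.exp (L ξ * (s' - s))) ξ : ℝ) : ℂ) * amplitude L a β s z ξ)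
          = amplitude L a β s' z := by
        funext ξ
        by_cases hξ : ξ ∈ {ξ | lo ≤ L ξ ∧ L ξ ≤ hi}
        · rw [indicator_of_mem hξ, amplitude, amplitude]
          have : Real.exp (L ξ * s') = Real.exp (L ξ * (s' - s)) * Real.exp (L ξ * s) := by
            rw [← Real.exp_add]; ring_nf
          rw [this]
          push_cast
          ring
        · rw [indicator_of_notMem hξ, amplitude, amplitude, hzero ξ hξ z (hI hz)]
          simp
      rw [e]
      exact ha.isFourier_amplitude hL hreal (hI hz)
  constructor
  · have h := main t 0 (Real.exp (-(t * lo))) (Real.exp_pos _) fun ξ h1 _ => by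
      refine Real.exp_le_exp.2 ?_
      nlinarith
    calc _ ≤ ENNReal.ofReal (Real.exp (t * lo)) * (ENNReal.ofReal (Real.exp (-(t * lo))) *
          P.hkNorm k (synthR L a β t)) := by gcongr
      _ = P.hkNorm k (synthR L a β t) := by
        rw [← mul_assoc, ← ENNReal.ofReal_mul (Real.exp_pos _).le, ← Real.exp_add]
        simp
  · refine main 0 t (Real.exp (t * hi)) (Real.exp_pos _) fun ξ _ h2 => ?_
    refine Real.exp_le_exp.2 ?_
    nlinarith

end Config

/-! ### Bounds of the initial data. -/

namespace Config

variable {P : Config} {R₀ c B D : ℝ} {M : ModeFamily} {f L : Plane → ℝ} {a : Plane → ℝ → ℝ}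
  {I : Set ℝ} {β t : ℝ}

/-- The square of a weighted `L²` norm of the amplitude. -/
def weightSq (k : ℕ) (f : Plane → ℝ) : ℝ≥0∞ :=
  ∫⁻ ξ : Plane, ENNReal.ofReal ((1 + ‖ξ‖ ^ 2) ^ (k + 1) * |f ξ| ^ 2)

lemma weightSq_lt_top (k : ℕ) (hf : Continuous f) (hc : HasCompactSupport f) :
    weightSq k f < ⊤ := by
  refine Integrable.lintegral_lt_top (Continuous.integrable_of_hasCompactSupport (by fun_prop) ?_)
  refine hc.mono fun ξ hξ => ?_
  rw [Function.mem_support] at hξ ⊢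
  contrapose! hξ
  simp [hξ]

/-- The square of the size of a mode, cut off at the frequency `R₀`. -/
def ampSq (P : Config) (R₀ : ℝ) (M : ModeFamily) (ξ : Plane) (z : ℝ) : ℝ :=
  if R₀ < ‖ξ‖ then P.amp M ξ z ^ 2 else 0

lemma ampSq_nonneg (ξ : Plane) (z : ℝ) : 0 ≤ P.ampSq R₀ M ξ z := by
  unfold ampSq
  split_ifs <;> positivity

lemma exists_lintegral_ampSq_le (hB : P.GrowthBounds R₀ c) : ∃ C > 0, ∀ M : ModeFamily,
    P.IsNormalModeFamily R₀ M → ∀ ξ,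
      ∫⁻ z in P.layers, ENNReal.ofReal (P.ampSq R₀ M ξ z) ≤ ENNReal.ofReal C := by
  obtain ⟨C, hC, h⟩ := exists_amp_bound hB
  refine ⟨C, hC, fun M hM ξ => ?_⟩
  by_cases hξ : R₀ < ‖ξ‖
  · obtain ⟨h1, h2⟩ := h M hM ξ hξ
    simp only [ampSq, if_pos hξ]
    rw [← ofReal_integral_eq_lintegral_ofReal h1 (Eventually.of_forall fun z => sq_nonneg _)]
    exact ENNReal.ofReal_le_ofReal h2
  · simp [ampSq, if_neg hξ]

/-- The classical jet competes in the infimum. Integrating first in z uses the bound of A that is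
uniform in ξ, and the weights of orders k - j and j + 1 multiply to order k + 1. -/
lemma IsKernel.hkSq_le (ha : P.IsKernel B a) (hL : IsRate B D L)
    (hreal : ∀ t, ∀ z ∈ P.layers, ∀ x, (synthR L a β t x z : ℂ) = synth (amplitude L a β t z) x)
    {k : ℕ} {K C : ℝ} {A : Plane → ℝ → ℝ} (hK : 0 ≤ K)
    (hA : ∀ ξ, ∫⁻ z in P.layers, ENNReal.ofReal (A ξ z) ≤ ENNReal.ofReal C)
    (h : ∀ j ≤ k, ∀ ξ, ∀ z ∈ P.layers,
      iteratedDeriv j (a ξ) z ^ 2 ≤ K * (1 + ‖ξ‖ ^ 2) ^ (j + 1) * |f ξ| ^ 2 * A ξ z)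
    (hI : I ⊆ P.layers) (ho : IsOpen I) :
    hkSq I k (fun x z => (synthR L a β 0 x z : ℂ))
      ≤ (k + 1 : ℕ) * (ENNReal.ofReal K * ENNReal.ofReal C * weightSq k f) := by
  refine (iInf₂_le _ (ha.isTransformJet hL hreal hI ho k)).trans ?_
  rw [← nsmul_eq_mul]
  refine (Finset.sum_le_card_nsmul _ _ _ fun j hj => ?_).trans_eq (by rw [Finset.card_range])
  have hj' : j ≤ k := Nat.lt_succ_iff.1 (Finset.mem_range.1 hj)
  have hprod : (volume : Measure Plane).prod (volume.restrict I)
      = volume.restrict ((univ : Set Plane) ×ˢ I) := by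
    rw [← Measure.restrict_univ (μ := (volume : Measure Plane)), Measure.prod_restrict]
    rfl
  have hmeas : AEMeasurable (Function.uncurry fun (ξ : Plane) (z : ℝ) =>
      ENNReal.ofReal ((1 + ‖ξ‖ ^ 2) ^ (k - j)) *
        ‖amplitude L (fun ξ => iteratedDeriv j (a ξ)) β 0 z ξ‖ₑ ^ 2)
      ((volume : Measure Plane).prod (volume.restrict I)) := by
    rw [hprod]
    refine AEMeasurable.mul ?_
      (((ha.vderiv_iterate j).aestronglyMeasurable_amplitude hL hI).enorm.pow_const 2)
    have : Measurable fun y : Plane × ℝ => ENNReal.ofReal ((1 + ‖y.1‖ ^ 2) ^ (k - j)) := by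
      fun_prop
    exact this.aemeasurable
  rw [← lintegral_lintegral_swap hmeas, weightSq, ← lintegral_const_mul' _ _
    (ENNReal.mul_ne_top ENNReal.ofReal_ne_top ENNReal.ofReal_ne_top)]
  refine lintegral_mono fun ξ => ?_
  have hpt : ∀ z ∈ I, ENNReal.ofReal ((1 + ‖ξ‖ ^ 2) ^ (k - j)) *
      ‖amplitude L (fun ξ => iteratedDeriv j (a ξ)) β 0 z ξ‖ₑ ^ 2
      ≤ ENNReal.ofReal (K * ((1 + ‖ξ‖ ^ 2) ^ (k + 1) * |f ξ| ^ 2)) * ENNReal.ofReal (A ξ z) := by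
    intro z hz
    rw [← ofReal_norm, norm_amplitude, mul_zero, Real.exp_zero, mul_one,
      ← ENNReal.ofReal_pow (abs_nonneg _), ← ENNReal.ofReal_mul (by positivity),
      ← ENNReal.ofReal_mul (by positivity), sq_abs]
    refine ENNReal.ofReal_le_ofReal ?_
    have e : (1 + ‖ξ‖ ^ 2) ^ (k + 1) = (1 + ‖ξ‖ ^ 2) ^ (k - j) * (1 + ‖ξ‖ ^ 2) ^ (j + 1) := by
      rw [← pow_add]
      congr 1
      omega
    rw [e]
    calc _ ≤ (1 + ‖ξ‖ ^ 2) ^ (k - j) * (K * (1 + ‖ξ‖ ^ 2) ^ (j + 1) * |f ξ| ^ 2 * A ξ z) :=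
          mul_le_mul_of_nonneg_left (h j hj' ξ z (hI hz)) (by positivity)
      _ = _ := by ring
  refine (setLIntegral_mono' ho.measurableSet hpt).trans ?_
  rw [lintegral_const_mul' _ _ ENNReal.ofReal_ne_top, ENNReal.ofReal_mul hK]
  calc _ ≤ ENNReal.ofReal K * ENNReal.ofReal ((1 + ‖ξ‖ ^ 2) ^ (k + 1) * |f ξ| ^ 2)
        * ENNReal.ofReal C := by
        gcongr
        exact (lintegral_mono_set hI).trans (hA ξ)
    _ = _ := by ring

lemma hkNorm_sq (k : ℕ) (u : Plane → ℝ → ℝ) : P.hkNorm k u ^ 2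
    = hkSq P.upper k (fun x z => (u x z : ℂ)) + hkSq P.lower k (fun x z => (u x z : ℂ)) := by
  rw [hkNorm, ← ENNReal.rpow_natCast, ← ENNReal.rpow_mul]
  norm_num

lemma IsKernel.hkNorm_sq_le (ha : P.IsKernel B a) (hL : IsRate B D L)
    (hreal : ∀ t, ∀ z ∈ P.layers, ∀ x, (synthR L a β t x z : ℂ) = synth (amplitude L a β t z) x)
    {k : ℕ} {K C : ℝ} {A : Plane → ℝ → ℝ} (hK : 0 ≤ K)
    (hA : ∀ ξ, ∫⁻ z in P.layers, ENNReal.ofReal (A ξ z) ≤ ENNReal.ofReal C)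
    (h : ∀ j ≤ k, ∀ ξ, ∀ z ∈ P.layers,
      iteratedDeriv j (a ξ) z ^ 2 ≤ K * (1 + ‖ξ‖ ^ 2) ^ (j + 1) * |f ξ| ^ 2 * A ξ z) :
    P.hkNorm k (synthR L a β 0) ^ 2
      ≤ ENNReal.ofReal (2 * (k + 1) * K * C) * weightSq k f := by
  rw [hkNorm_sq]
  refine (add_le_add (ha.hkSq_le hL hreal hK hA h upper_subset isOpen_upper)
    (ha.hkSq_le hL hreal hK hA h lower_subset isOpen_lower)).trans_eq ?_
  have : ((k + 1 : ℕ) : ℝ≥0∞) = ENNReal.ofReal (k + 1) := by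
    rw [← ENNReal.ofReal_natCast]
    push_cast
    rfl
  rw [ENNReal.ofReal_mul (by positivity), ENNReal.ofReal_mul (by positivity),
    ENNReal.ofReal_mul (by positivity), this, ENNReal.ofReal_ofNat]
  ring

lemma IsModeFunction.exists_sq_le {h : ModeFamily → Plane → ℝ → ℝ} (H : P.IsModeFunction R₀ h)
    (hB : P.GrowthBounds R₀ c) (k : ℕ) :
    ∃ K > 0, ∀ M, P.IsNormalModeFamily R₀ M → (∀ ξ, ‖ξ‖ ≤ R₀ → ∀ z, h M ξ z = 0) →
      ∀ j ≤ k, ∀ ξ, ∀ z ∈ P.layers,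
        iteratedDeriv j (h M ξ) z ^ 2 ≤ K * (‖ξ‖ ^ 2) ^ j * P.ampSq R₀ M ξ z := by
  choose C hC h1 using fun j => H.bound hB j
  have hpos : ∀ j, 0 < C j ^ 2 := fun j => pow_pos (hC j) 2
  refine ⟨∑ j ∈ Finset.range (k + 1), C j ^ 2, Finset.sum_pos (fun j _ => hpos j) (by simp),
    fun M hM h0 j hj ξ z hz => ?_⟩
  by_cases hξ : R₀ < ‖ξ‖
  · rw [ampSq, if_pos hξ, ← sq_abs]
    have hamp := amp_nonneg (P := P) (M := M) ξ z
    calc _ ≤ (C j * ‖ξ‖ ^ j * P.amp M ξ z) ^ 2 := by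
          gcongr
          exact h1 j M hM ξ hξ z hz
      _ = C j ^ 2 * (‖ξ‖ ^ 2) ^ j * P.amp M ξ z ^ 2 := by ring
      _ ≤ _ := by
          gcongr
          exact Finset.single_le_sum (fun j _ => (hpos j).le) (Finset.mem_range.2 (by omega))
  · have : h M ξ = fun _ => 0 := funext (h0 ξ (not_lt.1 hξ))
    rw [this, ampSq, if_neg hξ]
    simp

lemma IsNormalModeFamily.profile_eq_zero (hM : P.IsNormalModeFamily R₀ M) (i : Fin 3) {ξ : Plane}
    (hξ : ‖ξ‖ ≤ R₀) (z : ℝ) : M.profile i ξ z = 0 := by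
  fin_cases i
  · exact hM.zero_φ ξ hξ z
  · exact hM.zero_θ ξ hξ z
  · exact hM.zero_ψ ξ hξ z

lemma isModeFunction_profile (hB : P.GrowthBounds R₀ c) (i : Fin 3) :
    P.IsModeFunction R₀ fun M => M.profile i := by
  fin_cases i
  · exact isModeFunction_phi hB
  · exact isModeFunction_theta hB
  · exact isModeFunction_psi

lemma rpow_half_sq (x : ℝ≥0∞) : (x ^ 2) ^ (1 / 2 : ℝ) = x := by
  rw [← ENNReal.rpow_natCast, ← ENNReal.rpow_mul]
  norm_num

lemma hkNormVec_le {k : ℕ} {u : Fin 3 → Plane → ℝ → ℝ} {Q : ℝ≥0∞}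
    (h : ∀ i, P.hkNorm k (u i) ^ 2 ≤ Q) : P.hkNormVec k u ≤ (3 * Q) ^ (1 / 2 : ℝ) := by
  refine ENNReal.rpow_le_rpow ?_ (by norm_num)
  refine (Finset.sum_le_card_nsmul _ _ _ fun i _ => h i).trans_eq ?_
  simp

/-- The initial data are bounded by a weighted norm of `f`, uniformly in the family of modes. -/
theorem exists_initial_bound (hB : P.GrowthBounds R₀ c) (k : ℕ) : ∃ C > 0, ∀ M : ModeFamily,
    P.IsNormalModeFamily R₀ M → ∀ (B : ℝ) (f : Plane → ℝ), Continuous f →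
      (∀ ξ, B < ‖ξ‖ → f ξ = 0) → (∀ ξ ξ' : Plane, ‖ξ‖ = ‖ξ'‖ → f ξ = f ξ') →
        P.hkNormVec k (fun i => M.flow f i 0) + P.hkNormVec k (fun i => M.velocity f i 0)
          + P.hkNorm k (M.density f P 0) ≤ ENNReal.ofReal C * weightSq k f ^ (1 / 2 : ℝ) := by
  obtain ⟨A, hA, hamp⟩ := exists_lintegral_ampSq_le hB
  choose Kw hKw hw using fun i => (isModeFunction_profile hB i).exists_sq_le hB k
  obtain ⟨Kd, hKd, hd⟩ := isModeFunction_dens.exists_sq_le hB k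
  have hg := P.g_pos
  set K := (∑ i, Kw i + Kd) * (1 + P.g)
  have hsum : 0 < ∑ i, Kw i := Finset.sum_pos (fun i _ => hKw i) (by simp)
  have hK : 0 < K := by positivity
  have hKw' : ∀ i, Kw i ≤ ∑ i, Kw i + Kd := fun i =>
    (Finset.single_le_sum (fun i _ => (hKw i).le) (Finset.mem_univ i)).trans (by linarith)
  set q : ℝ := 2 * (k + 1) * K * A
  have hq : 0 < q := by positivity
  -- One factor 3 counts η, v and q, the other the components of a vector; the scalar q is given the
  -- same bound generously.
  refine ⟨3 * √(3 * q), by positivity, fun M hM B f hf hsupp hrad => ?_⟩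
  have hL := hB.isRate hM B
  have kw := hM.isKernel_profile hB hf hsupp
  have kd := hM.isKernel_dens hB hf hsupp
  have hpow : ∀ (ξ : Plane) (j : ℕ), (‖ξ‖ ^ 2) ^ j ≤ (1 + ‖ξ‖ ^ 2) ^ j := fun ξ j => by
    gcongr
    linarith
  have hpow' : ∀ (ξ : Plane) (j : ℕ), (‖ξ‖ ^ 2) ^ j ≤ (1 + ‖ξ‖ ^ 2) ^ (j + 1) := fun ξ j =>
    (hpow ξ j).trans (pow_le_pow_right₀ (by nlinarith [sq_nonneg ‖ξ‖]) (Nat.le_succ j))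
  have b1 : ∀ i, P.hkNorm k (M.flow f i 0) ^ 2 ≤ ENNReal.ofReal q * weightSq k f := fun i =>
    (kw i).hkNorm_sq_le hL (fun t z hz x => by
      rw [amplitude_flow]; exact hM.ofReal_flow hB hf hsupp hrad i t x hz) hK.le
      (hamp M hM) fun j hj ξ z hz => by
        rw [iteratedDeriv_const_mul_field', mul_pow, ← sq_abs (f ξ)]
        have h1 := hw i M hM (fun ξ hξ z => hM.profile_eq_zero i hξ z) j hj ξ z hz
        have h2 := ampSq_nonneg (P := P) (R₀ := R₀) (M := M) ξ z
        have h3 : Kw i ≤ K := (hKw' i).trans (le_mul_of_one_le_right (by linarith [hKw i, hKw' i])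
          (by linarith))
        calc _ ≤ |f ξ| ^ 2 * (K * (1 + ‖ξ‖ ^ 2) ^ (j + 1) * P.ampSq R₀ M ξ z) := by
              refine mul_le_mul_of_nonneg_left (h1.trans ?_) (by positivity)
              have := hpow' ξ j
              gcongr
          _ = _ := by ring
  have b2 : ∀ i, P.hkNorm k (M.velocity f i 0) ^ 2 ≤ ENNReal.ofReal q * weightSq k f := fun i =>
    ((kw i).rate_mul hL).hkNorm_sq_le hL (fun t z hz x => by
      rw [amplitude_velocity]; exact hM.ofReal_velocity hB hf hsupp hrad i t x hz) hK.le
      (hamp M hM) fun j hj ξ z hz => by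
        rw [iteratedDeriv_const_mul_field', iteratedDeriv_const_mul_field', mul_pow, mul_pow,
          ← sq_abs (f ξ)]
        have h1 := hw i M hM (fun ξ hξ z => hM.profile_eq_zero i hξ z) j hj ξ z hz
        have h2 := ampSq_nonneg (P := P) (R₀ := R₀) (M := M) ξ z
        -- The extra factor λ of the velocity takes up the spare power of the weight and the factor
        -- 1 + g in K.
        have h3 : M.lam ‖ξ‖ ^ 2 ≤ (1 + P.g) * (1 + ‖ξ‖ ^ 2) := by
          rcases le_or_gt ‖ξ‖ R₀ with h | h
          · rw [hM.zero_lam _ h, zero_pow two_ne_zero]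
            positivity
          · have h4 := hB.lam_sq_le hM h
            have h5 : ‖ξ‖ ≤ 1 + ‖ξ‖ ^ 2 := by nlinarith [sq_nonneg (‖ξ‖ - 1)]
            have h6 := mul_le_mul_of_nonneg_left h5 hg.le
            have h7 : 0 ≤ 1 + ‖ξ‖ ^ 2 := by positivity
            linarith
        have h4 := hKw' i
        have h5 := (hKw i).le
        calc _ ≤ ((1 + P.g) * (1 + ‖ξ‖ ^ 2)) * (|f ξ| ^ 2 *
              ((∑ i, Kw i + Kd) * (1 + ‖ξ‖ ^ 2) ^ j * P.ampSq R₀ M ξ z)) := by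
              refine mul_le_mul h3 (mul_le_mul_of_nonneg_left (h1.trans ?_) (by positivity))
                (by positivity) (by positivity)
              have := hpow ξ j
              gcongr
          _ = _ := by simp only [K]; ring
  have b3 : P.hkNorm k (M.density f P 0) ^ 2 ≤ ENNReal.ofReal q * weightSq k f :=
    kd.hkNorm_sq_le hL (fun t z hz x => by
      rw [amplitude_density]; exact hM.ofReal_density hB hf hsupp hrad t x hz) hK.le
      (hamp M hM) fun j hj ξ z hz => by
        rw [iteratedDeriv_const_mul_field', mul_pow, ← sq_abs (f ξ)]
        have h1 := hd M hM (fun ξ hξ z => congrFun (hM.dens_eq_zero hξ) z) j hj ξ z hz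
        have h2 := ampSq_nonneg (P := P) (R₀ := R₀) (M := M) ξ z
        have h3 : Kd ≤ K := by
          refine le_trans (by linarith : Kd ≤ ∑ i, Kw i + Kd) ?_
          exact le_mul_of_one_le_right (by linarith) (by linarith)
        calc _ ≤ |f ξ| ^ 2 * (K * (1 + ‖ξ‖ ^ 2) ^ (j + 1) * P.ampSq R₀ M ξ z) := by
              refine mul_le_mul_of_nonneg_left (h1.trans ?_) (by positivity)
              have := hpow' ξ j
              gcongr
          _ = _ := by ring
  have b3' : P.hkNorm k (M.density f P 0)
      ≤ (3 * (ENNReal.ofReal q * weightSq k f)) ^ (1 / 2 : ℝ) := by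
    rw [← rpow_half_sq (P.hkNorm k (M.density f P 0))]
    refine ENNReal.rpow_le_rpow (b3.trans ?_) (by norm_num)
    exact le_mul_of_one_le_left zero_le (by norm_num)
  refine (add_le_add (add_le_add (hkNormVec_le b1) (hkNormVec_le b2)) b3').trans_eq ?_
  have e : (3 * (ENNReal.ofReal q * weightSq k f)) ^ (1 / 2 : ℝ)
      = ENNReal.ofReal √(3 * q) * weightSq k f ^ (1 / 2 : ℝ) := by
    rw [← mul_assoc, ENNReal.mul_rpow_of_nonneg _ _ (by norm_num), Real.sqrt_eq_rpow,
      ← ENNReal.ofReal_rpow_of_nonneg (by positivity) (by norm_num),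
      ENNReal.ofReal_mul (p := 3) (q := q) (by norm_num), ENNReal.ofReal_ofNat]
  rw [e, ENNReal.ofReal_mul (by norm_num), ENNReal.ofReal_ofNat]
  ring

lemma hkNormVec_mono {k : ℕ} {u u' : Fin 3 → Plane → ℝ → ℝ} {b b' : ℝ≥0∞}
    (h : ∀ i, b * P.hkNorm k (u i) ≤ b' * P.hkNorm k (u' i)) :
    b * P.hkNormVec k u ≤ b' * P.hkNormVec k u' := by
  have e : ∀ (b : ℝ≥0∞) (u : Fin 3 → Plane → ℝ → ℝ),
      b * P.hkNormVec k u = (∑ i, (b * P.hkNorm k (u i)) ^ 2) ^ (1 / 2 : ℝ) := by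
    intro b u
    simp only [mul_pow, ← Finset.mul_sum]
    rw [ENNReal.mul_rpow_of_nonneg _ _ (by norm_num), rpow_half_sq, hkNormVec]
  rw [e, e]
  refine ENNReal.rpow_le_rpow (Finset.sum_le_sum fun i _ => ?_) (by norm_num)
  exact pow_le_pow_left' (h i) 2

lemma twoSided_vec {k : ℕ} {x y : ℝ} {u u' : Fin 3 → Plane → ℝ → ℝ} (hu : P.hkNormVec k u < ⊤)
    (h : ∀ i, ENNReal.ofReal x * P.hkNorm k (u i) ≤ P.hkNorm k (u' i) ∧
      P.hkNorm k (u' i) ≤ ENNReal.ofReal y * P.hkNorm k (u i)) :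
    TwoSided x y (P.hkNormVec k u) (P.hkNormVec k u') := by
  have h1 : ENNReal.ofReal x * P.hkNormVec k u ≤ 1 * P.hkNormVec k u' :=
    hkNormVec_mono fun i => by rw [one_mul]; exact (h i).1
  have h2 : 1 * P.hkNormVec k u' ≤ ENNReal.ofReal y * P.hkNormVec k u :=
    hkNormVec_mono fun i => by rw [one_mul]; exact (h i).2
  rw [one_mul] at h1 h2
  exact ⟨hu, h2.trans_lt (ENNReal.mul_lt_top ENNReal.ofReal_lt_top hu), h1, h2⟩

end Config

end

end RTI

/-! ### The theorem. -/

open RTI in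
theorem theorem2p3 (P : RTI.Config) :
    ∃ (R₀ C₄ : ℝ) (C : ℕ → ℝ), 1 < R₀ ∧ 0 < C₄ ∧ 2 ≤ C₄ * R₀ ∧ (∀ k, 0 < C k) ∧
      (∃ M : ModeFamily, P.IsNormalModeFamily R₀ M) ∧
      ∀ M : ModeFamily, P.IsNormalModeFamily R₀ M →
      ∀ (R₃ R₄ : ℝ) (f : Plane → ℝ), R₀ ≤ R₃ → R₃ < R₄ →
        ContDiff ℝ ∞ f → HasCompactSupport f →
        (∀ ξ ξ' : Plane, ‖ξ‖ = ‖ξ'‖ → f ξ = f ξ') →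
        tsupport f ⊆ Metric.closedBall 0 R₄ \ Metric.ball 0 R₃ →
        (∀ t ≥ 0, ∀ z ∈ P.layers,
          (∀ i, Integrable (M.etaHat f i t z)) ∧ (∀ i, Integrable (M.vHat f i t z)) ∧
            Integrable (M.qHat f P t z)) ∧
        ∃ (η v : Fin 3 → ℝ → Plane → ℝ → ℝ) (q : ℝ → Plane → ℝ → ℝ),
          (∀ t ≥ 0, ∀ x, ∀ z ∈ P.layers,
            (∀ i, (η i t x z : ℂ) = synth (M.etaHat f i t z) x) ∧
            (∀ i, (v i t x z : ℂ) = synth (M.vHat f i t z) x) ∧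
            (q t x z : ℂ) = synth (M.qHat f P t z) x) ∧
          P.IsLinearSolution η v q ∧
          (∀ k : ℕ,
            P.hkNormVec k (fun i => η i 0) + P.hkNormVec k (fun i => v i 0) + P.hkNorm k (q 0)
                ≤ ENNReal.ofReal (C k) *
                  (∫⁻ ξ : Plane, ENNReal.ofReal ((1 + ‖ξ‖ ^ 2) ^ (k + 1) * |f ξ| ^ 2))
                    ^ (1 / 2 : ℝ) ∧
            (∫⁻ ξ : Plane, ENNReal.ofReal ((1 + ‖ξ‖ ^ 2) ^ (k + 1) * |f ξ| ^ 2)) < ⊤) ∧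
          (∀ k : ℕ, ∀ t > 0,
            TwoSided (Real.exp (t * √(C₄ * R₃ - 1))) (Real.exp (t * √(P.g * R₄)))
              (P.hkNormVec k (fun i => η i 0)) (P.hkNormVec k (fun i => η i t)) ∧
            TwoSided (Real.exp (t * √(C₄ * R₃ - 1))) (Real.exp (t * √(P.g * R₄)))
              (P.hkNormVec k (fun i => v i 0)) (P.hkNormVec k (fun i => v i t)) ∧
            TwoSided (Real.exp (t * √(C₄ * R₃ - 1))) (Real.exp (t * √(P.g * R₄)))
              (P.hkNorm k (q 0)) (P.hkNorm k (q t))) := by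
  obtain ⟨R₀, c, hB⟩ := P.exists_growthBounds
  choose C hC hinit using fun k => Config.exists_initial_bound hB k
  refine ⟨R₀, c, C, hB.one_lt, hB.pos, hB.two_le, hC, ⟨P.modeFamily R₀,
    Config.isNormalModeFamily_modeFamily (zero_lt_one.trans hB.one_lt) fun r hr => ⟨hB.isGLB r hr,
      (mul_pos hB.pos (hB.pos_of_lt hr)).trans_le (hB.lower r hr)⟩⟩, ?_⟩
  intro M hM R₃ R₄ f h03 h34 hf hc hrad hts
  have hfc := hf.continuous
  have hmem : ∀ ξ, f ξ ≠ 0 → R₃ ≤ ‖ξ‖ ∧ ‖ξ‖ ≤ R₄ := fun ξ hξ => by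
    have h := hts (subset_tsupport f hξ)
    simpa [and_comm] using h
  have hsupp : ∀ ξ, R₄ < ‖ξ‖ → f ξ = 0 := fun ξ hξ => by
    by_contra h
    exact absurd (hmem ξ h).2 (not_le.2 hξ)
  have hL := hB.isRate hM R₄
  have kw := hM.isKernel_profile hB hfc hsupp
  have kd := hM.isKernel_dens hB hfc hsupp
  -- The -1 under the root is slack, since cR₃ ≤ λ² already holds on these frequencies.
  have hrate : ∀ ξ, f ξ ≠ 0 → R₀ < ‖ξ‖ →
      √(c * R₃ - 1) ≤ M.lam ‖ξ‖ ∧ M.lam ‖ξ‖ ≤ √(P.g * R₄) := by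
    intro ξ hξ h0
    obtain ⟨h3, h4⟩ := hmem ξ hξ
    constructor
    · refine Real.sqrt_le_iff.2 ⟨(hM.lam_pos _ h0).le, ?_⟩
      have h5 := hB.le_lam_sq hM h0
      have h6 := mul_le_mul_of_nonneg_left h3 hB.pos.le
      linarith
    · exact Real.le_sqrt_of_sq_le ((hB.lam_sq_le hM h0).trans
        (mul_le_mul_of_nonneg_left h4 P.g_pos.le))
  -- If R₃ = R₀, then f may be nonzero on |ξ| = R₀, where λ = 0. The modes vanish there too, so a
  -- nonzero amplitude forces |ξ| > R₀.
  have hw : ∀ i ξ, (∃ z ∈ P.layers, f ξ * M.profile i ξ z ≠ 0) →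
      √(c * R₃ - 1) ≤ M.lam ‖ξ‖ ∧ M.lam ‖ξ‖ ≤ √(P.g * R₄) := by
    rintro i ξ ⟨z, _, hz⟩
    refine hrate ξ (left_ne_zero_of_mul hz) (lt_of_not_ge fun h => ?_)
    exact right_ne_zero_of_mul hz (hM.profile_eq_zero i h z)
  have hd : ∀ ξ, (∃ z ∈ P.layers, f ξ * P.dens M ξ z ≠ 0) →
      √(c * R₃ - 1) ≤ M.lam ‖ξ‖ ∧ M.lam ‖ξ‖ ≤ √(P.g * R₄) := by
    rintro ξ ⟨z, _, hz⟩
    refine hrate ξ (left_ne_zero_of_mul hz) (lt_of_not_ge fun h => ?_)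
    exact right_ne_zero_of_mul hz (congrFun (hM.dens_eq_zero h) z)
  refine ⟨fun t _ z hz => ⟨fun i => hM.integrable_etaHat hB hfc hsupp i t hz,
    fun i => hM.integrable_vHat hB hfc hsupp i t hz, hM.integrable_qHat hB hfc hsupp t hz⟩,
    M.flow f, M.velocity f, M.density f P, fun t _ x z hz =>
      ⟨fun i => hM.ofReal_flow hB hfc hsupp hrad i t x hz,
        fun i => hM.ofReal_velocity hB hfc hsupp hrad i t x hz,
        hM.ofReal_density hB hfc hsupp hrad t x hz⟩,
    hM.isLinearSolution hB hfc hsupp, fun k => ⟨hinit k M hM R₄ f hfc hsupp hrad,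
      Config.weightSq_lt_top k hfc hc⟩, fun k t ht => ?_⟩
  have hfin := (hinit k M hM R₄ f hfc hsupp hrad).trans_lt (ENNReal.mul_lt_top
    ENNReal.ofReal_lt_top (ENNReal.rpow_lt_top_of_nonneg (by norm_num)
      (Config.weightSq_lt_top k hfc hc).ne))
  rw [ENNReal.add_lt_top, ENNReal.add_lt_top] at hfin
  obtain ⟨⟨hfw, hfv⟩, hfq⟩ := hfin
  refine ⟨Config.twoSided_vec hfw fun i => ?_, Config.twoSided_vec hfv fun i => ?_, ?_⟩
  · exact (kw i).hkNorm_growth hL (fun t z hz x => by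
      rw [Config.amplitude_flow]; exact hM.ofReal_flow hB hfc hsupp hrad i t x hz) (hw i) ht.le k
  · refine ((kw i).rate_mul hL).hkNorm_growth hL (fun t z hz x => by
      rw [Config.amplitude_velocity]
      exact hM.ofReal_velocity hB hfc hsupp hrad i t x hz) ?_ ht.le k
    rintro ξ ⟨z, hz, h⟩
    exact hw i ξ ⟨z, hz, right_ne_zero_of_mul h⟩
  · obtain ⟨h1, h2⟩ := kd.hkNorm_growth hL (fun t z hz x => by
      rw [Config.amplitude_density]
      exact hM.ofReal_density hB hfc hsupp hrad t x hz) hd ht.le k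
    exact ⟨hfq, h2.trans_lt (ENNReal.mul_lt_top ENNReal.ofReal_lt_top hfq), h1, h2⟩
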